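/- **Setting.** Let $F$ be a Fano manifold (only the following structure matters, and the statement holds for every system of this kind). Let $H=H^{\mathrm{ev}}(F;\mathbb C)$ be its even cohomology ring, $N=\dim_{\mathbb C}H$, with Poincaré pairing $(\alpha,\beta)_F=\int_F\alpha\cup\beta$, and let $\langle\alpha_1,\dots,\alpha_n\rangle_{0,n,d}$ ($n\ge 3$, $d$ an effective curve class) be its genus-zero Gromov–Witten invariants, which satisfy the Kontsevich–Manin axioms (symmetry and multilinearity, dimension, mapping to a point, fundamental class, divisor, WDVV splitting). The quantum product $\star_\tau$, $\tau\in H$, is defined by $$(\alpha_1\star_\tau\alpha_2,\alpha_3)_F=\sum_{d}\sum_{n\ge 0}\frac1{n!}\langle\alpha_1,\alpha_2,\alpha_3,\tau,\dots,\tau\rangle_{0,n+3,d}.$$ Let $\mu=p-\tfrac12\dim F$ on $H^{2p}(F)$, and let $E=c_1(F)+\sum_i(1-\tfrac12\deg\phi_i)\tau^i\phi_i$ for $\tau=\sum_i\tau^i\phi_i$ in a homogeneous basis $(\phi_i)$. The big quantum connection is $$\nabla_\alpha=\partial_\alpha+\tfrac1z(\alpha\star_\tau)\quad(\alpha\in H),\qquad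 \nabla_{z\partial_z}=z\partial_z-\tfrac1z(E\star_\tau)+\mu .$$ **Assumptions.** Let $B\subset H$ be an open neighbourhood of $\tau_0$ on which $\star_\tau$ converges to an analytic product (for each $d$ the sum over $n$ converges, and the sum over $d$ converges locally uniformly in $\tau$), and suppose that for each $\tau\in B$ the algebra $(H,\star_\tau)$ is semisimple, i.e. has a basis $\psi_1,\dots,\psi_N$ with $\psi_i\star_\tau\psi_j=\delta_{ij}\psi_i$. The vectors $\Psi_i=\psi_i/\sqrt{(\psi_i,\psi_i)_F}$ are the normalized idempotents; they are unique up to sign and order. Choose them at $\tau_0$, and let $E\star_{\tau_0}\Psi_i=u_{i,0}\Psi_i$; the $u_{i,0}$ may coincide. Let $\phi\in\mathbb R$ be an admissible phase, i.e. $e^{-\mathtt i\phi}(u_{i,0}-u_{j,0})\notin\mathbb R_{>0}$ for all $i,j$. **Claim.** After shrinking $B$ to a smaller open neighbourhood of $\tau_0$, the chosen $\Psi_i$ extend to normalized idempotents $\Psi_i(\tau)$ depending analytically on $\tau\in B$, with analytic eigenvalues $u_i(\tau)$, $E\star_\tau\Psi_i=u_i\Psi_i$, $u_i(\tau_0)=u_{i,0}$.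 Write $\Psi=(\Psi_1,\dots,\Psi_N)$ and $U=\operatorname{diag}(u_1,\dots,u_N)$. There are $\epsilon\in(0,\tfrac\pi2)$ and a fundamental solution $Y_\tau(z)=(y_1(\tau,z),\dots,y_N(\tau,z))$ of $\nabla$, analytic in $(\tau,z)$ for $\tau\in B$ and $z$ in the sector $|\arg z-\phi|<\frac\pi2+\epsilon$, such that for every $\tau\in B$ $$Y_\tau(z)e^{U/z}\to\Psi\quad\text{as } z\to0 \text{ in the sector } |\arg z-\phi|<\tfrac\pi2+\epsilon .$$ Moreover: 1. $Y_\tau$ is unique: for each $\tau\in B$ and $0<\delta\le\epsilon$, a solution of $\nabla_{z\partial_z}Y=0$ in the sector $|\arg z-\phi|<\frac\pi2+\delta$ with $Ye^{U/z}\to\Psi$ as $z\to 0$ in that sector equals $Y_\tau$ there. 2. The same holds, with the same $B$, $\epsilon$, $\Psi$, $U$, for the direction $-e^{\mathtt i\phi}$, that is, with $\phi+\pi$ in place of $\phi$; if $Y^-_\tau=(y^-_1,\dots,y^-_N)$ is the corresponding solution, then $(y^-_i(\tau,-z),y_j(\tau,z))_F=\delta_{ij}$ for all $\tau\in B$ and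 all $z$ with $|\arg z-\phi|<\frac\pi2+\epsilon$. 3. A semisimple point is not a turning point: there is a formal solution $\Psi(\mathrm{id}+R_1z+R_2z^2+\cdots)e^{-U/z}$ of $\nabla$ over $B$ whose coefficients $R_k$ are analytic in $\tau\in B$, and for every $\tau \in B$ one has $Y_\tau(z)e^{U/z}\sim\Psi(\mathrm{id}+R_1z+R_2z^2+\cdots)$ as $z\to0$ in the sector $|\arg z-\phi|<\frac\pi2+\epsilon$. -/

import Mathlib

open Complex Filter Topology Asymptotics

/-- The even cohomology ring `H = H^{ev}(F; ℂ)` (cup product, `grade p = H^{2p}(F)`, integration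
over `F`, Poincaré duality, first Chern class) of a connected smooth projective variety `F`,
together with its genus-zero Gromov–Witten invariants, subject to the Kontsevich–Manin axioms.
`D` is the monoid of effective curve classes in `H_2(F; ℤ)`; a class in it is the sum of two
others in finitely many ways. The norm on `H` only serves to do calculus on this
finite-dimensional vector space. Fano manifolds are a special case: positivity of `c₁` is not
required.

Even classes commute, so `⟨α₁, …, αₙ⟩_{0,n,d}` depends on the multiset `{α₁, …, αₙ}` only; it
is written `gw d {α₁, …, αₙ}`. Only invariants with at least three insertions are used. -/
structure GromovWittenTheory (H D : Type*) [NormedCommRing H] [NormedAlgebra ℂ H]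
    [AddCommMonoid D] [Finset.HasAntidiagonal D] where
  /-- `grade p` is `H^{2p}(F)` -/
  grade : ℕ → Submodule ℂ H
  [gradedAlgebra : GradedAlgebra grade]
  /-- `F` is connected -/
  grade_zero : ∀ a ∈ grade 0, ∃ c : ℂ, a = algebraMap ℂ H c
  /-- the complex dimension of `F` -/
  dim : ℕ
  /-- integration over `F` -/
  integral : H →ₗ[ℂ] ℂ
  integral_eq_zero : ∀ p, p ≠ dim → ∀ a ∈ grade p, integral a = 0
  /-- Poincaré duality -/
  poincare_duality : ∀ a, (∀ b, integral (a * b) = 0) → a = 0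
  /-- the first Chern class of `F` -/
  c₁ : H
  c₁_mem : c₁ ∈ grade 1
  /-- `curveIntegral d h = ∫_d h`; only the values at `h ∈ H²(F)` are used -/
  curveIntegral : D →+ (H →ₗ[ℂ] ℂ)
  /-- the genus-zero Gromov–Witten invariants -/
  gw : D → Multiset H → ℂ
  /-- multilinearity -/
  gw_linear : ∀ d s, 2 ≤ s.card → IsLinearMap ℂ fun a => gw d (a ::ₘ s)
  /-- the dimension axiom: an invariant of homogeneous classes `αᵢ ∈ H^{2pᵢ}(F)` vanishes unless
  `∑ pᵢ = dim F + c₁(F) · d + n - 3`; the members of `s` are the pairs `(pᵢ, αᵢ)` -/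
  gw_dimension : ∀ d (s : Multiset (ℕ × H)), 3 ≤ s.card → (∀ x ∈ s, x.2 ∈ grade x.1) →
    (((s.map Prod.fst).sum : ℕ) : ℂ) ≠ dim + curveIntegral d c₁ + s.card - 3 →
    gw d (s.map Prod.snd) = 0
  /-- the mapping-to-a-point axiom -/
  gw_zero_three : ∀ a b c, gw 0 {a, b, c} = integral (a * b * c)
  gw_zero_of_card : ∀ s : Multiset H, 4 ≤ s.card → gw 0 s = 0
  /-- the fundamental class axiom -/
  gw_one : ∀ d (s : Multiset H), (3 ≤ s.card ∨ s.card = 2 ∧ d ≠ 0) → gw d (1 ::ₘ s) = 0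
  /-- the divisor axiom -/
  gw_divisor : ∀ d, ∀ h ∈ grade 1, ∀ s : Multiset H, 3 ≤ s.card →
    gw d (h ::ₘ s) = curveIntegral d h * gw d s
  /-- the splitting axiom (WDVV): for Poincaré-dual bases `(e i)`, `(e' i)`, the sum over all
  splittings of the degree `d` and of the insertions `s` is unchanged when `a₂` and `a₃` are
  interchanged -/
  gw_splitting : ∀ e e' : Module.Basis (Fin (Module.finrank ℂ H)) ℂ H,
    (∀ i j, integral (e i * e' j) = if i = j then 1 else 0) →
    ∀ d (s : Multiset H) (a₁ a₂ a₃ a₄ : H),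
      (∑ p ∈ Finset.HasAntidiagonal.antidiagonal d, (s.antidiagonal.map fun q => ∑ i,
        gw p.1 (a₁ ::ₘ a₂ ::ₘ e i ::ₘ q.1) * gw p.2 (e' i ::ₘ a₃ ::ₘ a₄ ::ₘ q.2)).sum) =
      ∑ p ∈ Finset.HasAntidiagonal.antidiagonal d, (s.antidiagonal.map fun q => ∑ i,
        gw p.1 (a₁ ::ₘ a₃ ::ₘ e i ::ₘ q.1) * gw p.2 (e' i ::ₘ a₂ ::ₘ a₄ ::ₘ q.2)).sum

/-- `φ` is admissible for `u₁, …, u_N` if no `e^{-iφ}(uᵢ - uⱼ)` is a positive real number. -/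
def AdmissiblePhase {ι : Type*} (φ : ℝ) (u : ι → ℂ) : Prop :=
  ∀ i j, ¬ ∃ r : ℝ, 0 < r ∧ exp (-(I * φ)) * (u i - u j) = r

/-- The sector `|arg z - φ| < π/2 + ε` of `ℂ ∖ {0}` (used for `0 < ε < π/2`). -/
def sector (φ ε : ℝ) : Set ℂ :=
  {z | z ≠ 0 ∧ |arg (exp (-(I * φ)) * z)| < Real.pi / 2 + ε}

namespace GromovWittenTheory

noncomputable section

variable {H D : Type*} [NormedCommRing H] [NormedAlgebra ℂ H] [FiniteDimensional ℂ H]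
  [AddCommMonoid D] [Finset.HasAntidiagonal D] (F : GromovWittenTheory H D)

attribute [instance] gradedAlgebra

/-- The Poincaré pairing `(α, β)_F = ∫_F α ∪ β`. -/
def pairing : LinearMap.BilinForm ℂ H := (LinearMap.mul ℂ H).compr₂ F.integral

theorem pairing_nondegenerate : F.pairing.Nondegenerate := by
  refine ⟨fun a h => F.poincare_duality a h, fun a h => F.poincare_duality a fun b => ?_⟩
  rw [mul_comm]
  exact h b

/-- The grading operator `μ`, equal to `p - dim F / 2` on `H^{2p}(F)`. (Classes of degree
`p > dim F` vanish by Poincaré duality.) -/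
def mu : H →ₗ[ℂ] H :=
  ∑ p ∈ Finset.range (F.dim + 1), ((p : ℂ) - F.dim / 2) • GradedAlgebra.proj F.grade p

/-- The Euler vector field `E = c₁(F) + ∑ (1 - deg φᵢ / 2) τⁱ φᵢ`. -/
def euler (τ : H) : H :=
  F.c₁ + ∑ p ∈ Finset.range (F.dim + 1), (1 - (p : ℂ)) • GradedAlgebra.proj F.grade p τ

/-- The term `1/n! ⟨a, b, c, τ, …, τ⟩_{0, n+3, d}` of the quantum product. -/
def quantumTerm (τ a b c : H) (d : D) (n : ℕ) : ℂ :=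
  ((n.factorial : ℂ))⁻¹ * F.gw d (a ::ₘ b ::ₘ c ::ₘ Multiset.replicate n τ)

/-- The three-point function `∑_d ∑_n 1/n! ⟨a, b, c, τ, …, τ⟩_{0, n+3, d}`. -/
def threePoint (τ a b c : H) : ℂ := ∑' d, ∑' n, F.quantumTerm τ a b c d n

/-- The quantum product `a ⋆_τ b`: the class with `(a ⋆_τ b, c)_F = threePoint τ a b c`, written
in the basis Poincaré-dual to a basis of `H`. -/
def star (τ a b : H) : H :=
  ∑ i, F.threePoint τ a b (Module.finBasis ℂ H i) •
    F.pairing.dualBasis F.pairing_nondegenerate (Module.finBasis ℂ H) i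

theorem pairing_star_finBasis (τ a b : H) (j : Fin (Module.finrank ℂ H)) :
    F.pairing (F.star τ a b) (Module.finBasis ℂ H j)
      = F.threePoint τ a b (Module.finBasis ℂ H j) := by
  simp [star, LinearMap.BilinForm.apply_dualBasis_left]

/-- The quantum product is convergent and analytic on `B`: the sums over `n` converge, and the
sum over `d` of the resulting functions of `τ` converges locally uniformly on `B`. -/
def ConvergesOn (B : Set H) : Prop :=
  ∀ a b c, (∀ d, ∀ τ ∈ B, Summable (F.quantumTerm τ a b c d)) ∧
    SummableLocallyUniformlyOn (fun d τ => ∑' n, F.quantumTerm τ a b c d n) B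

/-- `ψ` is a basis of orthogonal idempotents of `(H, ⋆_τ)`. -/
def IsIdempotentBasis (τ : H) (ψ : Module.Basis (Fin (Module.finrank ℂ H)) ℂ H) : Prop :=
  ∀ i j, F.star τ (ψ i) (ψ j) = if i = j then ψ i else 0

/-- `(H, ⋆_τ)` is isomorphic to a direct sum of copies of `ℂ`. -/
def IsSemisimpleAt (τ : H) : Prop := ∃ ψ, F.IsIdempotentBasis τ ψ

/-- `Ψ` is a family of normalized idempotents `Ψᵢ = ψᵢ / √(ψᵢ, ψᵢ)_F` at `τ`, for some ordering
of the idempotents and some choice `sᵢ` of the square roots. -/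
def IsNormalizedIdempotents (τ : H) (Ψ : Fin (Module.finrank ℂ H) → H) : Prop :=
  ∃ ψ, F.IsIdempotentBasis τ ψ ∧
    ∃ s : Fin (Module.finrank ℂ H) → ℂ,
      ∀ i, s i ^ 2 = F.pairing (ψ i) (ψ i) ∧ Ψ i = (s i)⁻¹ • ψ i

/-- `w` satisfies `∇_{z∂_z} w = (z∂_z - z⁻¹ (E ⋆_τ) + μ) w = 0` on `S`, for fixed `τ`. -/
def IsFlatInZ (τ : H) (S : Set ℂ) (w : ℂ → H) : Prop :=
  ∀ z ∈ S, DifferentiableAt ℂ w z ∧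
    z • deriv w z - z⁻¹ • F.star τ (F.euler τ) (w z) + F.mu (w z) = 0

/-- `y` is an analytic section over `B × S` that is flat for the big quantum connection:
`∇_α y = (∂_α + z⁻¹ (α ⋆_τ)) y = 0` for all `α`, and `∇_{z∂_z} y = 0`. -/
def IsFlatSection (B : Set H) (S : Set ℂ) (y : H → ℂ → H) : Prop :=
  AnalyticOnNhd ℂ (fun p : H × ℂ => y p.1 p.2) (B ×ˢ S) ∧
  (∀ τ ∈ B, ∀ z ∈ S, ∀ α, fderiv ℂ (fun t => y t z) τ α + z⁻¹ • F.star τ α (y τ z) = 0) ∧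
  ∀ τ ∈ B, F.IsFlatInZ τ S (y τ)

/-- `y₁, …, y_N` is an analytic fundamental solution: its members are flat, and form a basis at
every point. -/
def IsFundamentalSolution (B : Set H) (S : Set ℂ)
    (y : Fin (Module.finrank ℂ H) → H → ℂ → H) : Prop :=
  (∀ i, F.IsFlatSection B S (y i)) ∧
    ∀ τ ∈ B, ∀ z ∈ S, LinearIndependent ℂ fun i => y i τ z

/-- `Y e^{U/z} → Ψ` as `z → 0` in `S`, for `Y = (w₁, …, w_N)` and `U = diag(u₁, …, u_N)`. -/
def ExpAsymptotics (S : Set ℂ) (u : Fin (Module.finrank ℂ H) → ℂ)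
    (Ψ : Fin (Module.finrank ℂ H) → H) (w : Fin (Module.finrank ℂ H) → ℂ → H) : Prop :=
  ∀ i, Tendsto (fun z => exp (u i / z) • w i z) (𝓝[S] 0) (𝓝 (Ψ i))

/-- `y` is an analytic fundamental solution over `B` with `Y_τ(z) e^{U/z} → Ψ` as `z → 0` in the
sector `|arg z - φ| < π/2 + ε`, for every `τ ∈ B`. -/
def IsAsymptoticallyExponential (B : Set H) (φ ε : ℝ) (u : H → Fin (Module.finrank ℂ H) → ℂ)
    (Ψ : H → Fin (Module.finrank ℂ H) → H) (y : Fin (Module.finrank ℂ H) → H → ℂ → H) : Prop :=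
  F.IsFundamentalSolution B (sector φ ε) y ∧
  ∀ τ ∈ B, ExpAsymptotics (sector φ ε) (u τ) (Ψ τ) fun i => y i τ

/-- For every single `τ ∈ B`, any solution of the differential equation in `z` with the
exponential asymptotics in a sector `|arg z - φ| < π/2 + δ`, `0 < δ ≤ ε`, agrees there with `y`. -/
def IsUniqueAsymptoticallyExponential (B : Set H) (φ ε : ℝ)
    (u : H → Fin (Module.finrank ℂ H) → ℂ) (Ψ : H → Fin (Module.finrank ℂ H) → H)
    (y : Fin (Module.finrank ℂ H) → H → ℂ → H) : Prop :=
  ∀ τ ∈ B, ∀ δ, 0 < δ → δ ≤ ε → ∀ w : Fin (Module.finrank ℂ H) → ℂ → H,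
    (∀ i, F.IsFlatInZ τ (sector φ δ) (w i)) → ExpAsymptotics (sector φ δ) (u τ) (Ψ τ) w →
    ∀ i, ∀ z ∈ sector φ δ, w i z = y i τ z

/-- `e^{-u/z} ∑_k r_k z^k` is a formal solution of the big quantum connection over `B`, with
analytic coefficients: the coefficients of all powers of `z` in `∇_{z∂_z}` and `∇_α` of it
vanish. -/
def IsFormalSolution (B : Set H) (u : H → ℂ) (r : ℕ → H → H) : Prop :=
  (∀ k, AnalyticOnNhd ℂ (r k) B) ∧ ∀ τ ∈ B,
    F.star τ (F.euler τ) (r 0 τ) = u τ • r 0 τ ∧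
    (∀ k : ℕ, u τ • r (k + 1) τ + (k : ℂ) • r k τ
      - F.star τ (F.euler τ) (r (k + 1) τ) + F.mu (r k τ) = 0) ∧
    ∀ α, F.star τ α (r 0 τ) = fderiv ℂ u τ α • r 0 τ ∧
      ∀ k, fderiv ℂ (r k) τ α - fderiv ℂ u τ α • r (k + 1) τ + F.star τ α (r (k + 1) τ) = 0

end

end GromovWittenTheory

/-! The connection has a double pole at `z = 0` whose leading part `E ⋆` is diagonalizable, possibly
with coinciding eigenvalues. What replaces distinctness is flatness in `τ`: in the frame of
normalized idempotents, `a ⋆` acts on `Ψ i` by `du_i(a)`, so the `u i` are canonical coordinates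
dual to the idempotents `ψ j`. For a formal solution `e^{-u_i/z} ∑ r_k z^k` with `r_0 = Ψ_i`, the
`Ψ_j`-component of `r_{k+1}`, `j ≠ i`, is minus that of the derivative of `r_k` along `ψ_j`; nothing
is divided by `u_i - u_j`. The `Ψ_i`-component is fixed by the equation in `z`. That all equations
then hold (`SemisimpleFrame.isIntegrable`) rests on the symmetry of the derivative of the product,
on homogeneity (`fderiv_eulerOp`) and on the skewness of `μ`.

Each recursion step costs one derivative in `τ`, so Cauchy estimates on shrinking balls give `‖r_k‖
≤ A M^k k!` (`exists_norm_coeff_le`). Hence the Borel transform `y(x) = ∑ r_k x^k / k!` converges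
near `x = 0`. It satisfies `(x + u_i - V) y' = -μ y` with `V = E ⋆`, a linear equation singular only
at the points `u_j - u_i`. Admissibility keeps these points off the ray `ℝ_{>0} e^{iφ}`; those that
vanish at `τ₀` stay close to `0`, where the convergent series takes over. So `y` continues to a thin
cone around the ray, uniformly for `τ` near `τ₀`, with polynomial growth
(`exists_isBorelTransform`). Its Laplace transform times `e^{-u_i/z}` is a flat section; rotating
the path of integration inside the cone extends it to a sector of opening greater than `π`, and
Watson's lemma gives the expansion (`exists_flatSection`).

Duality and uniqueness have one cause. The pairing of a solution at `-z` in the opposite sector with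
a solution at `z` is constant in `z`. Comparison with the exponential asymptotics shows that this
constant times `e^{(u_j - u_i)/z}` tends to `δ_ij`. The sector contains a direction in which the
exponential does not decay, so the constant is `δ_ij` (`pairing_flat`). Two solutions with the same
asymptotics thus pair equally with a dual basis and coincide.

The data for this come from the axioms: by the divisor and dimension axioms each degree contributes
an exponential times a polynomial to the three-point function, and locally uniform convergence
transfers analyticity, symmetry and homogeneity to the sum over degrees. -/

/-! ### Osgood's lemma, and analyticity of limits and integrals with parameters. -/

section Osgood

open MeasureTheory

/-- A continuous function with values in `C(K, G)` all of whose evaluations are holomorphic is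
holomorphic. -/
theorem differentiableAt_continuousMap_of_eval {K G : Type*} [TopologicalSpace K] [CompactSpace K]
    [NormedAddCommGroup G] [NormedSpace ℂ G] [CompleteSpace G] {g : ℂ → C(K, G)} {r : ℝ}
    (hr : 0 < r) (hc : ContinuousOn g (Metric.closedBall 0 r))
    (hd : ∀ k, ∀ t ∈ Metric.ball (0 : ℂ) r, DifferentiableAt ℂ (fun t => g t k) t) :
    DifferentiableAt ℂ g 0 := by
  lift r to NNReal using hr.le
  have hci : CircleIntegrable g 0 r :=
    (hc.mono Metric.sphere_subset_closedBall).circleIntegrable r.coe_nonneg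
  have hA := hasFPowerSeriesOn_cauchy_integral hci (by exact_mod_cast hr)
  -- The Cauchy integral of a merely continuous function is analytic inside the circle, and
  -- evaluation at each `k` shows that it reproduces `g`.
  refine (hA.analyticAt.differentiableAt).congr_of_eventuallyEq ?_
  filter_upwards [Metric.ball_mem_nhds (0 : ℂ) hr] with w hw
  ext k
  let ev : C(K, G) →L[ℂ] G := ContinuousMap.evalCLM ℂ k
  have hci' : CircleIntegrable (fun z => (z - w)⁻¹ • g z) 0 r := by
    refine ContinuousOn.circleIntegrable r.coe_nonneg ?_
    refine ContinuousOn.smul (ContinuousOn.inv₀ (continuousOn_id.sub continuousOn_const) ?_)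
      (hc.mono Metric.sphere_subset_closedBall)
    rintro z hz h
    obtain rfl : z = w := sub_eq_zero.1 h
    simp at hz hw
    linarith
  have h1 : ev (∮ z in C(0, r), (z - w)⁻¹ • g z) = ∮ z in C(0, r), (z - w)⁻¹ • g z k := by
    simp only [circleIntegral]
    rw [← ContinuousLinearMap.intervalIntegral_comp_comm _ hci'.out]
    simp [ev]
  have h2 := two_pi_I_inv_smul_circleIntegral_sub_inv_smul_of_differentiable_on_off_countable
    (f := fun t => g t k) Set.countable_empty hw (ev.continuous.comp_continuousOn hc)
    (fun x hx => hd k x hx.1)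
  rw [← h2, ← h1, ContinuousMap.smul_apply]
  rfl

/-- The bilinear pairing `(k, f) ↦ ∫ k f` of continuous functions on the unit circle. -/
noncomputable def circlePairing (G : Type*) [NormedAddCommGroup G] [NormedSpace ℂ G] :
    C(Circle, ℂ) →L[ℂ] C(Circle, G) →L[ℂ] G :=
  LinearMap.mkContinuous₂
    (LinearMap.mk₂ ℂ (fun k f => ∫ θ in (0 : ℝ)..2 * Real.pi, k (Circle.exp θ) • f (Circle.exp θ))
      (by
        intro k k' f
        rw [← intervalIntegral.integral_add]
        · simp [add_smul]
        all_goals exact Continuous.intervalIntegrable (by fun_prop) _ _)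
      (by
        intro c k f
        rw [← intervalIntegral.integral_smul]
        simp [mul_smul])
      (by
        intro k f f'
        rw [← intervalIntegral.integral_add]
        · simp [smul_add]
        all_goals exact Continuous.intervalIntegrable (by fun_prop) _ _)
      (by
        intro c k f
        rw [← intervalIntegral.integral_smul]
        simp [smul_comm c]))
    (2 * Real.pi) (by
      intro k f
      have := intervalIntegral.norm_integral_le_of_norm_le_const (a := 0) (b := 2 * Real.pi)
        (f := fun θ => k (Circle.exp θ) • f (Circle.exp θ)) (C := ‖k‖ * ‖f‖) (by
          intro θ _
          rw [norm_smul]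
          exact mul_le_mul (k.norm_coe_le_norm _) (f.norm_coe_le_norm _) (norm_nonneg _)
            (norm_nonneg _))
      rw [sub_zero, abs_of_pos Real.two_pi_pos] at this
      simp only [LinearMap.mk₂_apply]
      linarith)

theorem circlePairing_apply {G : Type*} [NormedAddCommGroup G] [NormedSpace ℂ G]
    (k : C(Circle, ℂ)) (f : C(Circle, G)) : circlePairing G k f =
      ∫ θ in (0 : ℝ)..2 * Real.pi, k (Circle.exp θ) • f (Circle.exp θ) := rfl

/-- The Cauchy kernel as an analytic function with values in the continuous functions on a
circle. -/
theorem exists_cauchyKernel (w₀ : ℂ) {ρ : ℝ} (hρ0 : 0 < ρ) :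
    ∃ κ : ℂ → C(Circle, ℂ), AnalyticAt ℂ κ w₀ ∧ ∀ w ∈ Metric.ball w₀ ρ, ∀ c : Circle,
      κ w c = (2 * Real.pi : ℂ)⁻¹ * (ρ * c) * (w₀ + ρ * c - w)⁻¹ := by
  let ζ : Circle → ℂ := fun c => w₀ + ρ * c
  have hζc : Continuous ζ := by fun_prop
  let b : C(Circle, ℂ) := ⟨ζ, hζc⟩
  -- The inverse is taken in the Banach algebra `C(Circle, ℂ)`, where inversion is analytic on
  -- units. The prefactor combines `1 / (2πi)` with `dζ = i ρ c dθ`.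
  let κ : ℂ → C(Circle, ℂ) := fun w =>
    (⟨fun c => (2 * Real.pi : ℂ)⁻¹ * (ρ * c), by fun_prop⟩ : C(Circle, ℂ)) *
      Ring.inverse (b - w • 1)
  have hunit : ∀ w ∈ Metric.ball w₀ ρ, IsUnit (b - w • (1 : C(Circle, ℂ))) := by
    intro w hw
    rw [ContinuousMap.isUnit_iff_forall_ne_zero]
    intro c h
    have : ζ c = w := by simpa [b, sub_eq_zero] using h
    rw [← this] at hw
    simp [ζ, abs_of_pos hρ0, Circle.norm_coe] at hw
  have hκ : ∀ w ∈ Metric.ball w₀ ρ, ∀ c, κ w c =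
      (2 * Real.pi : ℂ)⁻¹ * (ρ * c) * (ζ c - w)⁻¹ := by
    intro w hw c
    have h1 := Ring.mul_inverse_cancel _ (hunit w hw)
    have h2 := congrArg (fun f : C(Circle, ℂ) => f c) h1
    simp only [ContinuousMap.mul_apply, ContinuousMap.sub_apply, ContinuousMap.smul_apply,
      ContinuousMap.one_apply, smul_eq_mul, mul_one] at h2
    simp only [κ, ContinuousMap.mul_apply]
    congr 1
    exact eq_inv_of_mul_eq_one_right h2
  have hκa : AnalyticAt ℂ κ w₀ := by
    refine analyticAt_const.mul ?_
    obtain ⟨e, he⟩ := hunit w₀ (Metric.mem_ball_self hρ0)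
    have := analyticAt_inverse (𝕜 := ℂ) e
    rw [he] at this
    refine this.fun_comp (f := fun w : ℂ => b - w • (1 : C(Circle, ℂ))) ?_
    fun_prop
  exact ⟨κ, hκa, hκ⟩

/-- Osgood's lemma holds on `E`: a continuous function that is holomorphic along all complex lines
is analytic. -/
def OsgoodProperty.{v, w} (E : Type w) [NormedAddCommGroup E] [NormedSpace ℂ E] : Prop :=
  ∀ (G : Type v) [NormedAddCommGroup G] [NormedSpace ℂ G] [CompleteSpace G] (f : E → G) (x₀ : E)
    (r : ℝ), 0 < r → ContinuousOn f (Metric.ball x₀ r) →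
    (∀ x ∈ Metric.ball x₀ r, ∀ h, DifferentiableAt ℂ (fun t : ℂ => f (x + t • h)) 0) →
    AnalyticAt ℂ f x₀

theorem differentiableAt_line {E G : Type*} [AddCommGroup E] [Module ℂ E]
    [NormedAddCommGroup G] [NormedSpace ℂ G] {f : E → G} {x h : E} {t : ℂ}
    (hf : DifferentiableAt ℂ (fun s : ℂ => f (x + t • h + s • h)) 0) :
    DifferentiableAt ℂ (fun s : ℂ => f (x + s • h)) t := by
  have h1 : DifferentiableAt ℂ (fun s : ℂ => f (x + t • h + s • h)) (t - t) := by simpa using hf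
  have := h1.comp t (f := fun s => s - t) (by fun_prop)
  refine this.congr_of_eventuallyEq (Eventually.of_forall fun s => ?_)
  simp only [Function.comp]
  congr 1
  module

/-- Cauchy's formula in the first variable writes `f (w, x)` as the circle pairing of the kernel `κ
w` with the slice `F x`. The slice is analytic in `x` by the property on `E` for values in
`C(Circle, G)`, which is why the property quantifies over all targets. -/
theorem OsgoodProperty.prod.{v, w} {E : Type w} [NormedAddCommGroup E] [NormedSpace ℂ E]
    (hE : OsgoodProperty.{v} E) : OsgoodProperty.{v} (ℂ × E) := by
  intro G _ _ _ f x₀ r hr hc hd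
  obtain ⟨w₀, x₀⟩ := x₀
  set ρ := r / 2 with hρ
  have hρ0 : 0 < ρ := by positivity
  let ζ : Circle → ℂ := fun c => w₀ + ρ * c
  have hζc : Continuous ζ := by fun_prop
  have hball : ∀ w x, w ∈ Metric.ball w₀ r → x ∈ Metric.ball x₀ r →
      (w, x) ∈ Metric.ball (w₀, x₀) r := by
    intro w x hw hx
    rw [← ball_prod_same]
    exact ⟨hw, hx⟩
  have hcb : ∀ w, w ∈ Metric.closedBall w₀ ρ → w ∈ Metric.ball w₀ r := fun w hw =>
    Metric.closedBall_subset_ball (by linarith) hw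
  have hζ : ∀ c, ζ c ∈ Metric.ball w₀ r := by
    intro c
    apply hcb
    simp [ζ, abs_of_pos hρ0, Circle.norm_coe]
  -- the slices as continuous functions on the circle
  let F' : Metric.ball x₀ r → C(Circle, G) := fun x => ⟨fun c => f (ζ c, x), by
    refine hc.comp_continuous (by fun_prop) fun c => hball _ _ (hζ c) x.2⟩
  have hF'c : Continuous F' := by
    refine ContinuousMap.continuous_of_continuous_uncurry _ ?_
    refine hc.comp_continuous (f := fun p : Metric.ball x₀ r × Circle => (ζ p.2, (p.1 : E)))
      (by fun_prop) fun p => hball _ _ (hζ p.2) p.1.2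
  classical
  let F : E → C(Circle, G) := fun x => if h : x ∈ Metric.ball x₀ r then F' ⟨x, h⟩ else 0
  have hF : ∀ x ∈ Metric.ball x₀ r, ∀ c, F x c = f (ζ c, x) := by
    intro x hx c
    simp only [F, dif_pos hx]
    rfl
  have hFc : ContinuousOn F (Metric.ball x₀ r) := by
    rw [continuousOn_iff_continuous_domRestrict]
    convert hF'c using 1
    funext x
    simp only [Set.domRestrict_apply, F, dif_pos x.2]
  have hFa : AnalyticAt ℂ F x₀ := by
    refine hE _ F x₀ r hr hFc fun x hx h => ?_
    have hopen : IsOpen {t : ℂ | x + t • h ∈ Metric.ball x₀ r} :=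
      Metric.isOpen_ball.preimage (by fun_prop)
    obtain ⟨s, hs, hsub⟩ := Metric.nhds_basis_closedBall.mem_iff.1
      (hopen.mem_nhds (show (0 : ℂ) ∈ _ by simpa using hx))
    -- Along a line `F` is continuous and its evaluations are slices of `f`, so it is holomorphic as
    -- a map to `C(Circle, G)`.
    refine differentiableAt_continuousMap_of_eval hs
      (hFc.comp (by fun_prop) fun t ht => hsub ht) fun c t ht => ?_
    have ht' := hsub (Metric.ball_subset_closedBall ht)
    have h1 : DifferentiableAt ℂ (fun t : ℂ => f ((ζ c, x) + t • ((0 : ℂ), h))) t := by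
      refine differentiableAt_line (hd _ ?_ _)
      simpa using hball _ _ (hζ c) ht'
    refine h1.congr_of_eventuallyEq ?_
    filter_upwards [hopen.mem_nhds ht'] with s hs
    rw [hF _ hs]
    simp
  obtain ⟨κ, hκa, hκ⟩ := exists_cauchyKernel w₀ hρ0
  have hmain : (fun p : ℂ × E => f p) =ᶠ[𝓝 (w₀, x₀)]
      fun p => circlePairing G (κ p.1) (F p.2) := by
    filter_upwards [prod_mem_nhds (Metric.ball_mem_nhds w₀ hρ0) (Metric.ball_mem_nhds x₀ hr)]
    rintro ⟨w, x⟩ ⟨hw, hx⟩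
    simp only at hw hx
    have h2 := two_pi_I_inv_smul_circleIntegral_sub_inv_smul_of_differentiable_on_off_countable
      (f := fun t => f (t, x)) (c := w₀) (R := ρ) Set.countable_empty hw
      (hc.comp (by fun_prop) fun t ht => hball _ _ (hcb t ht) hx)
      (fun t ht => by
        have h1 : DifferentiableAt ℂ (fun t : ℂ => f ((0, x) + t • ((1 : ℂ), (0 : E)))) t := by
          refine differentiableAt_line (hd _ ?_ _)
          simpa using hball _ _ (hcb _ (Metric.ball_subset_closedBall ht.1)) hx
        simpa using h1)
    rw [← h2, circlePairing_apply, circleIntegral, ← intervalIntegral.integral_smul]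
    refine intervalIntegral.integral_congr fun θ _ => ?_
    simp only
    rw [hκ w hw, hF x hx, smul_smul, smul_smul, deriv_circleMap]
    have : circleMap w₀ ρ θ = ζ (Circle.exp θ) := by simp [circleMap, ζ]
    rw [this]
    congr 1
    simp only [ζ, Circle.coe_exp]
    have : (2 * Real.pi * I : ℂ) ≠ 0 := by simp [Real.pi_ne_zero]
    rw [circleMap]
    field_simp
    ring_nf
  refine AnalyticAt.congr ?_ hmain.symm
  have a1 : AnalyticAt ℂ (fun p : ℂ × E => κ p.1) (w₀, x₀) :=
    hκa.fun_comp (f := fun p : ℂ × E => p.1) analyticAt_fst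
  have a2 : AnalyticAt ℂ (fun p : ℂ × E => F p.2) (w₀, x₀) :=
    hFa.fun_comp (f := fun p : ℂ × E => p.2) analyticAt_snd
  exact ((circlePairing G).analyticAt_bilinear (κ w₀, F x₀)).fun_comp
    (f := fun p : ℂ × E => (κ p.1, F p.2)) (a1.prod a2)

theorem OsgoodProperty.of_equiv.{v, w, w'} {E : Type w} {E' : Type w'}
    [NormedAddCommGroup E] [NormedSpace ℂ E]
    [NormedAddCommGroup E'] [NormedSpace ℂ E'] (e : E ≃L[ℂ] E') (hE : OsgoodProperty.{v} E) :
    OsgoodProperty.{v} E' := by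
  intro G _ _ _ f x₀ r hr hc hd
  have hopen : IsOpen (e ⁻¹' Metric.ball x₀ r) := Metric.isOpen_ball.preimage e.continuous
  obtain ⟨s, hs, hsub⟩ := Metric.isOpen_iff.1 hopen (e.symm x₀) (by simpa using hr)
  have h1 : AnalyticAt ℂ (f ∘ e) (e.symm x₀) := by
    refine hE G (f ∘ e) (e.symm x₀) s hs (hc.comp e.continuous.continuousOn hsub)
      fun x hx h => ?_
    simpa using hd (e x) (hsub hx) (e h)
  have h2 := h1.fun_comp (g := f ∘ e) (f := e.symm) (x := x₀)
    ((e.symm : E' →L[ℂ] E).analyticAt x₀)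
  simpa [Function.comp_def] using h2

theorem osgoodProperty_pi.{v} (n : ℕ) : OsgoodProperty.{v} (Fin n → ℂ) := by
  induction n with
  | zero =>
    intro G _ _ _ f x₀ r hr hc hd
    have : f = fun _ => f x₀ := funext fun x => by rw [Subsingleton.elim x x₀]
    rw [this]
    exact analyticAt_const
  | succ n ih =>
    exact ih.prod.of_equiv (Fin.consEquivL ℂ (fun _ : Fin (n + 1) => ℂ))

theorem osgoodProperty.{v, w} (E : Type w) [NormedAddCommGroup E] [NormedSpace ℂ E]
    [FiniteDimensional ℂ E] : OsgoodProperty.{v} E :=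
  (osgoodProperty_pi (Module.finrank ℂ E)).of_equiv
    (ContinuousLinearEquiv.ofFinrankEq (by simp))

section

variable {E G : Type*} [NormedAddCommGroup E] [NormedSpace ℂ E] [FiniteDimensional ℂ E]
  [NormedAddCommGroup G] [NormedSpace ℂ G] [CompleteSpace G] {U : Set E} {f : E → G}

/-- **Osgood's lemma**. -/
theorem analyticOnNhd_of_continuousOn_of_line (hU : IsOpen U) (hc : ContinuousOn f U)
    (hd : ∀ x ∈ U, ∀ h, DifferentiableAt ℂ (fun t : ℂ => f (x + t • h)) 0) :
    AnalyticOnNhd ℂ f U := by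
  intro x hx
  obtain ⟨r, hr, hsub⟩ := Metric.isOpen_iff.1 hU x hx
  exact osgoodProperty E G f x r hr (hc.mono hsub) fun y hy => hd y (hsub hy)

theorem DifferentiableOn.analyticOnNhd_of_finiteDimensional (hf : DifferentiableOn ℂ f U)
    (hU : IsOpen U) : AnalyticOnNhd ℂ f U := by
  refine analyticOnNhd_of_continuousOn_of_line hU hf.continuousOn fun x hx h => ?_
  have h1 : DifferentiableAt ℂ f (x + (0 : ℂ) • h) := by
    simpa using hf.differentiableAt (hU.mem_nhds hx)
  exact h1.comp (0 : ℂ) (f := fun t : ℂ => x + t • h) (by fun_prop)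

omit [FiniteDimensional ℂ E] [NormedSpace ℂ G] [CompleteSpace G] in
theorem TendstoLocallyUniformlyOn.comp_line {ι : Type*} {F : ι → E → G} {p : Filter ι}
    (h : TendstoLocallyUniformlyOn F f p U) (x v : E) :
    TendstoLocallyUniformlyOn (fun i (t : ℂ) => F i (x + t • v)) (fun t => f (x + t • v)) p
      {t : ℂ | x + t • v ∈ U} :=
  h.comp (fun t : ℂ => x + t • v) (fun _ ht => ht) (by fun_prop)

/-- Locally uniform limits of analytic functions are analytic. -/
theorem TendstoLocallyUniformlyOn.analyticOnNhd {ι : Type*} {F : ι → E → G} {p : Filter ι}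
    [p.NeBot] (h : TendstoLocallyUniformlyOn F f p U) (hU : IsOpen U)
    (hF : ∀ᶠ i in p, AnalyticOnNhd ℂ (F i) U) : AnalyticOnNhd ℂ f U := by
  refine analyticOnNhd_of_continuousOn_of_line hU
    (h.continuousOn (hF.mono fun i hi => hi.continuousOn).frequently) fun x hx v => ?_
  have hopen : IsOpen {t : ℂ | x + t • v ∈ U} := hU.preimage (by fun_prop)
  refine ((h.comp_line x v).differentiableOn (hF.mono fun i hi => ?_) hopen).differentiableAt
    (hopen.mem_nhds (by simpa using hx))
  intro t ht
  exact (DifferentiableAt.comp t (hi _ ht).differentiableAt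
    (f := fun t : ℂ => x + t • v) (by fun_prop)).differentiableWithinAt

omit [CompleteSpace G] in
/-- A dominated integral of functions holomorphic on a disc is holomorphic, and may be
differentiated under the integral sign. -/
theorem hasDerivAt_integral_of_differentiableOn {α : Type*} [MeasurableSpace α] {μ : Measure α}
    {F : ℂ → α → G} {t₀ : ℂ} {r : ℝ} {bound : α → ℝ} (hr : 0 < r)
    (hm : ∀ t ∈ Metric.ball t₀ r, AEStronglyMeasurable (F t) μ)
    (hb : ∀ᵐ a ∂μ, ∀ t ∈ Metric.ball t₀ r, ‖F t a‖ ≤ bound a) (hbi : Integrable bound μ)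
    (hd : ∀ᵐ a ∂μ, DifferentiableOn ℂ (fun t => F t a) (Metric.ball t₀ r)) :
    HasDerivAt (fun t => ∫ a, F t a ∂μ) (∫ a, deriv (fun t => F t a) t₀ ∂μ) t₀ := by
  have hr2 : 0 < r / 2 := by positivity
  have h0 : t₀ ∈ Metric.ball t₀ r := Metric.mem_ball_self hr
  refine (hasDerivAt_integral_of_dominated_loc_of_deriv_le (F := F)
    (F' := fun t a => deriv (fun t => F t a) t) (bound := fun a => bound a / (r / 4))
    (s := Metric.ball t₀ (r / 2)) (Metric.ball_mem_nhds _ hr2) ?_ ?_ ?_ ?_ ?_ ?_).2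
  · filter_upwards [Metric.ball_mem_nhds _ hr] with t ht using hm t ht
  · exact hbi.mono' (hm _ h0) (hb.mono fun a ha => ha _ h0)
  -- The derivative is measurable as a pointwise limit of difference quotients along a sequence `s n
  -- → 0` that stays in the disc.
  · let s : ℕ → ℂ := fun n => ((r / 2 * (1 / ((n : ℝ) + 1)) : ℝ) : ℂ)
    have hs0 : ∀ n, s n ≠ 0 := by
      intro n
      simp only [s, ne_eq, ofReal_eq_zero]
      positivity
    have hst : Tendsto s atTop (𝓝 0) := by
      have h1 : Tendsto (fun n : ℕ => r / 2 * (1 / ((n : ℝ) + 1))) atTop (𝓝 (r / 2 * 0)) :=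
        tendsto_const_nhds.mul tendsto_one_div_add_atTop_nhds_zero_nat
      rw [mul_zero] at h1
      have h2 := (continuous_ofReal.tendsto (0 : ℝ)).comp h1
      rw [ofReal_zero] at h2
      exact h2
    have hsb : ∀ n, t₀ + s n ∈ Metric.ball t₀ r := by
      intro n
      rw [Metric.mem_ball, dist_eq_norm, add_sub_cancel_left]
      simp only [s, norm_real, Real.norm_eq_abs]
      rw [abs_of_pos (by positivity)]
      have : 1 / ((n : ℝ) + 1) ≤ 1 := by
        rw [div_le_one (by positivity)]
        linarith [Nat.cast_nonneg (α := ℝ) n]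
      nlinarith
    refine aestronglyMeasurable_of_tendsto_ae atTop
      (f := fun n a => (s n)⁻¹ • (F (t₀ + s n) a - F t₀ a)) (fun n => ?_) ?_
    · exact ((hm _ (hsb n)).sub (hm _ h0)).const_smul _
    · filter_upwards [hd] with a ha
      have h1 := ((ha.differentiableAt (Metric.ball_mem_nhds _ hr)).hasDerivAt).tendsto_slope_zero
      exact h1.comp (tendsto_nhdsWithin_iff.2 ⟨hst, Eventually.of_forall fun n => hs0 n⟩)
  · filter_upwards [hb, hd] with a ha hda t ht
    -- Cauchy's estimate on a circle of radius `r / 4` about a point at distance less than `r / 2`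
    -- from the centre.
    have hsub : Metric.closedBall t (r / 4) ⊆ Metric.ball t₀ r := by
      refine Metric.closedBall_subset_ball' ?_
      rw [Metric.mem_ball] at ht
      linarith
    refine Complex.norm_deriv_le_of_forall_mem_sphere_norm_le (by positivity) ?_
      fun w hw => ha w (hsub (Metric.sphere_subset_closedBall hw))
    exact (hda.mono hsub).diffContOnCl_ball subset_rfl
  · exact hbi.div_const _
  · filter_upwards [hd] with a ha t ht
    exact (ha.differentiableAt (Metric.isOpen_ball.mem_nhds
      (Metric.ball_subset_ball (by linarith) ht))).hasDerivAt

/-- A locally dominated integral of functions depending analytically on a parameter is analytic. -/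
theorem analyticOnNhd_integral {α : Type*} [MeasurableSpace α] {μ : Measure α} {F : E → α → G}
    (hU : IsOpen U) (hm : ∀ x ∈ U, AEStronglyMeasurable (F x) μ)
    (hd : ∀ᵐ a ∂μ, AnalyticOnNhd ℂ (fun x => F x a) U)
    (hb : ∀ x₀ ∈ U, ∃ V ∈ 𝓝 x₀, ∃ bound : α → ℝ, Integrable bound μ ∧
      ∀ᵐ a ∂μ, ∀ x ∈ V, ‖F x a‖ ≤ bound a) :
    AnalyticOnNhd ℂ (fun x => ∫ a, F x a ∂μ) U := by
  refine analyticOnNhd_of_continuousOn_of_line hU ?_ ?_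
  · intro x hx
    obtain ⟨V, hV, bound, hbi, hb⟩ := hb x hx
    refine (continuousAt_of_dominated (bound := bound) ?_ ?_ hbi ?_).continuousWithinAt
    · filter_upwards [hU.mem_nhds hx] with y hy using hm y hy
    · filter_upwards [hV] with y hy
      filter_upwards [hb] with a ha using ha y hy
    · filter_upwards [hd] with a ha using (ha x hx).continuousAt
  · intro x hx v
    obtain ⟨V, hV, bound, hbi, hb⟩ := hb x hx
    have hW : (fun t : ℂ => x + t • v) ⁻¹' (V ∩ U) ∈ 𝓝 (0 : ℂ) := by
      have hc : ContinuousAt (fun t : ℂ => x + t • v) 0 := by fun_prop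
      refine hc.preimage_mem_nhds ?_
      simpa using inter_mem hV (hU.mem_nhds hx)
    obtain ⟨r, hr, hsub⟩ := Metric.mem_nhds_iff.1 hW
    refine (hasDerivAt_integral_of_differentiableOn (F := fun t a => F (x + t • v) a)
      (bound := bound) hr (fun t ht => hm _ (hsub ht).2) ?_ hbi ?_).differentiableAt
    · filter_upwards [hb] with a ha t ht using ha _ (hsub ht).1
    · filter_upwards [hd] with a ha t ht
      exact ((ha _ (hsub ht).2).differentiableAt.comp t
        (f := fun t : ℂ => x + t • v) (by fun_prop)).differentiableWithinAt

end

end Osgood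

theorem HasSum.of_eq {ι G : Type*} [AddCommMonoid G] [TopologicalSpace G] {f g : ι → G} {a : G}
    (hg : HasSum g a) (h : ∀ n, f n = g n) : HasSum f a := by
  rwa [funext h]

/-! ### Consequences of the grading, divisor and dimension axioms in a fixed degree `d`. -/

namespace GromovWittenTheory

noncomputable section

variable {H D : Type*} [NormedCommRing H] [NormedAlgebra ℂ H] [AddCommMonoid D]
  [Finset.HasAntidiagonal D] (F : GromovWittenTheory H D)

theorem proj_mem (p : ℕ) (a : H) : GradedAlgebra.proj F.grade p a ∈ F.grade p := by
  rw [GradedAlgebra.proj_apply]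
  exact SetLike.coe_mem _

theorem pairing_apply (a b : H) : F.pairing a b = F.integral (a * b) := rfl

theorem pairing_comm (a b : H) : F.pairing a b = F.pairing b a := by
  rw [pairing_apply, pairing_apply, mul_comm]

theorem pairing_eq_zero_of_mem {p q : ℕ} {a b : H} (ha : a ∈ F.grade p) (hb : b ∈ F.grade q)
    (h : p + q ≠ F.dim) : F.pairing a b = 0 :=
  F.integral_eq_zero _ h _ (SetLike.mul_mem_graded ha hb)

theorem sum_support_proj (a : H) : ∃ s : Finset ℕ, ∑ p ∈ s, GradedAlgebra.proj F.grade p a = a := by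
  classical
  exact ⟨_, DirectSum.sum_support_decompose F.grade a⟩

/-- Such a class pairs to zero with every homogeneous class, hence with everything. -/
theorem eq_zero_of_mem_grade {p : ℕ} (hp : F.dim < p) {a : H} (ha : a ∈ F.grade p) : a = 0 := by
  refine F.poincare_duality a fun b => ?_
  obtain ⟨s, hs⟩ := F.sum_support_proj b
  rw [← hs, Finset.mul_sum, map_sum]
  exact Finset.sum_eq_zero fun q _ => F.pairing_eq_zero_of_mem ha (F.proj_mem q b) (by omega)

theorem sum_range_proj {n : ℕ} (hn : F.dim < n) (a : H) :
    ∑ p ∈ Finset.range n, GradedAlgebra.proj F.grade p a = a := by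
  obtain ⟨s, hs⟩ := F.sum_support_proj a
  have h0 : ∀ p, F.dim < p → GradedAlgebra.proj F.grade p a = 0 :=
    fun p hp => F.eq_zero_of_mem_grade hp (F.proj_mem p a)
  have hp : ∀ q, GradedAlgebra.proj F.grade q a =
      if q ∈ s then GradedAlgebra.proj F.grade q a else 0 := by
    intro q
    split_ifs with h
    · rfl
    · conv_lhs => rw [← hs]
      rw [map_sum]
      refine Finset.sum_eq_zero fun p hp => ?_
      have hpq : p ≠ q := fun e => h (e ▸ hp)
      rw [GradedAlgebra.proj_apply]
      exact DirectSum.decompose_of_mem_ne _ (F.proj_mem p a) hpq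
  conv_rhs => rw [← hs]
  refine Finset.sum_congr_of_eq_on_inter ?_ ?_ ?_
  · intro p _ hps
    rw [hp p, if_neg hps]
  · intro p _ hpn
    rw [Finset.mem_range] at hpn
    exact h0 p (by omega)
  · intro _ _ _
    rfl

theorem proj_of_mem {p : ℕ} {a : H} (ha : a ∈ F.grade p) (q : ℕ) :
    GradedAlgebra.proj F.grade q a = if q = p then a else 0 := by
  rw [GradedAlgebra.proj_apply]
  split_ifs with h
  · subst h
    exact DirectSum.decompose_of_mem_same _ ha
  · exact DirectSum.decompose_of_mem_ne _ ha (Ne.symm h)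

theorem mu_of_mem {p : ℕ} {a : H} (ha : a ∈ F.grade p) : F.mu a = ((p : ℂ) - F.dim / 2) • a := by
  simp only [mu, LinearMap.sum_apply, LinearMap.smul_apply, F.proj_of_mem ha, smul_ite, smul_zero]
  rw [Finset.sum_ite_eq']
  split_ifs with h
  · rfl
  · rw [F.eq_zero_of_mem_grade (by simpa using h) ha, smul_zero]

/-- Induction principle: a property of elements of `H` holds if it holds for homogeneous elements
and is additive. -/
theorem homogeneous_induction {P : H → Prop} (h : ∀ p, ∀ a ∈ F.grade p, P a)
    (hadd : ∀ a b, P a → P b → P (a + b)) (a : H) : P a := by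
  rw [← F.sum_range_proj (Nat.lt_succ_self _) a]
  exact Finset.sum_induction _ _ hadd (h 0 0 (zero_mem _)) fun p _ => h p _ (F.proj_mem p a)

/-- Classes of degrees `p` and `q` pair nontrivially only if `p + q = dim`, and then the eigenvalues
`p - dim / 2` and `q - dim / 2` are opposite. -/
theorem pairing_mu (a b : H) : F.pairing (F.mu a) b = -F.pairing a (F.mu b) := by
  refine F.homogeneous_induction (P := fun a => F.pairing (F.mu a) b = -F.pairing a (F.mu b))
    (fun p a ha => ?_) (fun a a' h h' => ?_) a
  · refine F.homogeneous_induction (P := fun b => F.pairing (F.mu a) b = -F.pairing a (F.mu b))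
      (fun q b hb => ?_) (fun b b' h h' => ?_) b
    · rw [F.mu_of_mem ha, F.mu_of_mem hb]
      simp only [map_smul, LinearMap.smul_apply, smul_eq_mul]
      by_cases h : p + q = F.dim
      · rw [← h]
        push_cast
        ring
      · rw [F.pairing_eq_zero_of_mem ha hb h]
        simp
    · simp only [map_add] at h h' ⊢
      rw [h, h']
      ring
  · simp only [map_add, LinearMap.add_apply] at h h' ⊢
    rw [h, h']
    ring

theorem euler_eq (τ : H) : F.euler τ = F.c₁ + ((1 - F.dim / 2 : ℂ) • τ - F.mu τ) := by
  rw [euler]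
  congr 1
  conv_rhs => rw [← F.sum_range_proj (Nat.lt_succ_self _) τ]
  simp only [map_sum, Finset.smul_sum]
  rw [← Finset.sum_sub_distrib]
  refine Finset.sum_congr rfl fun p _ => ?_
  rw [F.mu_of_mem (F.proj_mem p τ)]
  module

/-- The invariants as linear functions of one insertion. -/
def gwLinear (d : D) (s : Multiset H) (hs : 2 ≤ s.card) : H →ₗ[ℂ] ℂ :=
  IsLinearMap.mk' _ (F.gw_linear d s hs)

theorem gw_add_cons (d : D) {s : Multiset H} (hs : 2 ≤ s.card) (a b : H) :
    F.gw d ((a + b) ::ₘ s) = F.gw d (a ::ₘ s) + F.gw d (b ::ₘ s) :=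
  (F.gwLinear d s hs).map_add a b

theorem gw_smul_cons (d : D) {s : Multiset H} (hs : 2 ≤ s.card) (c : ℂ) (a : H) :
    F.gw d ((c • a) ::ₘ s) = c * F.gw d (a ::ₘ s) :=
  (F.gwLinear d s hs).map_smul c a

theorem gw_sum_cons (d : D) {s : Multiset H} (hs : 2 ≤ s.card) {ι : Type*} (t : Finset ι)
    (f : ι → H) : F.gw d ((∑ i ∈ t, f i) ::ₘ s) = ∑ i ∈ t, F.gw d (f i ::ₘ s) :=
  map_sum (F.gwLinear d s hs) f t

/-- The part of degree at least four of a cohomology class. -/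
def high : H →ₗ[ℂ] H := ∑ p ∈ Finset.range F.dim, GradedAlgebra.proj F.grade (p + 2)

theorem high_apply (τ : H) :
    F.high τ = ∑ p ∈ Finset.range F.dim, GradedAlgebra.proj F.grade (p + 2) τ := by
  simp [high]

/-- The degree-zero part of `τ` is a multiple of `1` and drops out by the fundamental class axiom;
the part in `H²` comes out by the divisor axiom. -/
theorem gw_cons (d : D) {s : Multiset H} (hs : 3 ≤ s.card) (τ : H) : F.gw d (τ ::ₘ s) =
    F.curveIntegral d (GradedAlgebra.proj F.grade 1 τ) * F.gw d s + F.gw d (F.high τ ::ₘ s) := by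
  have hs2 : 2 ≤ s.card := by omega
  have h := F.sum_range_proj (n := F.dim + 2) (by omega) τ
  rw [Finset.sum_range_succ', Finset.sum_range_succ'] at h
  conv_lhs => rw [← h]
  obtain ⟨c, hc⟩ := F.grade_zero _ (F.proj_mem 0 τ)
  rw [F.gw_add_cons d hs2, F.gw_add_cons d hs2, hc, Algebra.algebraMap_eq_smul_one,
    F.gw_smul_cons d hs2, F.gw_one d s (Or.inl hs), F.high_apply]
  have h1 := F.gw_divisor d _ (F.proj_mem 1 τ) s hs
  simp only [zero_add] at h1 ⊢
  rw [h1]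
  ring

/-- Iterating `gw_cons`, each copy of `τ` either contributes a divisor factor or is replaced by
`high τ`; the count is binomial. -/
theorem gw_add_replicate (d : D) (τ : H) (n : ℕ) {s : Multiset H} (hs : 3 ≤ s.card) :
    F.gw d (s + Multiset.replicate n τ) =
      ∑ q ∈ Finset.HasAntidiagonal.antidiagonal n, (n.choose q.1 : ℂ) *
      (F.curveIntegral d (GradedAlgebra.proj F.grade 1 τ) ^ q.1 *
        F.gw d (s + Multiset.replicate q.2 (F.high τ))) := by
  induction n generalizing s with
  | zero => simp
  | succ n ih =>
    have hcard : 3 ≤ (s + Multiset.replicate n τ).card := by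
      rw [Multiset.card_add]
      omega
    rw [Finset.sum_antidiagonal_choose_succ_mul (fun i j =>
      (F.curveIntegral d (GradedAlgebra.proj F.grade 1 τ) ^ i *
        F.gw d (s + Multiset.replicate j (F.high τ)))),
      Multiset.replicate_succ, Multiset.add_cons, F.gw_cons d hcard, ← Multiset.cons_add, ih hs,
      ih (s := F.high τ ::ₘ s) (by rw [Multiset.card_cons]; omega), add_comm]
    congr 1
    · refine Finset.sum_congr rfl fun q _ => ?_
      rw [Multiset.replicate_succ, Multiset.add_cons, Multiset.cons_add]
    · rw [Finset.mul_sum]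
      refine Finset.sum_congr rfl fun q hq => ?_
      rw [← Nat.choose_symm_of_eq_add (Finset.HasAntidiagonal.mem_antidiagonal.1 hq).symm, pow_succ]
      ring

/-- The invariants with many insertions of degree at least four vanish, by the dimension axiom. -/
theorem gw_high_eq_zero_of_homogeneous (d : D) (τ : H) (k : ℕ) (S : Multiset (ℕ × H))
    (hS : 3 ≤ S.card) (hS' : ∀ x ∈ S, x.2 ∈ F.grade x.1)
    (h : F.dim + (F.curveIntegral d F.c₁).re + S.card < (S.map Prod.fst).sum + k) :
    F.gw d (S.map Prod.snd + Multiset.replicate k (F.high τ)) = 0 := by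
  induction k generalizing S with
  | zero =>
    rw [Multiset.replicate_zero, add_zero]
    refine F.gw_dimension d S hS hS' fun e => ?_
    have h1 := congrArg Complex.re e
    simp only [natCast_re, sub_re, add_re, re_ofNat] at h1
    rw [Nat.cast_zero] at h
    linarith
  | succ k ih =>
    rw [Multiset.replicate_succ, Multiset.add_cons, F.high_apply, F.gw_sum_cons d]
    · refine Finset.sum_eq_zero fun p _ => ?_
      -- Moving the component of index `p + 2` into `S` raises the degree sum by at least two and
      -- the allowed degree by only one, so the inequality survives with `k` in place of `k + 1`.
      have := ih ((p + 2, GradedAlgebra.proj F.grade (p + 2) τ) ::ₘ S)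
        (by rw [Multiset.card_cons]; omega)
        (by
          intro x hx
          rcases Multiset.mem_cons.1 hx with rfl | hx
          · exact F.proj_mem _ _
          · exact hS' x hx)
        (by
          rw [Multiset.map_cons, Multiset.sum_cons, Multiset.card_cons]
          push_cast at h ⊢
          linarith [Nat.cast_nonneg (α := ℝ) p])
      rw [Multiset.map_cons, Multiset.cons_add, F.high_apply] at this
      exact this
    · rw [Multiset.card_add, Multiset.card_map]
      omega

/-- The insertions of `s` are split one by one into homogeneous components, which are collected in
`S`; each has finitely many components, so the bounds `K` have a maximum. The resulting `K` does not
depend on `τ`. -/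
theorem exists_gw_high_eq_zero_aux (d : D) (s : Multiset H) : ∀ S : Multiset (ℕ × H),
    3 ≤ S.card + s.card → (∀ x ∈ S, x.2 ∈ F.grade x.1) → ∃ K : ℕ, ∀ k ≥ K, ∀ τ,
      F.gw d (S.map Prod.snd + s + Multiset.replicate k (F.high τ)) = 0 := by
  induction s using Multiset.induction_on with
  | empty =>
    intro S hS hS'
    obtain ⟨K, hK⟩ := exists_nat_gt (F.dim + (F.curveIntegral d F.c₁).re + S.card)
    refine ⟨K, fun k hk τ => ?_⟩
    rw [add_zero]
    refine F.gw_high_eq_zero_of_homogeneous d τ k S (by simpa using hS) hS' ?_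
    have h1 : (K : ℝ) ≤ k := by exact_mod_cast hk
    have h2 : (0 : ℝ) ≤ ((S.map Prod.fst).sum : ℕ) := Nat.cast_nonneg _
    linarith
  | cons a s ih =>
    intro S hS hS'
    rw [Multiset.card_cons] at hS
    choose K hK using fun p : ℕ => ih ((p, GradedAlgebra.proj F.grade p a) ::ₘ S)
      (by rw [Multiset.card_cons]; omega)
      (by
        intro x hx
        rcases Multiset.mem_cons.1 hx with rfl | hx
        · exact F.proj_mem _ _
        · exact hS' x hx)
    refine ⟨(Finset.range (F.dim + 1)).sup K, fun k hk τ => ?_⟩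
    have hcard : 2 ≤ (S.map Prod.snd + s + Multiset.replicate k (F.high τ)).card := by
      rw [Multiset.card_add, Multiset.card_add, Multiset.card_map]
      omega
    rw [Multiset.add_cons, Multiset.cons_add]
    conv_lhs => rw [← F.sum_range_proj (Nat.lt_succ_self _) a]
    rw [F.gw_sum_cons d hcard]
    refine Finset.sum_eq_zero fun p hp => ?_
    have := hK p k (le_trans (Finset.le_sup hp) hk) τ
    rwa [Multiset.map_cons, Multiset.cons_add, Multiset.cons_add] at this

theorem exists_gw_high_eq_zero (d : D) {s : Multiset H} (hs : 3 ≤ s.card) :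
    ∃ K : ℕ, ∀ k ≥ K, ∀ τ, F.gw d (s + Multiset.replicate k (F.high τ)) = 0 := by
  simpa using F.exists_gw_high_eq_zero_aux d s 0 (by simpa using hs) (by simp)

/-- The sum `∑_n 1/n! ⟨s, τ, …, τ⟩_{0, n + |s|, d}`. -/
def degreeSum (d : D) (s : Multiset H) (τ : H) : ℂ :=
  ∑' n : ℕ, ((n.factorial : ℂ))⁻¹ * F.gw d (s + Multiset.replicate n τ)

theorem quantumTerm_eq (τ a b c : H) (d : D) (n : ℕ) : F.quantumTerm τ a b c d n =
    ((n.factorial : ℂ))⁻¹ * F.gw d ((a ::ₘ b ::ₘ c ::ₘ 0) + Multiset.replicate n τ) := by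
  simp [quantumTerm]

theorem threePoint_eq (τ a b c : H) :
    F.threePoint τ a b c = ∑' d, F.degreeSum d (a ::ₘ b ::ₘ c ::ₘ 0) τ := by
  simp only [threePoint, degreeSum, quantumTerm_eq]

/-- By the binomial formula the series is the Cauchy product of an exponential series with a finite
sum. So in each degree the sum over `n` is an exponential of a linear form times a polynomial in
`τ`. -/
theorem hasSum_degreeSum_aux (d : D) {s : Multiset H} (hs : 3 ≤ s.card) {K : ℕ}
    (hK : ∀ k ≥ K, ∀ τ, F.gw d (s + Multiset.replicate k (F.high τ)) = 0) (τ : H) :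
    HasSum (fun n : ℕ => ((n.factorial : ℂ))⁻¹ * F.gw d (s + Multiset.replicate n τ))
      (exp (F.curveIntegral d (GradedAlgebra.proj F.grade 1 τ)) * ∑ k ∈ Finset.range K,
        ((k.factorial : ℂ))⁻¹ * F.gw d (s + Multiset.replicate k (F.high τ))) := by
  set c := F.curveIntegral d (GradedAlgebra.proj F.grade 1 τ) with hc
  set f : ℕ → ℂ := fun n => c ^ n / n.factorial
  set g : ℕ → ℂ := fun k => ((k.factorial : ℂ))⁻¹ * F.gw d (s + Multiset.replicate k (F.high τ))
  have hf : HasSum f (exp c) := by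
    have := NormedSpace.expSeries_div_hasSum_exp c
    rwa [← Complex.exp_eq_exp_ℂ] at this
  have hg0 : ∀ k ∉ Finset.range K, g k = 0 := by
    intro k hk
    simp only [g]
    rw [hK k (by simpa using hk) τ, mul_zero]
  have hg : HasSum g (∑ k ∈ Finset.range K, g k) := hasSum_sum_of_ne_finset_zero hg0
  have hfn : Summable fun n => ‖f n‖ := hf.summable.norm
  have hgn : Summable fun n => ‖g n‖ := hg.summable.norm
  have h1 := (summable_norm_sum_mul_antidiagonal_of_summable_norm hfn hgn).of_norm.hasSum
  rw [← tsum_mul_tsum_eq_tsum_sum_antidiagonal_of_summable_norm hfn hgn, hf.tsum_eq,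
    hg.tsum_eq] at h1
  refine HasSum.of_eq (h1) fun n => ?_
  rw [F.gw_add_replicate d τ n hs, Finset.mul_sum]
  refine Finset.sum_congr rfl fun q hq => ?_
  simp only [f, g]
  have hq' := Finset.HasAntidiagonal.mem_antidiagonal.1 hq
  rw [← hq', ← hc]
  have h0 : ((q.1 + q.2).factorial : ℂ) =
      (q.1 + q.2).choose q.1 * q.1.factorial * q.2.factorial := by
    exact_mod_cast (Nat.choose_symm_add (a := q.1) (b := q.2) ▸
      Nat.add_choose_mul_factorial_mul_factorial q.1 q.2).symm
  have h1 : ((q.1 + q.2).choose q.1 : ℂ) ≠ 0 := by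
    exact_mod_cast (Nat.choose_pos (Nat.le_add_right _ _)).ne'
  have h2 : (q.1.factorial : ℂ) ≠ 0 := by exact_mod_cast Nat.factorial_ne_zero _
  have h3 : (q.2.factorial : ℂ) ≠ 0 := by exact_mod_cast Nat.factorial_ne_zero _
  rw [h0]
  field_simp

theorem hasSum_degreeSum (d : D) {s : Multiset H} (hs : 3 ≤ s.card) (τ : H) :
    HasSum (fun n : ℕ => ((n.factorial : ℂ))⁻¹ * F.gw d (s + Multiset.replicate n τ))
      (F.degreeSum d s τ) := by
  obtain ⟨K, hK⟩ := F.exists_gw_high_eq_zero d hs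
  exact (F.hasSum_degreeSum_aux d hs hK τ).summable.hasSum

theorem degreeSum_eq (d : D) {s : Multiset H} (hs : 3 ≤ s.card) {K : ℕ}
    (hK : ∀ k ≥ K, ∀ τ, F.gw d (s + Multiset.replicate k (F.high τ)) = 0) (τ : H) :
    F.degreeSum d s τ = exp (F.curveIntegral d (GradedAlgebra.proj F.grade 1 τ)) *
      ∑ k ∈ Finset.range K, ((k.factorial : ℂ))⁻¹ *
        F.gw d (s + Multiset.replicate k (F.high τ)) :=
  (F.hasSum_degreeSum_aux d hs hK τ).tsum_eq

/-- The sums `degreeSum` as linear functions of one insertion. -/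
theorem degreeSum_linear (d : D) {s : Multiset H} (hs : 2 ≤ s.card) (τ : H) :
    IsLinearMap ℂ fun a => F.degreeSum d (a ::ₘ s) τ := by
  have hc : ∀ a : H, 3 ≤ (a ::ₘ s).card := fun a => by rw [Multiset.card_cons]; omega
  have hc' : ∀ n, 2 ≤ (s + Multiset.replicate n τ).card := fun n => by
    rw [Multiset.card_add]
    omega
  constructor
  · intro a b
    refine ((F.hasSum_degreeSum d (hc (a + b)) τ).unique ?_)
    refine HasSum.of_eq ((F.hasSum_degreeSum d (hc a) τ).add (F.hasSum_degreeSum d (hc b) τ))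
      fun n => ?_
    simp only [Multiset.cons_add]
    rw [F.gw_add_cons d (hc' n)]
    ring
  · intro c a
    refine ((F.hasSum_degreeSum d (hc (c • a)) τ).unique ?_)
    refine HasSum.of_eq ((F.hasSum_degreeSum d (hc a) τ).mul_left c) fun n => ?_
    simp only [Multiset.cons_add]
    rw [F.gw_smul_cons d (hc' n)]
    ring

theorem degreeSum_cons (d : D) {s : Multiset H} (hs : 3 ≤ s.card) (γ τ : H) :
    F.degreeSum d (γ ::ₘ s) τ = F.curveIntegral d (GradedAlgebra.proj F.grade 1 γ) *
      F.degreeSum d s τ + F.degreeSum d (F.high γ ::ₘ s) τ := by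
  have hc : ∀ a : H, 3 ≤ (a ::ₘ s).card := fun a => by rw [Multiset.card_cons]; omega
  refine (F.hasSum_degreeSum d (hc γ) τ).unique ?_
  refine HasSum.of_eq (((F.hasSum_degreeSum d hs τ).mul_left
    (F.curveIntegral d (GradedAlgebra.proj F.grade 1 γ))).add
      (F.hasSum_degreeSum d (hc (F.high γ)) τ)) fun n => ?_
  simp only [Multiset.cons_add]
  rw [F.gw_cons d (by rw [Multiset.card_add]; omega)]
  ring

/-- The weight of a multiset of homogeneous insertions in the dimension axiom. -/
def excess (d : D) (S : Multiset (ℕ × H)) : ℂ :=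
  ((S.map Prod.fst).sum : ℕ) - S.card + 3 - F.dim - F.curveIntegral d F.c₁

theorem excess_cons (d : D) (S : Multiset (ℕ × H)) (p : ℕ) (a : H) :
    F.excess d ((p, a) ::ₘ S) = F.excess d S + p - 1 := by
  simp only [excess, Multiset.map_cons, Multiset.sum_cons, Multiset.card_cons]
  push_cast
  ring

theorem excess_mul_gw (d : D) {S : Multiset (ℕ × H)} (hS : 3 ≤ S.card)
    (hS' : ∀ x ∈ S, x.2 ∈ F.grade x.1) : F.excess d S * F.gw d (S.map Prod.snd) = 0 := by
  by_cases h : (((S.map Prod.fst).sum : ℕ) : ℂ) = F.dim + F.curveIntegral d F.c₁ + S.card - 3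
  · rw [excess, h]
    ring
  · rw [F.gw_dimension d S hS hS' h, mul_zero]

/-- The linear part `τ ↦ ∑ (1 - p) τ_p` of the Euler vector field. -/
def eulerLinear : H →ₗ[ℂ] H := (1 - F.dim / 2 : ℂ) • LinearMap.id - F.mu

theorem euler_eq' (τ : H) : F.euler τ = F.c₁ + F.eulerLinear τ := by
  simp [euler_eq, eulerLinear]

theorem eulerLinear_eq_sum (τ : H) : F.eulerLinear τ =
    ∑ p ∈ Finset.range (F.dim + 1), (1 - (p : ℂ)) • GradedAlgebra.proj F.grade p τ := by
  have := F.euler_eq' τ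
  rw [euler] at this
  exact (add_left_cancel this).symm

/-- Infinitesimal homogeneity. For homogeneous insertions, the excess of `S` together with `n + 1`
components of degrees `p` is `excess S - ∑ (1 - p)` and vanishes on nonzero invariants. By symmetry,
weighting the `n + 1` copies of `τ` by `1 - p` gives `n + 1` times the invariant with one copy
replaced. -/
theorem gw_eulerLinear (d : D) (τ : H) (n : ℕ) : ∀ S : Multiset (ℕ × H), 3 ≤ S.card →
    (∀ x ∈ S, x.2 ∈ F.grade x.1) →
    (n + 1 : ℂ) * F.gw d (F.eulerLinear τ ::ₘ (S.map Prod.snd + Multiset.replicate n τ)) =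
      F.excess d S * F.gw d (S.map Prod.snd + Multiset.replicate (n + 1) τ) := by
  induction n with
  | zero =>
    intro S hS hS'
    have hc : 2 ≤ (S.map Prod.snd).card := by rw [Multiset.card_map]; omega
    simp only [Multiset.replicate_zero, add_zero, zero_add, Multiset.replicate_one, Nat.cast_zero,
      one_mul]
    rw [Multiset.add_comm, Multiset.singleton_add]
    conv_rhs => rw [← F.sum_range_proj (Nat.lt_succ_self _) τ]
    rw [F.eulerLinear_eq_sum, F.gw_sum_cons d hc, F.gw_sum_cons d hc, Finset.mul_sum]
    refine Finset.sum_congr rfl fun p _ => ?_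
    rw [F.gw_smul_cons d hc]
    have := F.excess_mul_gw d (S := (p, GradedAlgebra.proj F.grade p τ) ::ₘ S)
      (by rw [Multiset.card_cons]; omega)
      (by
        intro x hx
        rcases Multiset.mem_cons.1 hx with rfl | hx
        · exact F.proj_mem _ _
        · exact hS' x hx)
    rw [F.excess_cons, Multiset.map_cons] at this
    linear_combination -this
  | succ n ih =>
    intro S hS hS'
    have hc : ∀ m (σ : H), 2 ≤ (S.map Prod.snd + Multiset.replicate m σ).card := fun m σ => by
      rw [Multiset.card_add, Multiset.card_map]
      omega
    have hc' : ∀ m (σ a : H), 2 ≤ (a ::ₘ (S.map Prod.snd + Multiset.replicate m σ)).card :=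
      fun m σ a => by
        rw [Multiset.card_cons]
        have := hc m σ
        omega
    have e1 : F.gw d (F.eulerLinear τ ::ₘ (S.map Prod.snd + Multiset.replicate (n + 1) τ)) =
        ∑ p ∈ Finset.range (F.dim + 1), (1 - (p : ℂ)) * F.gw d (GradedAlgebra.proj F.grade p τ ::ₘ
          (S.map Prod.snd + Multiset.replicate (n + 1) τ)) := by
      rw [F.eulerLinear_eq_sum, F.gw_sum_cons d (hc _ _)]
      exact Finset.sum_congr rfl fun p _ => F.gw_smul_cons d (hc _ _) _ _
    -- A component of degree `p` moved into `S` changes the excess by `p - 1`, and the induction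
    -- hypothesis treats the remaining copies.
    have e2 : (n + 1 : ℂ) * F.gw d (F.eulerLinear τ ::ₘ (S.map Prod.snd +
        Multiset.replicate (n + 1) τ)) =
        ∑ p ∈ Finset.range (F.dim + 1), (F.excess d S + p - 1) *
          F.gw d (GradedAlgebra.proj F.grade p τ ::ₘ
            (S.map Prod.snd + Multiset.replicate (n + 1) τ)) := by
      have hsw : F.eulerLinear τ ::ₘ (S.map Prod.snd + Multiset.replicate (n + 1) τ) =
          (∑ p ∈ Finset.range (F.dim + 1), GradedAlgebra.proj F.grade p τ) ::ₘ
            F.eulerLinear τ ::ₘ (S.map Prod.snd + Multiset.replicate n τ) := by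
        rw [F.sum_range_proj (Nat.lt_succ_self _), Multiset.replicate_succ, Multiset.add_cons,
          Multiset.cons_swap]
      rw [hsw, F.gw_sum_cons d (hc' _ _ _), Finset.mul_sum]
      refine Finset.sum_congr rfl fun p _ => ?_
      have := ih ((p, GradedAlgebra.proj F.grade p τ) ::ₘ S)
        (by rw [Multiset.card_cons]; omega)
        (by
          intro x hx
          rcases Multiset.mem_cons.1 hx with rfl | hx
          · exact F.proj_mem _ _
          · exact hS' x hx)
      rw [F.excess_cons, Multiset.map_cons, Multiset.cons_add, Multiset.cons_add,
        Multiset.cons_swap] at this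
      exact this
    have e3 : F.gw d (S.map Prod.snd + Multiset.replicate (n + 1 + 1) τ) =
        ∑ p ∈ Finset.range (F.dim + 1), F.gw d (GradedAlgebra.proj F.grade p τ ::ₘ
            (S.map Prod.snd + Multiset.replicate (n + 1) τ)) := by
      rw [← F.gw_sum_cons d (hc _ _), F.sum_range_proj (Nat.lt_succ_self _),
        Multiset.replicate_succ _ (n + 1), Multiset.add_cons]
    push_cast
    rw [add_mul (n + 1 : ℂ), one_mul, e2, e1, e3, ← Finset.sum_add_distrib, Finset.mul_sum]
    refine Finset.sum_congr rfl fun p _ => ?_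
    ring

/-- The divisor contribution of `c₁` cancels the dependence of the excess on `d`, so the identity
can be summed over `d`. -/
theorem degreeSum_euler (d : D) (τ : H) {S : Multiset (ℕ × H)} (hS : 3 ≤ S.card)
    (hS' : ∀ x ∈ S, x.2 ∈ F.grade x.1) :
    F.degreeSum d (F.euler τ ::ₘ S.map Prod.snd) τ =
      (F.excess d S + F.curveIntegral d F.c₁) * F.degreeSum d (S.map Prod.snd) τ := by
  have hc : 3 ≤ (S.map Prod.snd).card := by rwa [Multiset.card_map]
  have hc' : ∀ a : H, 3 ≤ (a ::ₘ S.map Prod.snd).card := fun a => by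
    rw [Multiset.card_cons]
    omega
  have h1 : F.degreeSum d (F.eulerLinear τ ::ₘ S.map Prod.snd) τ =
      F.excess d S * F.degreeSum d (S.map Prod.snd) τ := by
    refine (F.hasSum_degreeSum d (hc' _) τ).unique ?_
    have h2 := ((F.hasSum_degreeSum d hc τ).mul_left (F.excess d S))
    -- The term `n = 0` vanishes by the dimension axiom; the shift by one turns `1 / (n + 1)!` into
    -- the factor `1 / n!` of the other side.
    have h3 := (hasSum_nat_add_iff' 1).2 h2
    rw [Finset.sum_range_one] at h3
    simp only [Nat.factorial_zero, Nat.cast_one, inv_one, one_mul, Multiset.replicate_zero,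
      add_zero, F.excess_mul_gw d hS hS', sub_zero] at h3
    refine HasSum.of_eq (h3) fun n => ?_
    have := F.gw_eulerLinear d τ n S hS hS'
    rw [Multiset.cons_add, mul_left_comm, ← this, Nat.factorial_succ]
    have hn : (n + 1 : ℂ) ≠ 0 := by exact_mod_cast Nat.succ_ne_zero n
    have hn' : (n.factorial : ℂ) ≠ 0 := by exact_mod_cast Nat.factorial_ne_zero n
    push_cast
    field_simp
  have h2 : F.degreeSum d (F.c₁ ::ₘ S.map Prod.snd) τ =
      F.curveIntegral d F.c₁ * F.degreeSum d (S.map Prod.snd) τ := by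
    refine (F.hasSum_degreeSum d (hc' _) τ).unique ?_
    refine HasSum.of_eq (((F.hasSum_degreeSum d hc τ).mul_left (F.curveIntegral d F.c₁)))
      fun n => ?_
    rw [Multiset.cons_add, F.gw_divisor d _ F.c₁_mem _ (by rw [Multiset.card_add]; omega)]
    ring
  have h3 := (F.degreeSum_linear d (s := S.map Prod.snd) (by omega) τ).map_add F.c₁
    (F.eulerLinear τ)
  rw [F.euler_eq', h3, h1, h2]
  ring

end

end GromovWittenTheory

/-! ### Derivatives and homogeneity of the three-point functions. -/

namespace GromovWittenTheory

noncomputable section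

variable {H D : Type*} [NormedCommRing H] [NormedAlgebra ℂ H] [FiniteDimensional ℂ H]
  [AddCommMonoid D] [Finset.HasAntidiagonal D] (F : GromovWittenTheory H D)

theorem gw_cons_eq_sum (d : D) {s : Multiset H} (hs : 2 ≤ s.card) (τ : H) :
    F.gw d (τ ::ₘ s) = ∑ i, (Module.finBasis ℂ H).coord i τ *
      F.gw d (Module.finBasis ℂ H i ::ₘ s) := by
  conv_lhs => rw [← (Module.finBasis ℂ H).sum_repr τ]
  rw [F.gw_sum_cons d hs]
  exact Finset.sum_congr rfl fun i _ => F.gw_smul_cons d hs _ _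

theorem hasFDerivAt_coord {ι : Type*} [Finite ι] (e : Module.Basis ι ℂ H) (i : ι) (τ : H) :
    HasFDerivAt (fun τ => e.coord i τ) (LinearMap.toContinuousLinearMap (e.coord i)) τ :=
  (LinearMap.toContinuousLinearMap (e.coord i)).hasFDerivAt

/-- Expanding one copy of `τ` in a basis makes this an induction on `k`: differentiation replaces
one of the `k` equal copies by `γ`. For `k = 0` the truncated `k - 1` is harmless because of the
factor `k`. -/
theorem differentiable_gw_replicate (d : D) (k : ℕ) : ∀ s : Multiset H, 3 ≤ s.card →
    Differentiable ℂ (fun τ => F.gw d (s + Multiset.replicate k τ)) ∧ ∀ τ γ,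
      fderiv ℂ (fun τ => F.gw d (s + Multiset.replicate k τ)) τ γ =
        k * F.gw d (γ ::ₘ (s + Multiset.replicate (k - 1) τ)) := by
  induction k with
  | zero => intro s hs; simp
  | succ k ih =>
    intro s hs
    set e := Module.finBasis ℂ H
    have hcs : ∀ m (τ : H), 2 ≤ (s + Multiset.replicate m τ).card := fun m τ => by
      rw [Multiset.card_add]
      omega
    have hce : ∀ i, 3 ≤ (e i ::ₘ s).card := fun i => by rw [Multiset.card_cons]; omega
    have hfun : (fun τ => F.gw d (s + Multiset.replicate (k + 1) τ)) =
        fun τ => ∑ i, e.coord i τ * F.gw d (e i ::ₘ s + Multiset.replicate k τ) := by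
      funext τ
      rw [Multiset.replicate_succ, Multiset.add_cons, F.gw_cons_eq_sum d (hcs _ _)]
      simp only [Multiset.cons_add, e]
    have hd : ∀ τ, HasFDerivAt (fun τ => ∑ i, e.coord i τ *
        F.gw d (e i ::ₘ s + Multiset.replicate k τ)) _ τ := fun τ =>
      HasFDerivAt.fun_sum fun i _ => (hasFDerivAt_coord e i τ).mul
        ((ih (e i ::ₘ s) (hce i)).1 τ).hasFDerivAt
    rw [hfun]
    refine ⟨fun τ => (hd τ).differentiableAt, fun τ γ => ?_⟩
    rw [(hd τ).fderiv]
    simp only [FunLike.coe_sum, Finset.sum_apply, add_apply,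
      smul_apply, smul_eq_mul, LinearMap.coe_toContinuousLinearMap',
      (ih _ (hce _)).2]
    rw [Finset.sum_add_distrib, Nat.add_sub_cancel]
    have h1 : ∑ i, F.gw d (e i ::ₘ s + Multiset.replicate k τ) * e.coord i γ =
        F.gw d (γ ::ₘ (s + Multiset.replicate k τ)) := by
      rw [F.gw_cons_eq_sum d (hcs _ _) γ]
      refine Finset.sum_congr rfl fun i _ => ?_
      rw [Multiset.cons_add]
      ring
    have h2 : ∑ i, e.coord i τ * (k * F.gw d (γ ::ₘ (e i ::ₘ s + Multiset.replicate (k - 1) τ))) =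
        k * F.gw d (γ ::ₘ (s + Multiset.replicate k τ)) := by
      rcases Nat.eq_zero_or_pos k with rfl | hk
      · simp
      · obtain ⟨m, rfl⟩ : ∃ m, k = m + 1 := ⟨k - 1, by omega⟩
        rw [Nat.add_sub_cancel, Multiset.replicate_succ, Multiset.add_cons, Multiset.cons_swap,
          F.gw_cons_eq_sum d (by rw [Multiset.card_cons]; have := hcs m τ; omega) τ,
          Finset.mul_sum]
        refine Finset.sum_congr rfl fun i _ => ?_
        rw [Multiset.cons_add, Multiset.cons_swap]
        simp only [e]
        ring
    rw [h1, h2]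
    push_cast
    ring

/-- In the form exponential times polynomial, the derivative of the exponential produces the divisor
part of `γ` and that of the polynomial the part `high γ`; `degreeSum_cons` reassembles them. -/
theorem differentiable_degreeSum (d : D) {s : Multiset H} (hs : 3 ≤ s.card) :
    Differentiable ℂ (F.degreeSum d s) ∧
      ∀ τ γ, fderiv ℂ (F.degreeSum d s) τ γ = F.degreeSum d (γ ::ₘ s) τ := by
  obtain ⟨K, hK⟩ := F.exists_gw_high_eq_zero d hs
  let c : H →L[ℂ] ℂ := LinearMap.toContinuousLinearMap
    (F.curveIntegral d ∘ₗ GradedAlgebra.proj F.grade 1)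
  let h : H →L[ℂ] H := LinearMap.toContinuousLinearMap F.high
  -- One term more than needed, because differentiating the polynomial kills its constant term and
  -- leaves `K` terms.
  have hfun : F.degreeSum d s = fun τ => exp (c τ) * ∑ k ∈ Finset.range (K + 1),
      ((k.factorial : ℂ))⁻¹ * F.gw d (s + Multiset.replicate k (h τ)) := by
    funext τ
    exact F.degreeSum_eq d hs (fun k hk τ => hK k (by omega) τ) τ
  have hg : ∀ k τ, HasFDerivAt (fun τ => F.gw d (s + Multiset.replicate k (h τ)))
      ((fderiv ℂ (fun τ => F.gw d (s + Multiset.replicate k τ)) (h τ)).comp h) τ := fun k τ =>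
    (((F.differentiable_gw_replicate d k s hs).1 (h τ)).hasFDerivAt).comp τ h.hasFDerivAt
  have hd : ∀ τ, HasFDerivAt (fun τ => exp (c τ) * ∑ k ∈ Finset.range (K + 1),
      ((k.factorial : ℂ))⁻¹ * F.gw d (s + Multiset.replicate k (h τ))) _ τ := fun τ =>
    (c.hasFDerivAt.cexp).mul (HasFDerivAt.fun_sum fun k _ => (hg k τ).const_mul _)
  refine ⟨by rw [hfun]; exact fun τ => (hd τ).differentiableAt, fun τ γ => ?_⟩
  have hKγ : ∀ k ≥ K, ∀ τ, F.gw d (F.high γ ::ₘ s + Multiset.replicate k (F.high τ)) = 0 := by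
    intro k hk τ
    -- polarize the vanishing at `k + 1`
    have h1 : (fun τ => F.gw d (s + Multiset.replicate (k + 1) (h τ))) = fun _ => 0 := by
      funext τ
      exact hK (k + 1) (by omega) τ
    have h2 := (hg (k + 1) τ).fderiv
    rw [h1] at h2
    have h3 := congrArg (fun L : H →L[ℂ] ℂ => L γ) h2
    simp only [fderiv_fun_const, Pi.zero_apply, zero_apply,
      ContinuousLinearMap.comp_apply, (F.differentiable_gw_replicate d (k + 1) s hs).2,
      Nat.add_sub_cancel] at h3
    rw [Multiset.cons_add]
    have h4 : ((k + 1 : ℕ) : ℂ) ≠ 0 := by exact_mod_cast Nat.succ_ne_zero k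
    exact (mul_eq_zero.1 h3.symm).resolve_left h4
  rw [F.degreeSum_cons d hs γ τ,
    F.degreeSum_eq d (s := F.high γ ::ₘ s) (by rw [Multiset.card_cons]; omega) hKγ τ]
  have hval := congrFun hfun τ
  conv_lhs => rw [hfun]
  rw [(hd τ).fderiv, hval]
  simp only [add_apply, smul_apply, smul_eq_mul,
    FunLike.coe_sum, Finset.sum_apply, ContinuousLinearMap.comp_apply,
    (F.differentiable_gw_replicate d _ s hs).2]
  rw [Finset.sum_range_succ' (fun k => ((k.factorial : ℂ))⁻¹ *
    (k * F.gw d (h γ ::ₘ (s + Multiset.replicate (k - 1) (h τ)))))]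
  have hsum : ∀ k ∈ Finset.range K, (((k + 1).factorial : ℂ))⁻¹ * (((k + 1 : ℕ) : ℂ) *
      F.gw d (h γ ::ₘ (s + Multiset.replicate (k + 1 - 1) (h τ)))) = ((k.factorial : ℂ))⁻¹ *
        F.gw d (F.high γ ::ₘ s + Multiset.replicate k (F.high τ)) := by
    intro k _
    rw [Nat.factorial_succ, Nat.add_sub_cancel, Multiset.cons_add]
    have hn : (k + 1 : ℂ) ≠ 0 := by exact_mod_cast Nat.succ_ne_zero k
    have hn' : (k.factorial : ℂ) ≠ 0 := by exact_mod_cast Nat.factorial_ne_zero k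
    change _ = _ * F.gw d (h γ ::ₘ (s + Multiset.replicate k (h τ)))
    push_cast
    field_simp
  rw [Finset.sum_congr rfl hsum]
  change exp (c τ) * (_ + _) + _ * (exp (c τ) * c γ) = c γ * _ + exp (c τ) * _
  push_cast
  ring

section Convergent

variable {F} {B : Set H}

omit [FiniteDimensional ℂ H] in
theorem ConvergesOn.tendsto (hconv : F.ConvergesOn B) (a b c : H) :
    TendstoLocallyUniformlyOn (fun (S : Finset D) τ => ∑ d ∈ S,
      F.degreeSum d (a ::ₘ b ::ₘ c ::ₘ 0) τ) (fun τ => F.threePoint τ a b c) atTop B := by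
  have h := (hconv a b c).2.hasSumLocallyUniformlyOn
  rw [hasSumLocallyUniformlyOn_iff_tendstoLocallyUniformlyOn] at h
  simp only [quantumTerm_eq] at h
  simp only [threePoint_eq]
  exact h

omit [FiniteDimensional ℂ H] in
theorem ConvergesOn.hasSum (hconv : F.ConvergesOn B) (a b c : H) {τ : H} (hτ : τ ∈ B) :
    HasSum (fun d => F.degreeSum d (a ::ₘ b ::ₘ c ::ₘ 0) τ) (F.threePoint τ a b c) :=
  (hconv.tendsto a b c).tendsto_at hτ

theorem ConvergesOn.analyticOnNhd_threePoint (hconv : F.ConvergesOn B) (hB : IsOpen B)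
    (a b c : H) : AnalyticOnNhd ℂ (fun τ => F.threePoint τ a b c) B := by
  refine (hconv.tendsto a b c).analyticOnNhd hB (Eventually.of_forall fun S => ?_)
  refine DifferentiableOn.analyticOnNhd_of_finiteDimensional ?_ hB
  exact DifferentiableOn.fun_sum fun d _ =>
    ((F.differentiable_degreeSum d (by simp)).1).differentiableOn

/-- Locally uniform limits of holomorphic functions may be differentiated; this is applied on the
complex line `τ + t γ`. -/
theorem ConvergesOn.hasSum_fderiv (hconv : F.ConvergesOn B) (hB : IsOpen B)
    (a b c : H) {τ : H} (hτ : τ ∈ B) (γ : H) :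
    HasSum (fun d => F.degreeSum d (γ ::ₘ a ::ₘ b ::ₘ c ::ₘ 0) τ)
      (fderiv ℂ (fun τ => F.threePoint τ a b c) τ γ) := by
  have hopen : IsOpen {t : ℂ | τ + t • γ ∈ B} := hB.preimage (by fun_prop)
  have h0 : (0 : ℂ) ∈ {t : ℂ | τ + t • γ ∈ B} := by simpa using hτ
  have hds : ∀ d, Differentiable ℂ (F.degreeSum d (a ::ₘ b ::ₘ c ::ₘ 0)) := fun d =>
    (F.differentiable_degreeSum d (by simp)).1
  have hline : ∀ f : H → ℂ, DifferentiableAt ℂ f τ →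
      deriv (fun t : ℂ => f (τ + t • γ)) 0 = fderiv ℂ f τ γ := fun f hf =>
    ((hf.hasFDerivAt).hasLineDerivAt γ).deriv
  have h1 := ((hconv.tendsto a b c).comp_line τ γ).deriv (Eventually.of_forall fun S => by
    refine Differentiable.differentiableOn ?_
    refine Differentiable.fun_sum fun d _ => (hds d).comp (by fun_prop)) hopen
  have h2 := h1.tendsto_at h0
  rw [hline _ ((hconv.analyticOnNhd_threePoint hB a b c τ hτ).differentiableAt)] at h2
  refine h2.congr fun S => ?_
  simp only [Function.comp]
  rw [hline (fun τ => ∑ d ∈ S, F.degreeSum d (a ::ₘ b ::ₘ c ::ₘ 0) τ)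
    (DifferentiableAt.fun_sum fun d _ => hds d τ)]
  rw [fderiv_fun_sum fun d _ => hds d τ]
  simp [(F.differentiable_degreeSum _ _).2]

/-- Both sides are the same four-point function, symmetric in its insertions. This is the
potentiality of the product. -/
theorem ConvergesOn.fderiv_threePoint_symm (hconv : F.ConvergesOn B) (hB : IsOpen B)
    (a b c : H) {τ : H} (hτ : τ ∈ B) (γ : H) :
    fderiv ℂ (fun τ => F.threePoint τ a b c) τ γ =
      fderiv ℂ (fun τ => F.threePoint τ γ b c) τ a := by
  refine (hconv.hasSum_fderiv hB a b c hτ γ).unique ?_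
  rw [Multiset.cons_swap]
  exact hconv.hasSum_fderiv hB γ b c hτ a

omit [FiniteDimensional ℂ H] in
theorem ConvergesOn.threePoint_swap (a b c τ : H) :
    F.threePoint τ a b c = F.threePoint τ b a c := by
  simp only [threePoint_eq]
  rw [Multiset.cons_swap]

omit [FiniteDimensional ℂ H] in
theorem ConvergesOn.threePoint_swap' (a b c τ : H) :
    F.threePoint τ a b c = F.threePoint τ a c b := by
  simp only [threePoint_eq]
  rw [Multiset.cons_swap b c]

omit [FiniteDimensional ℂ H] in
theorem ConvergesOn.linear_threePoint (hconv : F.ConvergesOn B) (b c : H) {τ : H} (hτ : τ ∈ B) :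
    IsLinearMap ℂ fun a => F.threePoint τ a b c where
  map_add a a' := by
    refine (hconv.hasSum (a + a') b c hτ).unique ?_
    refine HasSum.of_eq ((hconv.hasSum a b c hτ).add (hconv.hasSum a' b c hτ)) fun d => ?_
    exact (F.degreeSum_linear d (by simp) τ).map_add a a'
  map_smul r a := by
    refine (hconv.hasSum (r • a) b c hτ).unique ?_
    refine HasSum.of_eq ((hconv.hasSum a b c hτ).const_smul r) fun d => ?_
    exact (F.degreeSum_linear d (by simp) τ).map_smul r a

theorem ConvergesOn.pairing_star (hconv : F.ConvergesOn B) (a b c : H) {τ : H} (hτ : τ ∈ B) :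
    F.pairing (F.star τ a b) c = F.threePoint τ a b c := by
  let L : H →ₗ[ℂ] ℂ := IsLinearMap.mk' _ (hconv.linear_threePoint b a hτ)
  have hL : ∀ c, L c = F.threePoint τ a b c := fun c => by
    change F.threePoint τ c b a = _
    rw [ConvergesOn.threePoint_swap, ConvergesOn.threePoint_swap', ConvergesOn.threePoint_swap]
  rw [← hL]
  refine LinearMap.congr_fun ((Module.finBasis ℂ H).ext fun j => ?_) c
  rw [F.pairing_star_finBasis, hL]

/-- The homogeneity of the three-point functions. -/
theorem ConvergesOn.fderiv_threePoint_euler (hconv : F.ConvergesOn B) (hB : IsOpen B)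
    (a b c : H) {τ : H} (hτ : τ ∈ B) :
    fderiv ℂ (fun τ => F.threePoint τ a b c) τ (F.euler τ) =
      F.threePoint τ (F.mu a) b c + F.threePoint τ a (F.mu b) c + F.threePoint τ a b (F.mu c) +
        F.dim / 2 * F.threePoint τ a b c := by
  have hE : ∀ a b c, HasSum (fun d => F.degreeSum d (F.euler τ ::ₘ a ::ₘ b ::ₘ c ::ₘ 0) τ)
      (fderiv ℂ (fun τ => F.threePoint τ a b c) τ (F.euler τ)) := fun a b c =>
    hconv.hasSum_fderiv hB a b c hτ _
  -- The identity is proved degree by degree. It is additive and symmetric in `a, b, c`, and for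
  -- homogeneous classes it is `degreeSum_euler`: the weight `p + q + m - dim` is the sum of the
  -- three eigenvalues of `μ` and `dim / 2`.
  let P : H → H → H → Prop := fun a b c => ∀ d, F.degreeSum d (F.euler τ ::ₘ a ::ₘ b ::ₘ c ::ₘ 0) τ
    = F.degreeSum d (F.mu a ::ₘ b ::ₘ c ::ₘ 0) τ + F.degreeSum d (a ::ₘ F.mu b ::ₘ c ::ₘ 0) τ +
      F.degreeSum d (a ::ₘ b ::ₘ F.mu c ::ₘ 0) τ +
        F.dim / 2 * F.degreeSum d (a ::ₘ b ::ₘ c ::ₘ 0) τ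
  have swap12 : ∀ a b c, P a b c → P b a c := by
    intro a b c h d
    have := h d
    rw [Multiset.cons_swap a b, Multiset.cons_swap (F.mu a) b, Multiset.cons_swap a (F.mu b),
      Multiset.cons_swap a b] at this
    rw [this]
    ring
  have swap23 : ∀ a b c, P a b c → P a c b := by
    intro a b c h d
    have := h d
    rw [Multiset.cons_swap b c, Multiset.cons_swap (F.mu b) c, Multiset.cons_swap b (F.mu c)]
      at this
    rw [this]
    ring
  have hadd : ∀ b c a a', P a b c → P a' b c → P (a + a') b c := by
    intro b c a a' h h' d
    have hl : ∀ (s : Multiset H), 2 ≤ s.card → ∀ a a', F.degreeSum d ((a + a') ::ₘ s) τ =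
        F.degreeSum d (a ::ₘ s) τ + F.degreeSum d (a' ::ₘ s) τ := fun s hs a a' =>
      (F.degreeSum_linear d hs τ).map_add a a'
    have h1 := h d
    have h2 := h' d
    rw [Multiset.cons_swap (F.euler τ)] at h1 h2 ⊢
    rw [hl _ (by simp), hl _ (by simp), hl _ (by simp), hl _ (by simp), map_add,
      hl _ (by simp), h1, h2]
    ring
  have hsmul : ∀ d (s : Multiset H), 2 ≤ s.card → ∀ (r : ℂ) a, F.degreeSum d ((r • a) ::ₘ s) τ =
      r * F.degreeSum d (a ::ₘ s) τ := fun d s hs r a => (F.degreeSum_linear d hs τ).map_smul r a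
  have hhom : ∀ p, ∀ a ∈ F.grade p, ∀ q, ∀ b ∈ F.grade q, ∀ m, ∀ c ∈ F.grade m, P a b c := by
    intro p a ha q b hb m c hc d
    have := F.degreeSum_euler d τ (S := (p, a) ::ₘ (q, b) ::ₘ (m, c) ::ₘ 0) (by simp) (by
      intro x hx
      simp only [Multiset.mem_cons, Multiset.notMem_zero, or_false] at hx
      rcases hx with rfl | rfl | rfl <;> assumption)
    simp only [Multiset.map_cons, Multiset.map_zero, excess, Multiset.sum_cons, Multiset.sum_zero,
      Multiset.card_cons, Multiset.card_zero] at this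
    rw [this, F.mu_of_mem ha, F.mu_of_mem hb, F.mu_of_mem hc, hsmul d _ (by simp),
      Multiset.cons_swap a (_ • b), hsmul d _ (by simp), Multiset.cons_swap b a,
      Multiset.cons_swap b (_ • c), Multiset.cons_swap a (_ • c), hsmul d _ (by simp),
      Multiset.cons_swap c a, Multiset.cons_swap c b]
    push_cast
    ring
  have hP : P a b c := by
    refine F.homogeneous_induction (P := fun a => P a b c) (fun p a ha => ?_)
      (fun a a' => hadd b c a a') a
    refine F.homogeneous_induction (P := fun b => P a b c) (fun q b hb => ?_)
      (fun b b' h h' => swap12 _ _ _ (hadd a c b b' (swap12 _ _ _ h) (swap12 _ _ _ h'))) b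
    refine F.homogeneous_induction (P := fun c => P a b c) (fun m c hc => hhom p a ha q b hb m c hc)
      (fun c c' h h' => ?_) c
    exact swap23 _ _ _ (swap12 _ _ _ (hadd a b c c' (swap12 _ _ _ (swap23 _ _ _ h))
      (swap12 _ _ _ (swap23 _ _ _ h'))))
  refine (hE a b c).unique ?_
  refine HasSum.of_eq ((((hconv.hasSum (F.mu a) b c hτ).add (hconv.hasSum a (F.mu b) c hτ)).add
    (hconv.hasSum a b (F.mu c) hτ)).add ((hconv.hasSum a b c hτ).mul_left (F.dim / 2 : ℂ)))
      fun d => hP d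

end Convergent

end

end GromovWittenTheory

/-! ### Frobenius structures in an idempotent frame, and local extension of idempotents and square
roots. -/

/-- A semisimple Frobenius structure with Euler field in a frame of normalized idempotents:
`C τ a` is the multiplication by `a`, `V τ` the multiplication by the Euler field, `Ψ` are the
normalized idempotents, `ψ` the idempotents and `u` the canonical coordinates. -/
structure SemisimpleFrame (ι H : Type*) [Fintype ι] [DecidableEq ι] [NormedAddCommGroup H]
    [NormedSpace ℂ H] (S : Set H) where
  /-- the multiplication -/
  C : H → H →L[ℂ] H →L[ℂ] H
  /-- the multiplication by the Euler field -/
  V : H → H →L[ℂ] H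
  /-- the grading operator -/
  mu : H →L[ℂ] H
  /-- the pairing -/
  Q : H →L[ℂ] H →L[ℂ] ℂ
  /-- the normalized idempotents -/
  Ψ : ι → H → H
  /-- the idempotents -/
  ψ : ι → H → H
  /-- the canonical coordinates -/
  u : ι → H → ℂ
  isOpen : IsOpen S
  analytic_C : AnalyticOnNhd ℂ C S
  analytic_V : AnalyticOnNhd ℂ V S
  analytic_Ψ : ∀ i, AnalyticOnNhd ℂ (Ψ i) S
  analytic_ψ : ∀ i, AnalyticOnNhd ℂ (ψ i) S
  analytic_u : ∀ i, AnalyticOnNhd ℂ (u i) S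
  C_Ψ : ∀ τ ∈ S, ∀ a i, C τ a (Ψ i τ) = fderiv ℂ (u i) τ a • Ψ i τ
  V_Ψ : ∀ τ ∈ S, ∀ i, V τ (Ψ i τ) = u i τ • Ψ i τ
  fderiv_C : ∀ τ ∈ S, ∀ a b, fderiv ℂ C τ a b = fderiv ℂ C τ b a
  fderiv_V : ∀ τ ∈ S, ∀ a x, fderiv ℂ V τ a x = C τ a x + C τ a (mu x) - mu (C τ a x)
  Q_symm : ∀ a b, Q a b = Q b a
  Q_mu : ∀ a b, Q (mu a) b = -Q a (mu b)
  Q_Ψ : ∀ τ ∈ S, ∀ i j, Q (Ψ i τ) (Ψ j τ) = if i = j then 1 else 0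
  sum_Ψ : ∀ τ ∈ S, ∀ x, ∑ i, Q x (Ψ i τ) • Ψ i τ = x
  fderiv_u_ψ : ∀ τ ∈ S, ∀ i j, fderiv ℂ (u i) τ (ψ j τ) = if i = j then 1 else 0

theorem analyticAt_clm_apply {E G K : Type*} [NormedAddCommGroup E] [NormedSpace ℂ E]
    [NormedAddCommGroup G] [NormedSpace ℂ G] [NormedAddCommGroup K] [NormedSpace ℂ K]
    {f : E → G →L[ℂ] K} {g : E → G} {x : E} (hf : AnalyticAt ℂ f x) (hg : AnalyticAt ℂ g x) :
    AnalyticAt ℂ (fun y => f y (g y)) x :=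
  ((ContinuousLinearMap.id ℂ (G →L[ℂ] K)).analyticAt_bilinear (f x, g x)).fun_comp
    (f := fun y => (f y, g y)) (hf.prod hg)

theorem fderiv_clm_apply_apply {E G K : Type*} [NormedAddCommGroup E] [NormedSpace ℂ E]
    [NormedAddCommGroup G] [NormedSpace ℂ G] [NormedAddCommGroup K] [NormedSpace ℂ K]
    {A : E → G →L[ℂ] K} {g : E → G} {x : E} (hA : DifferentiableAt ℂ A x)
    (hg : DifferentiableAt ℂ g x) (a : E) :
    fderiv ℂ (fun y => A y (g y)) x a = fderiv ℂ A x a (g x) + A x (fderiv ℂ g x a) := by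
  rw [fderiv_clm_apply hA hg]
  simp [add_comm]

theorem fderiv_bilinear_apply {E G K L : Type*} [NormedAddCommGroup E] [NormedSpace ℂ E]
    [NormedAddCommGroup G] [NormedSpace ℂ G] [NormedAddCommGroup K] [NormedSpace ℂ K]
    [NormedAddCommGroup L] [NormedSpace ℂ L] (Q : G →L[ℂ] K →L[ℂ] L)
    {f : E → G} {g : E → K} {x : E} (hf : DifferentiableAt ℂ f x)
    (hg : DifferentiableAt ℂ g x) (a : E) : fderiv ℂ (fun y => Q (f y) (g y)) x a =
      Q (fderiv ℂ f x a) (g x) + Q (f x) (fderiv ℂ g x a) := by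
  have hQ : HasFDerivAt (fun y => Q (f y)) (Q ∘L fderiv ℂ f x) x :=
    Q.hasFDerivAt.comp x hf.hasFDerivAt
  rw [fderiv_clm_apply_apply hQ.differentiableAt hg, hQ.fderiv]
  rfl

section

variable {H : Type*} [NormedAddCommGroup H] [NormedSpace ℂ H] [FiniteDimensional ℂ H]

open scoped ContDiff in
/-- Idempotents of an analytic family of commutative algebras extend analytically. -/
theorem exists_analyticAt_idempotent {C : H → H →L[ℂ] H →L[ℂ] H} {τ₀ : H} (hC : AnalyticAt ℂ C τ₀)
    (hcomm : ∀ x y, C τ₀ x y = C τ₀ y x) {ψ₀ : H} (hψ₀ : C τ₀ ψ₀ ψ₀ = ψ₀)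
    (hassoc : ∀ ξ, C τ₀ ψ₀ (C τ₀ ψ₀ ξ) = C τ₀ ψ₀ ξ) :
    ∃ ψ : H → H, AnalyticAt ℂ ψ τ₀ ∧ ψ τ₀ = ψ₀ ∧ ∀ᶠ τ in 𝓝 τ₀, C τ (ψ τ) (ψ τ) = ψ τ := by
  have : CompleteSpace H := FiniteDimensional.complete ℂ H
  let f : H × H → H := fun p => C p.1 p.2 p.2 - p.2
  have hCc : ContDiffAt ℂ ω C τ₀ := hC.contDiffAt
  have hC1 : ContDiffAt ℂ ω (fun p : H × H => C p.1) (τ₀, ψ₀) :=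
    hCc.comp (τ₀, ψ₀) (f := fun p : H × H => p.1) contDiffAt_fst
  have hf : ContDiffAt ℂ ω f (τ₀, ψ₀) :=
    ((hC1.clm_apply contDiffAt_snd).clm_apply contDiffAt_snd).sub contDiffAt_snd
  have hd : HasFDerivAt (fun x => f (τ₀, x)) (fderiv ℂ f (τ₀, ψ₀) ∘L .inr ℂ H H) ψ₀ :=
    ((hf.differentiableAt (by simp)).hasFDerivAt).comp ψ₀ (hasFDerivAt_prodMk_right τ₀ ψ₀)
  have hd' : HasFDerivAt (fun x => f (τ₀, x))
      ((C τ₀ ψ₀) ∘L (.id ℂ H) + (C τ₀).flip ψ₀ - .id ℂ H) ψ₀ :=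
    (HasFDerivAt.clm_apply ((C τ₀).hasFDerivAt) (hasFDerivAt_id ψ₀)).sub (hasFDerivAt_id ψ₀)
  have heq := hd.unique hd'
  -- The derivative is `ξ ↦ 2 ψ₀ ξ - ξ`. If it vanishes at `ξ`, multiplication by `ψ₀` gives `ψ₀ ξ =
  -- 0`, hence `ξ = 0`.
  have hinv : (fderiv ℂ f (τ₀, ψ₀) ∘L .inr ℂ H H).IsInvertible := by
    have hinj : Function.Injective
        ((fderiv ℂ f (τ₀, ψ₀) ∘L .inr ℂ H H : H →L[ℂ] H) : H →ₗ[ℂ] H) := by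
      rw [← LinearMap.ker_eq_bot, LinearMap.ker_eq_bot']
      intro ξ hξ
      rw [heq] at hξ
      have h1 : C τ₀ ψ₀ ξ + C τ₀ ψ₀ ξ - ξ = 0 := by
        have : C τ₀ ψ₀ ξ + C τ₀ ξ ψ₀ - ξ = 0 := hξ
        rwa [hcomm ξ ψ₀] at this
      have h2 := congrArg (C τ₀ ψ₀) h1
      rw [map_sub, map_add, hassoc, map_zero, add_sub_cancel_right] at h2
      rw [h2] at h1
      simpa using h1
    refine ⟨(LinearEquiv.ofInjectiveEndo _ hinj).toContinuousLinearEquiv, ?_⟩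
    ext x
    rfl
  refine ⟨hf.implicitFunction (by simp) hinv, ?_, hf.implicitFunction_apply_self (by simp) hinv, ?_⟩
  · exact (hf.contDiffAt_implicitFunction (by simp) hinv).analyticAt
  · filter_upwards [hf.eventually_apply_implicitFunction (by simp) hinv] with τ hτ
    have h0 : f (τ₀, ψ₀) = 0 := by simp [f, hψ₀]
    rw [h0] at hτ
    exact sub_eq_zero.1 hτ

end

/-- A nonvanishing analytic function has an analytic square root near a point, with a prescribed
value there. -/
theorem exists_analyticAt_sq_eq {H : Type*} [NormedAddCommGroup H] [NormedSpace ℂ H] {f : H → ℂ}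
    {τ₀ : H} (hf : AnalyticAt ℂ f τ₀) {s₀ : ℂ} (hs₀ : s₀ ≠ 0) (h : s₀ ^ 2 = f τ₀) :
    ∃ s : H → ℂ, AnalyticAt ℂ s τ₀ ∧ s τ₀ = s₀ ∧ ∀ᶠ τ in 𝓝 τ₀, s τ ^ 2 = f τ ∧ s τ ≠ 0 := by
  have hs2 : s₀ ^ 2 ≠ 0 := pow_ne_zero 2 hs₀
  have h1 : f τ₀ / s₀ ^ 2 = 1 := by rw [← h, div_self hs2]
  -- Division by `s₀ ^ 2` moves the value at `τ₀` to `1`, where the principal logarithm is analytic.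
  refine ⟨fun τ => s₀ * exp (log (f τ / s₀ ^ 2) / 2), ?_, ?_, ?_⟩
  · refine analyticAt_const.mul (AnalyticAt.cexp ?_)
    refine AnalyticAt.div (AnalyticAt.clog (hf.div analyticAt_const hs2) ?_) analyticAt_const
      two_ne_zero
    rw [h1]
    exact one_mem_slitPlane
  · simp [h1]
  · have hne : ∀ᶠ τ in 𝓝 τ₀, f τ ≠ 0 := hf.continuousAt.eventually_ne (h ▸ hs2)
    filter_upwards [hne] with τ hτ
    refine ⟨?_, mul_ne_zero hs₀ (exp_ne_zero _)⟩
    rw [mul_pow, ← exp_nat_mul]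
    have : ((2 : ℕ) : ℂ) * (log (f τ / s₀ ^ 2) / 2) = log (f τ / s₀ ^ 2) := by
      push_cast
      ring
    rw [this, exp_log (div_ne_zero hτ hs2)]
    field_simp

/-! ### The quantum product as an analytic family of bilinear maps. -/

namespace GromovWittenTheory

noncomputable section

variable {H D : Type*} [NormedCommRing H] [NormedAlgebra ℂ H] [FiniteDimensional ℂ H]
  [AddCommMonoid D] [Finset.HasAntidiagonal D] (F : GromovWittenTheory H D)

/-- The quantum product as a continuous bilinear map. -/
def starCLM (τ : H) : H →L[ℂ] H →L[ℂ] H :=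
  ∑ j, ∑ k, (LinearMap.toContinuousLinearMap ((Module.finBasis ℂ H).coord j)).smulRight
    ((LinearMap.toContinuousLinearMap ((Module.finBasis ℂ H).coord k)).smulRight
      (F.star τ (Module.finBasis ℂ H j) (Module.finBasis ℂ H k)))

/-- The Poincaré pairing as a continuous bilinear form. -/
def pairingCLM : H →L[ℂ] H →L[ℂ] ℂ :=
  LinearMap.toContinuousLinearMap
    ((LinearMap.toContinuousLinearMap : (H →ₗ[ℂ] ℂ) ≃ₗ[ℂ] (H →L[ℂ] ℂ)).toLinearMap ∘ₗ F.pairing)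

theorem pairingCLM_apply (a b : H) : F.pairingCLM a b = F.pairing a b := rfl

/-- The grading operator as a continuous linear map. -/
def muCLM : H →L[ℂ] H := LinearMap.toContinuousLinearMap F.mu

theorem muCLM_apply (a : H) : F.muCLM a = F.mu a := rfl

omit [FiniteDimensional ℂ H] in
theorem eq_of_pairing_eq {x y : H} (h : ∀ c, F.pairing x c = F.pairing y c) : x = y := by
  refine sub_eq_zero.1 (F.poincare_duality _ fun c => ?_)
  have : F.pairing (x - y) c = 0 := by rw [map_sub, LinearMap.sub_apply, h, sub_self]
  exact this

section Convergent

variable {F} {B : Set H}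

theorem ConvergesOn.isLinearMap_star_left (hconv : F.ConvergesOn B) {τ : H} (hτ : τ ∈ B) (b : H) :
    IsLinearMap ℂ fun a => F.star τ a b where
  map_add a a' := F.eq_of_pairing_eq fun c => by
    simp only [map_add, LinearMap.add_apply, hconv.pairing_star _ _ _ hτ]
    exact (hconv.linear_threePoint b c hτ).map_add a a'
  map_smul r a := F.eq_of_pairing_eq fun c => by
    simp only [map_smul, LinearMap.smul_apply, hconv.pairing_star _ _ _ hτ]
    exact (hconv.linear_threePoint b c hτ).map_smul r a

theorem ConvergesOn.star_comm (hconv : F.ConvergesOn B) {τ : H} (hτ : τ ∈ B) (a b : H) :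
    F.star τ a b = F.star τ b a := F.eq_of_pairing_eq fun c => by
  rw [hconv.pairing_star _ _ _ hτ, hconv.pairing_star _ _ _ hτ, ConvergesOn.threePoint_swap]

theorem ConvergesOn.starCLM_apply (hconv : F.ConvergesOn B) {τ : H} (hτ : τ ∈ B) (a b : H) :
    F.starCLM τ a b = F.star τ a b := by
  let L : H → H →ₗ[ℂ] H := fun b => IsLinearMap.mk' _ (hconv.isLinearMap_star_left hτ b)
  have hL : ∀ a b, L b a = F.star τ a b := fun _ _ => rfl
  have h1 : ∀ a b, ∑ j, (Module.finBasis ℂ H).coord j a • F.star τ (Module.finBasis ℂ H j) b =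
      F.star τ a b := by
    intro a b
    conv_rhs => rw [← hL, ← (Module.finBasis ℂ H).sum_repr a, map_sum]
    simp only [map_smul]
    rfl
  rw [← h1 a b]
  simp only [starCLM, FunLike.coe_sum, Finset.sum_apply, ContinuousLinearMap.smulRight_apply,
    smul_apply, LinearMap.coe_toContinuousLinearMap']
  refine Finset.sum_congr rfl fun j _ => ?_
  rw [← Finset.smul_sum, hconv.star_comm hτ _ b, ← h1 b]
  congr 1
  refine Finset.sum_congr rfl fun k _ => ?_
  rw [hconv.star_comm hτ]

theorem ConvergesOn.analyticOnNhd_star (hconv : F.ConvergesOn B) (hB : IsOpen B) (a b : H) :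
    AnalyticOnNhd ℂ (fun τ => F.star τ a b) B := by
  unfold GromovWittenTheory.star
  refine Finset.analyticOnNhd_fun_sum _ fun i _ => ?_
  exact (hconv.analyticOnNhd_threePoint hB _ _ _).smul analyticOnNhd_const

theorem ConvergesOn.analyticOnNhd_starCLM (hconv : F.ConvergesOn B) (hB : IsOpen B) :
    AnalyticOnNhd ℂ F.starCLM B := by
  unfold starCLM
  refine Finset.analyticOnNhd_fun_sum _ fun j _ => Finset.analyticOnNhd_fun_sum _ fun k _ => ?_
  intro τ hτ
  let cj := LinearMap.toContinuousLinearMap ((Module.finBasis ℂ H).coord j)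
  let ck := LinearMap.toContinuousLinearMap ((Module.finBasis ℂ H).coord k)
  have h1 := hconv.analyticOnNhd_star hB (Module.finBasis ℂ H j) (Module.finBasis ℂ H k) τ hτ
  have h2 := ((ContinuousLinearMap.smulRightL ℂ H H ck).analyticAt _).fun_comp h1
  let L : (H →L[ℂ] H) →L[ℂ] (H →L[ℂ] H →L[ℂ] H) :=
    ContinuousLinearMap.smulRightL ℂ H (H →L[ℂ] H) cj
  exact (ContinuousLinearMap.analyticAt (F := H →L[ℂ] H →L[ℂ] H) L _).fun_comp h2

theorem ConvergesOn.pairing_fderiv_starCLM (hconv : F.ConvergesOn B) (hB : IsOpen B) {τ : H}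
    (hτ : τ ∈ B) (γ a b c : H) : F.pairing (fderiv ℂ F.starCLM τ γ a b) c =
      fderiv ℂ (fun τ => F.threePoint τ a b c) τ γ := by
  have h1 : (fun τ => F.threePoint τ a b c) =ᶠ[𝓝 τ]
      fun τ => F.pairingCLM.flip c (F.starCLM τ a b) := by
    filter_upwards [hB.mem_nhds hτ] with σ hσ
    rw [hconv.starCLM_apply hσ]
    exact (hconv.pairing_star a b c hσ).symm
  have hd := (hconv.analyticOnNhd_starCLM hB τ hτ).differentiableAt.hasFDerivAt
  have h2 := (F.pairingCLM.flip c).hasFDerivAt.comp τ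
    ((hd.clm_apply (hasFDerivAt_const a τ)).clm_apply (hasFDerivAt_const b τ))
  rw [h1.fderiv_eq]
  erw [h2.fderiv]
  simp [pairingCLM_apply]

theorem ConvergesOn.fderiv_starCLM_symm (hconv : F.ConvergesOn B) (hB : IsOpen B) {τ : H}
    (hτ : τ ∈ B) (a b : H) : fderiv ℂ F.starCLM τ a b = fderiv ℂ F.starCLM τ b a := by
  ext x
  refine F.eq_of_pairing_eq fun c => ?_
  rw [hconv.pairing_fderiv_starCLM hB hτ, hconv.pairing_fderiv_starCLM hB hτ,
    hconv.fderiv_threePoint_symm hB _ _ _ hτ]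

theorem ConvergesOn.pairing_star_right (hconv : F.ConvergesOn B) {τ : H} (hτ : τ ∈ B) (a b c : H) :
    F.pairing (F.star τ a b) c = F.pairing b (F.star τ a c) := by
  rw [F.pairing_comm b, hconv.pairing_star _ _ _ hτ, hconv.pairing_star _ _ _ hτ,
    ConvergesOn.threePoint_swap']

variable (F) in
/-- The quantum multiplication by the Euler vector field. -/
def eulerOp (τ : H) : H →L[ℂ] H := F.starCLM τ (F.euler τ)

variable (F) in
theorem hasFDerivAt_euler (τ : H) :
    HasFDerivAt F.euler (LinearMap.toContinuousLinearMap F.eulerLinear) τ := by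
  have : F.euler = fun τ => F.c₁ + LinearMap.toContinuousLinearMap F.eulerLinear τ :=
    funext fun τ => F.euler_eq' τ
  rw [this]
  exact (LinearMap.toContinuousLinearMap F.eulerLinear).hasFDerivAt.const_add _

variable (F) in
theorem analyticAt_euler (τ : H) : AnalyticAt ℂ F.euler τ := by
  have : F.euler = fun τ => F.c₁ + LinearMap.toContinuousLinearMap F.eulerLinear τ :=
    funext fun τ => F.euler_eq' τ
  rw [this]
  exact analyticAt_const.add (ContinuousLinearMap.analyticAt _ _)

theorem ConvergesOn.analyticOnNhd_eulerOp (hconv : F.ConvergesOn B) (hB : IsOpen B) :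
    AnalyticOnNhd ℂ F.eulerOp B := fun τ hτ =>
  analyticAt_clm_apply (hconv.analyticOnNhd_starCLM hB τ hτ) (F.analyticAt_euler τ)

/-- By potentiality, differentiating `E ⋆` along `a` amounts to differentiating `a ⋆` along `E`,
plus the derivative of `E` itself; homogeneity evaluates the former. The identity is the `z⁻¹` part
of the commutation of `∇_a` with `∇_{z∂_z}`. -/
theorem ConvergesOn.fderiv_eulerOp (hconv : F.ConvergesOn B) (hB : IsOpen B) {τ : H} (hτ : τ ∈ B)
    (a x : H) : fderiv ℂ F.eulerOp τ a x =
      F.starCLM τ a x + F.starCLM τ a (F.muCLM x) - F.muCLM (F.starCLM τ a x) := by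
  have hd := ((hconv.analyticOnNhd_starCLM hB τ hτ).differentiableAt.hasFDerivAt).clm_apply
    (F.hasFDerivAt_euler τ)
  have h1 : fderiv ℂ F.eulerOp τ a x =
      F.starCLM τ (F.eulerLinear a) x + fderiv ℂ F.starCLM τ (F.euler τ) a x := by
    rw [hconv.fderiv_starCLM_symm hB hτ]
    change fderiv ℂ (fun τ => F.starCLM τ (F.euler τ)) τ a x = _
    rw [hd.fderiv]
    rfl
  rw [h1]
  refine F.eq_of_pairing_eq fun c => ?_
  have h2 := hconv.pairing_fderiv_starCLM hB hτ (F.euler τ) a x c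
  rw [hconv.fderiv_threePoint_euler hB _ _ _ hτ] at h2
  simp only [← hconv.pairing_star _ _ _ hτ, ← hconv.starCLM_apply hτ] at h2
  simp only [map_add, map_sub, LinearMap.add_apply, LinearMap.sub_apply, h2, muCLM_apply,
    eulerLinear, LinearMap.smul_apply, map_smul, LinearMap.id_apply, sub_apply,
    smul_apply, F.pairing_mu, smul_eq_mul]
  ring

end Convergent

end

end GromovWittenTheory

/-! ### The analytic frame of normalized idempotents. -/

namespace GromovWittenTheory

noncomputable section

variable {H D : Type*} [NormedCommRing H] [NormedAlgebra ℂ H] [FiniteDimensional ℂ H]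
  [AddCommMonoid D] [Finset.HasAntidiagonal D] {F : GromovWittenTheory H D} {B : Set H}

theorem ConvergesOn.repr_starCLM (hconv : F.ConvergesOn B) {τ : H} (hτ : τ ∈ B)
    {b : Module.Basis (Fin (Module.finrank ℂ H)) ℂ H} (hb : F.IsIdempotentBasis τ b) (x y : H)
    (i : Fin (Module.finrank ℂ H)) :
    b.repr (F.starCLM τ x y) i = b.repr x i * b.repr y i := by
  conv_lhs => rw [← b.sum_repr x, ← b.sum_repr y]
  have h : ∀ j k, F.starCLM τ (b j) (b k) = if j = k then b j else 0 := fun j k => by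
    rw [hconv.starCLM_apply hτ, hb j k]
  simp only [map_sum, map_smul, FunLike.coe_sum, Finset.sum_apply, smul_apply, h]
  have h5 : ∀ j k, b.repr (if j = k then b j else 0) i =
      if j = k then (if j = i then 1 else 0) else 0 := by
    intro j k
    split_ifs <;> simp_all
  simp [h5, mul_comm]

/-- In a basis of orthogonal idempotents the product is componentwise. -/
theorem ConvergesOn.starCLM_assoc (hconv : F.ConvergesOn B) {τ : H} (hτ : τ ∈ B)
    (hss : F.IsSemisimpleAt τ) (x y w : H) :
    F.starCLM τ (F.starCLM τ x y) w = F.starCLM τ x (F.starCLM τ y w) := by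
  obtain ⟨b, hb⟩ := hss
  refine b.repr.injective (Finsupp.ext fun i => ?_)
  simp only [hconv.repr_starCLM hτ hb]
  ring

theorem ConvergesOn.starCLM_comm (hconv : F.ConvergesOn B) {τ : H} (hτ : τ ∈ B) (x y : H) :
    F.starCLM τ x y = F.starCLM τ y x := by
  rw [hconv.starCLM_apply hτ, hconv.starCLM_apply hτ, hconv.star_comm hτ]

/-- The chosen idempotents at a semisimple point extend analytically. -/
theorem ConvergesOn.exists_idempotents (hconv : F.ConvergesOn B) (hB : IsOpen B)
    (hss : ∀ τ ∈ B, F.IsSemisimpleAt τ) {τ₀ : H} (hτ₀ : τ₀ ∈ B)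
    {ψ₀ : Module.Basis (Fin (Module.finrank ℂ H)) ℂ H} (hψ₀ : F.IsIdempotentBasis τ₀ ψ₀) :
    ∃ ψ : Fin (Module.finrank ℂ H) → H → H, (∀ i, AnalyticAt ℂ (ψ i) τ₀ ∧ ψ i τ₀ = ψ₀ i) ∧
      ∀ᶠ τ in 𝓝 τ₀, (∀ i, ψ i τ ≠ 0) ∧
        ∀ i j, F.starCLM τ (ψ i τ) (ψ j τ) = if i = j then ψ i τ else 0 := by
  have hC := hconv.analyticOnNhd_starCLM hB τ₀ hτ₀
  have h0 : ∀ i j, F.starCLM τ₀ (ψ₀ i) (ψ₀ j) = if i = j then ψ₀ i else 0 := fun i j => by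
    rw [hconv.starCLM_apply hτ₀, hψ₀ i j]
  choose ψ hψa hψ0 hψi using fun i => exists_analyticAt_idempotent hC (hconv.starCLM_comm hτ₀)
    (ψ₀ := ψ₀ i) (by simp [h0]) (fun ξ => by
      rw [← hconv.starCLM_assoc hτ₀ (hss τ₀ hτ₀)]
      simp [h0])
  refine ⟨ψ, fun i => ⟨hψa i, hψ0 i⟩, ?_⟩
  have e1 : ∀ᶠ τ in 𝓝 τ₀, ∀ i, ψ i τ ≠ 0 := eventually_all.2 fun i =>
    (hψa i).continuousAt.eventually_ne (by rw [hψ0]; exact ψ₀.ne_zero i)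
  have e2 : ∀ᶠ τ in 𝓝 τ₀, ∀ i, F.starCLM τ (ψ i τ) (ψ i τ) = ψ i τ := eventually_all.2 hψi
  set M := ‖F.starCLM τ₀‖ + 1 with hM
  have hM0 : 0 < M := by positivity
  have e3 : ∀ᶠ τ in 𝓝 τ₀, ‖F.starCLM τ‖ < M :=
    (show ContinuousAt (fun τ => ‖F.starCLM τ‖) τ₀ from
      (continuous_norm (E := H →L[ℂ] H →L[ℂ] H)).continuousAt.comp
          hC.continuousAt).eventually_lt_const
        (by linarith)
  have e4 : ∀ᶠ τ in 𝓝 τ₀, ∀ i j, i ≠ j → ‖F.starCLM τ (ψ i τ) (ψ j τ)‖ < M⁻¹ := by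
    refine eventually_all.2 fun i => eventually_all.2 fun j => eventually_imp_distrib_left.2
      fun hij => ?_
    have hc : ContinuousAt (fun τ => ‖F.starCLM τ (ψ i τ) (ψ j τ)‖) τ₀ :=
      ((hC.continuousAt.clm_apply (hψa i).continuousAt).clm_apply (hψa j).continuousAt).norm
    refine hc.eventually_lt_const ?_
    simp only [hψ0, h0, if_neg hij, norm_zero]
    positivity
  filter_upwards [e1, e2, e3, e4, hB.mem_nhds hτ₀] with τ h1 h2 h3 h4 hτ
  refine ⟨h1, fun i j => ?_⟩
  split_ifs with hij
  · rw [← hij, h2]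
  -- The product of two idempotents is idempotent, so `‖e‖ ≤ M ‖e‖ ^ 2`: a nonzero `e` has norm at
  -- least `M⁻¹`. It vanishes at `τ₀` and is therefore smaller than that nearby.
  · set e := F.starCLM τ (ψ i τ) (ψ j τ) with he
    have hidem : F.starCLM τ e e = e := by
      have ha := hconv.starCLM_assoc hτ (hss τ hτ)
      have hc := hconv.starCLM_comm hτ
      rw [he, ha, hc (ψ j τ), ha, h2 j, ← ha, h2 i]
    by_contra hne
    have hpos : 0 < ‖e‖ := norm_pos_iff.2 hne
    have hle : ‖e‖ ≤ M * ‖e‖ * ‖e‖ := by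
      conv_lhs => rw [← hidem]
      refine (F.starCLM τ).le_opNorm₂ e e |>.trans ?_
      gcongr
    have hlt : M * ‖e‖ < 1 := by
      have := h4 i j hij
      rwa [lt_inv_comm₀ hpos hM0, ← one_div, lt_div_iff₀ hpos] at this
    nlinarith

theorem ConvergesOn.linearIndependent_idempotents {τ : H}
    {ψ : Fin (Module.finrank ℂ H) → H} (h0 : ∀ i, ψ i ≠ 0)
    (h : ∀ i j, F.starCLM τ (ψ i) (ψ j) = if i = j then ψ i else 0) : LinearIndependent ℂ ψ := by
  rw [Fintype.linearIndependent_iff]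
  intro g hg i
  have := congrArg (F.starCLM τ (ψ i)) hg
  simp only [map_sum, map_smul, h, map_zero, smul_ite, smul_zero, Finset.sum_ite_eq,
    Finset.mem_univ, if_true] at this
  exact (smul_eq_zero.1 this).resolve_right (h0 i)

/-- Invariance of the pairing gives `(ψ_i, ψ_j) = (ψ_i, ψ_i ψ_j) = 0`. An isotropic `ψ_i` would then
be orthogonal to the whole basis. -/
theorem ConvergesOn.pairing_idempotents (hconv : F.ConvergesOn B) {τ : H} (hτ : τ ∈ B)
    {b : Module.Basis (Fin (Module.finrank ℂ H)) ℂ H} (hb : F.IsIdempotentBasis τ b) :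
    (∀ i j, i ≠ j → F.pairing (b i) (b j) = 0) ∧ ∀ i, F.pairing (b i) (b i) ≠ 0 := by
  have h1 : ∀ i j, i ≠ j → F.pairing (b i) (b j) = 0 := by
    intro i j hij
    have h := hconv.pairing_star_right hτ (b i) (b i) (b j)
    rwa [hb i i, hb i j, if_pos rfl, if_neg hij, map_zero] at h
  refine ⟨h1, fun i h => b.ne_zero i ?_⟩
  refine F.poincare_duality _ fun c => ?_
  change F.pairing (b i) c = 0
  rw [← b.sum_repr c, map_sum]
  refine Finset.sum_eq_zero fun j _ => ?_
  rw [map_smul]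
  by_cases hij : i = j
  · rw [← hij, h, smul_zero]
  · rw [h1 i j hij, smul_zero]

/-- Near a semisimple point the quantum product has an analytic frame of normalized idempotents. -/
theorem ConvergesOn.exists_semisimpleFrame (hconv : F.ConvergesOn B) (hB : IsOpen B)
    (hss : ∀ τ ∈ B, F.IsSemisimpleAt τ) {τ₀ : H} (hτ₀ : τ₀ ∈ B)
    {Ψ₀ : Fin (Module.finrank ℂ H) → H} (hΨ₀ : F.IsNormalizedIdempotents τ₀ Ψ₀) :
    ∃ R > 0, Metric.ball τ₀ R ⊆ B ∧
      ∃ Φ : SemisimpleFrame (Fin (Module.finrank ℂ H)) H (Metric.ball τ₀ R),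
        Φ.C = F.starCLM ∧ Φ.V = F.eulerOp ∧ Φ.mu = F.muCLM ∧ Φ.Q = F.pairingCLM ∧
        (∀ i, Φ.Ψ i τ₀ = Ψ₀ i) ∧
        ∀ τ ∈ Metric.ball τ₀ R, F.IsNormalizedIdempotents τ fun i => Φ.Ψ i τ := by
  obtain ⟨ψ₀, hψ₀, s₀, hs₀⟩ := hΨ₀
  obtain ⟨ψ, hψ, hψe⟩ := hconv.exists_idempotents hB hss hτ₀ hψ₀
  have hs0 : ∀ i, s₀ i ≠ 0 := fun i h => (hconv.pairing_idempotents hτ₀ hψ₀).2 i (by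
    rw [← (hs₀ i).1, h]
    ring)
  have hbil : ∀ {f g : H → H} {τ : H}, AnalyticAt ℂ f τ → AnalyticAt ℂ g τ →
      AnalyticAt ℂ (fun τ => F.pairingCLM (f τ) (g τ)) τ := fun hf hg =>
    (F.pairingCLM.analyticAt_bilinear (_, _)).fun_comp (f := fun τ => (_, _)) (hf.prod hg)
  choose s hsa hs0' hse using fun i => exists_analyticAt_sq_eq
    (hbil (hψ i).1 (hψ i).1) (hs0 i) (by rw [(hψ i).2, (hs₀ i).1]; rfl)
  obtain ⟨R, hR, hsub⟩ := Metric.eventually_nhds_iff_ball.1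
    ((((eventually_all.2 hse).and hψe).and
      (eventually_all.2 fun i => (hψ i).1.eventually_analyticAt)).and
      ((eventually_all.2 fun i => (hsa i).eventually_analyticAt).and (hB.mem_nhds hτ₀)))
  have hBall : Metric.ball τ₀ R ⊆ B := fun τ hτ => (hsub τ hτ).2.2
  set S := Metric.ball τ₀ R with hS
  have hsψ : ∀ τ ∈ S, ∀ i, s i τ ^ 2 = F.pairing (ψ i τ) (ψ i τ) := fun τ hτ i =>
    ((hsub τ hτ).1.1.1 i).1
  have hsn : ∀ τ ∈ S, ∀ i, s i τ ≠ 0 := fun τ hτ i => ((hsub τ hτ).1.1.1 i).2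
  have hψψ : ∀ τ ∈ S, ∀ i j, F.starCLM τ (ψ i τ) (ψ j τ) = if i = j then ψ i τ else 0 :=
    fun τ hτ => (hsub τ hτ).1.1.2.2
  have hψan : ∀ i, AnalyticOnNhd ℂ (ψ i) S := fun i τ hτ => (hsub τ hτ).1.2 i
  have hsan : ∀ i, AnalyticOnNhd ℂ (s i) S := fun i τ hτ => (hsub τ hτ).2.1 i
  have hbasis : ∀ τ ∈ S, ∃ b : Module.Basis (Fin (Module.finrank ℂ H)) ℂ H,
      (∀ i, b i = ψ i τ) ∧ F.IsIdempotentBasis τ b := by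
    intro τ hτ
    have hli := ConvergesOn.linearIndependent_idempotents (F := F) (hsub τ hτ).1.1.2.1 (hψψ τ hτ)
    refine ⟨basisOfLinearIndependentOfCardEqFinrank' _ hli (by simp), fun i => by simp,
      fun i j => ?_⟩
    rw [← hconv.starCLM_apply (hBall hτ)]
    simp [hψψ τ hτ]
  let Ψ : Fin (Module.finrank ℂ H) → H → H := fun i τ => (s i τ)⁻¹ • ψ i τ
  have hΨan : ∀ i, AnalyticOnNhd ℂ (Ψ i) S := fun i τ hτ =>
    ((hsan i τ hτ).inv (hsn τ hτ i)).smul (hψan i τ hτ)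
  have hQΨ : ∀ τ ∈ S, ∀ i j, F.pairingCLM (Ψ i τ) (Ψ j τ) = if i = j then 1 else 0 := by
    intro τ hτ i j
    obtain ⟨b, hb, hbi⟩ := hbasis τ hτ
    simp only [Ψ, map_smul, smul_apply, smul_eq_mul, pairingCLM_apply]
    split_ifs with hij
    · subst hij
      rw [← hsψ τ hτ]
      have := hsn τ hτ i
      field_simp
    · have := (hconv.pairing_idempotents (hBall hτ) hbi).1 i j hij
      rw [hb, hb] at this
      rw [this]
      ring
  have hψC : ∀ τ ∈ S, ∀ a i, ∃ c : ℂ, F.starCLM τ a (ψ i τ) = c • ψ i τ := by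
    intro τ hτ a i
    obtain ⟨b, hb, hbi⟩ := hbasis τ hτ
    refine ⟨b.repr a i, ?_⟩
    conv_lhs => rw [← b.sum_repr a]
    simp only [map_sum, map_smul, FunLike.coe_sum, Finset.sum_apply, smul_apply, hb, hψψ τ hτ,
      smul_ite, smul_zero, Finset.sum_ite_eq', Finset.mem_univ, if_true]
  have hCΨ : ∀ τ ∈ S, ∀ a i, F.starCLM τ a (Ψ i τ) =
      F.pairingCLM (F.starCLM τ a (Ψ i τ)) (Ψ i τ) • Ψ i τ := by
    intro τ hτ a i
    obtain ⟨c, hc⟩ := hψC τ hτ a i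
    have h1 : F.starCLM τ a (Ψ i τ) = c • Ψ i τ := by
      simp only [Ψ, map_smul, hc]
      rw [smul_comm]
    rw [h1, F.pairingCLM.map_smul, smul_apply, hQΨ τ hτ, if_pos rfl, smul_eq_mul, mul_one]
  let u : Fin (Module.finrank ℂ H) → H → ℂ := fun i τ =>
    F.pairingCLM (F.eulerOp τ (Ψ i τ)) (Ψ i τ)
  have hVΨ : ∀ τ ∈ S, ∀ i, F.eulerOp τ (Ψ i τ) = u i τ • Ψ i τ := fun τ hτ i =>
    hCΨ τ hτ (F.euler τ) i
  have hVan : AnalyticOnNhd ℂ F.eulerOp S := (hconv.analyticOnNhd_eulerOp hB).mono hBall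
  have huan : ∀ i, AnalyticOnNhd ℂ (u i) S := fun i τ hτ =>
    hbil (analyticAt_clm_apply (hVan τ hτ) (hΨan i τ hτ)) (hΨan i τ hτ)
  have hSopen : IsOpen S := Metric.isOpen_ball
  have hQs : ∀ a b, F.pairingCLM a b = F.pairingCLM b a := F.pairing_comm
  -- First-order perturbation theory for `u_i = (E ⋆ Ψ_i, Ψ_i)`: the terms with `dΨ_i` vanish since
  -- `(Ψ_i, Ψ_i)` is constant, and the commutator of `a ⋆` with `μ` contributes a multiple of `(μ
  -- Ψ_i, Ψ_i) = 0`. What remains is the eigenvalue of `a ⋆` on `Ψ_i`.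
  have hdu : ∀ τ ∈ S, ∀ i a, fderiv ℂ (u i) τ a =
      F.pairingCLM (F.starCLM τ a (Ψ i τ)) (Ψ i τ) := by
    intro τ hτ i a
    have dΨ := (hΨan i τ hτ).differentiableAt
    have dV := (hVan τ hτ).differentiableAt
    have hN : (fun τ => F.pairingCLM (Ψ i τ) (Ψ i τ)) =ᶠ[𝓝 τ] fun _ => 1 := by
      filter_upwards [hSopen.mem_nhds hτ] with σ hσ
      rw [hQΨ σ hσ, if_pos rfl]
    have hN'' := congrArg (fun L : H →L[ℂ] ℂ => L a) (hN.fderiv_eq (𝕜 := ℂ))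
    simp only [fderiv_bilinear_apply F.pairingCLM dΨ dΨ, fderiv_fun_const, Pi.zero_apply,
      zero_apply] at hN''
    rw [hQs (fderiv ℂ (Ψ i) τ a)] at hN''
    have hz : F.pairingCLM (Ψ i τ) (fderiv ℂ (Ψ i) τ a) = 0 := by
      have : (2 : ℂ) * F.pairingCLM (Ψ i τ) (fderiv ℂ (Ψ i) τ a) = 0 := by
        linear_combination hN''
      simpa using this
    have hself : ∀ x y, F.pairingCLM (F.eulerOp τ x) y = F.pairingCLM x (F.eulerOp τ y) := by
      intro x y
      simp only [eulerOp, hconv.starCLM_apply (hBall hτ)]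
      exact hconv.pairing_star_right (hBall hτ) _ _ _
    have hself' : ∀ x y, F.pairingCLM (F.starCLM τ a x) y = F.pairingCLM x (F.starCLM τ a y) := by
      intro x y
      simp only [hconv.starCLM_apply (hBall hτ)]
      exact hconv.pairing_star_right (hBall hτ) _ _ _
    change fderiv ℂ (fun τ => F.pairingCLM (F.eulerOp τ (Ψ i τ)) (Ψ i τ)) τ a = _
    rw [fderiv_bilinear_apply F.pairingCLM (dV.clm_apply dΨ) dΨ, fderiv_clm_apply_apply dV dΨ,
      hconv.fderiv_eulerOp hB (hBall hτ)]
    simp only [map_add, map_sub, add_apply, sub_apply]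
    have hmu : F.pairingCLM (F.starCLM τ a (F.muCLM (Ψ i τ))) (Ψ i τ) =
        -F.pairingCLM (F.muCLM (F.starCLM τ a (Ψ i τ))) (Ψ i τ) := by
      rw [hself', hQs]
      simp only [pairingCLM_apply, muCLM_apply]
      rw [F.pairing_mu, neg_neg]
    have hA : F.pairingCLM (F.eulerOp τ (fderiv ℂ (Ψ i) τ a)) (Ψ i τ) = 0 := by
      rw [hself, hVΨ τ hτ, (F.pairingCLM _).map_smul (u i τ), hQs (fderiv ℂ (Ψ i) τ a), hz,
        smul_zero]
    have hA' : F.pairingCLM (F.eulerOp τ (Ψ i τ)) (fderiv ℂ (Ψ i) τ a) = 0 := by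
      rw [hVΨ τ hτ, F.pairingCLM.map_smul (u i τ), smul_apply, hz, smul_zero]
    rw [hA, hA', hmu]
    have hcancel : F.pairingCLM (F.muCLM (F.starCLM τ a (Ψ i τ))) (Ψ i τ) = 0 := by
      rw [hCΨ τ hτ a i]
      simp only [map_smul, smul_apply, pairingCLM_apply, muCLM_apply]
      have h3 : F.pairing (F.mu (Ψ i τ)) (Ψ i τ) = 0 := by
        have h4 := F.pairing_mu (Ψ i τ) (Ψ i τ)
        rw [F.pairing_comm (Ψ i τ)] at h4
        have : (2 : ℂ) * F.pairing (F.mu (Ψ i τ)) (Ψ i τ) = 0 := by linear_combination h4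
        simpa using this
      rw [h3, smul_zero]
    rw [hcancel]
    simp
  refine ⟨R, hR, hBall, ⟨F.starCLM, F.eulerOp, F.muCLM, F.pairingCLM, Ψ, ψ, u, hSopen,
    (hconv.analyticOnNhd_starCLM hB).mono hBall, hVan, hΨan, hψan, huan, ?_, hVΨ,
    fun τ hτ => hconv.fderiv_starCLM_symm hB (hBall hτ),
    fun τ hτ => hconv.fderiv_eulerOp hB (hBall hτ), hQs, F.pairing_mu, hQΨ, ?_, ?_⟩,
    rfl, rfl, rfl, rfl, ?_, ?_⟩
  · intro τ hτ a i
    rw [hdu τ hτ]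
    exact hCΨ τ hτ a i
  · intro τ hτ x
    obtain ⟨b, hb, hbi⟩ := hbasis τ hτ
    have hbΨ : ∀ i, b i = s i τ • Ψ i τ := fun i => by
      simp only [hb, Ψ]
      rw [smul_inv_smul₀ (hsn τ hτ i)]
    have hlin : ∀ x : H, x = ∑ j, (b.repr x j * s j τ) • Ψ j τ := fun x => by
      conv_lhs => rw [← b.sum_repr x]
      simp only [hbΨ, smul_smul]
    have : ∀ i, F.pairingCLM x (Ψ i τ) = b.repr x i * s i τ := by
      intro i
      conv_lhs => rw [hlin x]
      simp only [map_sum, map_smul, FunLike.coe_sum, Finset.sum_apply, smul_apply, hQΨ τ hτ,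
        smul_eq_mul, mul_ite, mul_one, mul_zero, Finset.sum_ite_eq', Finset.mem_univ, if_true]
    simp only [this]
    exact (hlin x).symm
  · intro τ hτ i j
    rw [hdu τ hτ]
    have h1 : F.starCLM τ (ψ j τ) (Ψ i τ) = (if i = j then 1 else 0 : ℂ) • Ψ i τ := by
      simp only [Ψ, map_smul, hψψ τ hτ]
      split_ifs with h h' h'
      · rw [one_smul, h]
      · exact absurd h.symm h'
      · exact absurd h'.symm h
      · simp
    rw [h1, F.pairingCLM.map_smul, smul_apply, hQΨ τ hτ, if_pos rfl, smul_eq_mul, mul_one]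
  · intro i
    simp only [Ψ, (hψ i).2, hs0']
    exact (hs₀ i).2.symm
  · intro τ hτ
    obtain ⟨b, hb, hbi⟩ := hbasis τ hτ
    exact ⟨b, hbi, fun i => s i τ, fun i => by rw [hb]; exact ⟨hsψ τ hτ i, rfl⟩⟩

end

end GromovWittenTheory

/-! ### The formal solution: recursion for the coefficients and its consistency. -/

namespace SemisimpleFrame

section Pointwise

variable {ι H : Type*} [Fintype ι] [DecidableEq ι] [NormedAddCommGroup H] [NormedSpace ℂ H]
  {S : Set H} (Φ : SemisimpleFrame ι H S)

theorem ext_Q {τ : H} (hτ : τ ∈ S) {x y : H} (h : ∀ j, Φ.Q x (Φ.Ψ j τ) = Φ.Q y (Φ.Ψ j τ)) :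
    x = y := by
  rw [← Φ.sum_Ψ τ hτ x, ← Φ.sum_Ψ τ hτ y]
  simp only [h]

theorem Q_sum_smul {τ : H} (hτ : τ ∈ S) (c : ι → ℂ) (s : Finset ι) (j : ι) :
    Φ.Q (∑ i ∈ s, c i • Φ.Ψ i τ) (Φ.Ψ j τ) = if j ∈ s then c j else 0 := by
  simp [map_sum, smul_apply, Φ.Q_Ψ τ hτ]

theorem Q_apply_of_eigen {τ : H} (hτ : τ ∈ S) {L : H →L[ℂ] H} {c : ι → ℂ}
    (hL : ∀ i, L (Φ.Ψ i τ) = c i • Φ.Ψ i τ) (x : H) (j : ι) :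
    Φ.Q (L x) (Φ.Ψ j τ) = c j * Φ.Q x (Φ.Ψ j τ) := by
  have h : L x = ∑ i, (Φ.Q x (Φ.Ψ i τ) * c i) • Φ.Ψ i τ := by
    conv_lhs => rw [← Φ.sum_Ψ τ hτ x]
    simp only [map_sum, map_smul, hL, smul_smul]
  rw [h, Φ.Q_sum_smul hτ fun i => Φ.Q x (Φ.Ψ i τ) * c i, if_pos (Finset.mem_univ _), mul_comm]

theorem Q_selfAdjoint_of_eigen {τ : H} (hτ : τ ∈ S) {L : H →L[ℂ] H} {c : ι → ℂ}
    (hL : ∀ i, L (Φ.Ψ i τ) = c i • Φ.Ψ i τ) (x y : H) : Φ.Q (L x) y = Φ.Q x (L y) := by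
  rw [← Φ.sum_Ψ τ hτ y]
  simp only [map_sum, map_smul, hL, Φ.Q_apply_of_eigen hτ hL, smul_eq_mul]

theorem Q_C {τ : H} (hτ : τ ∈ S) (a x : H) (j : ι) :
    Φ.Q (Φ.C τ a x) (Φ.Ψ j τ) = fderiv ℂ (Φ.u j) τ a * Φ.Q x (Φ.Ψ j τ) :=
  Φ.Q_apply_of_eigen hτ (c := fun j => fderiv ℂ (Φ.u j) τ a) (Φ.C_Ψ τ hτ a) x j

theorem Q_V {τ : H} (hτ : τ ∈ S) (x : H) (j : ι) :
    Φ.Q (Φ.V τ x) (Φ.Ψ j τ) = Φ.u j τ * Φ.Q x (Φ.Ψ j τ) :=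
  Φ.Q_apply_of_eigen hτ (c := fun j => Φ.u j τ) (Φ.V_Ψ τ hτ) x j

theorem Q_C_comm {τ : H} (hτ : τ ∈ S) (a x y : H) :
    Φ.Q (Φ.C τ a x) y = Φ.Q x (Φ.C τ a y) :=
  Φ.Q_selfAdjoint_of_eigen hτ (c := fun j => fderiv ℂ (Φ.u j) τ a) (Φ.C_Ψ τ hτ a) x y

theorem Q_V_comm {τ : H} (hτ : τ ∈ S) (x y : H) : Φ.Q (Φ.V τ x) y = Φ.Q x (Φ.V τ y) :=
  Φ.Q_selfAdjoint_of_eigen hτ (c := fun j => Φ.u j τ) (Φ.V_Ψ τ hτ) x y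

theorem Q_mu_self (x : H) : Φ.Q (Φ.mu x) x = 0 := by
  have h := Φ.Q_mu x x
  rw [Φ.Q_symm x] at h
  have : (2 : ℂ) * Φ.Q (Φ.mu x) x = 0 := by linear_combination h
  simpa using this

/-- The components other than the `i`-th one of the next coefficient of a formal solution. -/
noncomputable def offDiag (i : ι) (f : H → H) (τ : H) : H :=
  ∑ j ∈ Finset.univ.erase i, (-Φ.Q (fderiv ℂ f τ (Φ.ψ j τ)) (Φ.Ψ j τ)) • Φ.Ψ j τ

/-- The coefficients of the formal solution `e^{-uᵢ/z} ∑ rₖ zᵏ` with `r₀ = Ψᵢ`. -/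
noncomputable def coeff (i : ι) : ℕ → H → H
  | 0 => Φ.Ψ i
  -- The other components come from derivatives along the `ψ j`, so no difference of eigenvalues is
  -- inverted. The component along `Ψ i` is the one that makes the next equation in `z` solvable;
  -- since `(μ Ψ_i, Ψ_i) = 0` it does not feed back into its own condition.
  | k + 1 => fun τ => Φ.offDiag i (coeff i k) τ -
      ((k + 1 : ℂ)⁻¹ * Φ.Q (Φ.mu (Φ.offDiag i (coeff i k) τ)) (Φ.Ψ i τ)) • Φ.Ψ i τ

theorem coeff_zero (i : ι) : Φ.coeff i 0 = Φ.Ψ i := rfl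

theorem Q_offDiag {τ : H} (hτ : τ ∈ S) (i : ι) (f : H → H) (j : ι) :
    Φ.Q (Φ.offDiag i f τ) (Φ.Ψ j τ) =
      if j = i then 0 else -Φ.Q (fderiv ℂ f τ (Φ.ψ j τ)) (Φ.Ψ j τ) := by
  rw [offDiag, Φ.Q_sum_smul hτ (fun j => -Φ.Q (fderiv ℂ f τ (Φ.ψ j τ)) (Φ.Ψ j τ))]
  by_cases h : j = i <;> simp [h]

theorem Q_coeff_succ {τ : H} (hτ : τ ∈ S) {i j : ι} (hj : j ≠ i) (k : ℕ) :
    Φ.Q (Φ.coeff i (k + 1) τ) (Φ.Ψ j τ) =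
      -Φ.Q (fderiv ℂ (Φ.coeff i k) τ (Φ.ψ j τ)) (Φ.Ψ j τ) := by
  simp only [coeff, map_sub, map_smul, sub_apply, smul_apply, Φ.Q_offDiag hτ, if_neg hj,
    Φ.Q_Ψ τ hτ, if_neg hj.symm, smul_zero, sub_zero]

/-- The solvability condition for the following coefficient: `V - u i` has no component along `Ψ i`
in its image. -/
theorem Q_mu_coeff_succ {τ : H} (hτ : τ ∈ S) (i : ι) (k : ℕ) :
    ((k : ℂ) + 1) * Φ.Q (Φ.coeff i (k + 1) τ) (Φ.Ψ i τ) +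
      Φ.Q (Φ.mu (Φ.coeff i (k + 1) τ)) (Φ.Ψ i τ) = 0 := by
  simp only [coeff, map_sub, map_smul, sub_apply, smul_apply, Φ.Q_offDiag hτ, if_true,
    Φ.Q_Ψ τ hτ, Φ.Q_mu_self, smul_eq_mul, mul_zero, sub_zero, zero_sub, mul_one]
  have : (k : ℂ) + 1 ≠ 0 := by exact_mod_cast k.succ_ne_zero
  field_simp
  ring

/-- The integrability conditions that determine `rₖ₊₁` from `rₖ`. -/
structure IsIntegrable (i : ι) (k : ℕ) (f : H → H) : Prop where
  symm : ∀ τ ∈ S, ∀ a b, fderiv ℂ (Φ.u i) τ a • fderiv ℂ f τ b - Φ.C τ a (fderiv ℂ f τ b) =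
    fderiv ℂ (Φ.u i) τ b • fderiv ℂ f τ a - Φ.C τ b (fderiv ℂ f τ a)
  euler : ∀ τ ∈ S, ∀ a, Φ.V τ (fderiv ℂ f τ a) - Φ.u i τ • fderiv ℂ f τ a =
    fderiv ℂ (Φ.u i) τ a • ((k : ℂ) • f τ + Φ.mu (f τ)) - Φ.C τ a ((k : ℂ) • f τ + Φ.mu (f τ))
  diag : ∀ τ ∈ S, (k : ℂ) * Φ.Q (f τ) (Φ.Ψ i τ) + Φ.Q (Φ.mu (f τ)) (Φ.Ψ i τ) = 0
  diag_fderiv : ∀ τ ∈ S, ∀ a, Φ.Q (fderiv ℂ f τ a) (Φ.Ψ i τ) = 0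

variable {Φ}

/-- Tested against `Ψ j` with `j ≠ i`, this is the condition `symm` with second direction `ψ j`,
because `du_j(ψ_j) = 1` and `du_i(ψ_j) = 0`. Against `Ψ i` both sides vanish. -/
theorem IsIntegrable.fderiv_coeff {i : ι} {k : ℕ} (h : Φ.IsIntegrable i k (Φ.coeff i k))
    {τ : H} (hτ : τ ∈ S) (a : H) :
    fderiv ℂ (Φ.coeff i k) τ a =
      fderiv ℂ (Φ.u i) τ a • Φ.coeff i (k + 1) τ - Φ.C τ a (Φ.coeff i (k + 1) τ) := by
  refine Φ.ext_Q hτ fun j => ?_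
  simp only [map_sub, map_smul, sub_apply, smul_apply, Φ.Q_C hτ, smul_eq_mul]
  by_cases hj : j = i
  · subst hj
    rw [h.diag_fderiv τ hτ, sub_self]
  · rw [Φ.Q_coeff_succ hτ hj]
    have h1 := congrArg (fun x => Φ.Q x (Φ.Ψ j τ)) (h.symm τ hτ a (Φ.ψ j τ))
    simp only [map_sub, map_smul, sub_apply, smul_apply, Φ.Q_C hτ, smul_eq_mul,
      Φ.fderiv_u_ψ τ hτ, if_neg (Ne.symm hj), if_true] at h1
    linear_combination h1

/-- The same test, now with the condition `euler` in the direction `ψ j`, and with `diag` for the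
component along `Ψ i`. -/
theorem IsIntegrable.V_coeff {i : ι} {k : ℕ} (h : Φ.IsIntegrable i k (Φ.coeff i k))
    {τ : H} (hτ : τ ∈ S) :
    Φ.V τ (Φ.coeff i (k + 1) τ) - Φ.u i τ • Φ.coeff i (k + 1) τ =
      (k : ℂ) • Φ.coeff i k τ + Φ.mu (Φ.coeff i k τ) := by
  refine Φ.ext_Q hτ fun j => ?_
  simp only [map_sub, map_add, map_smul, sub_apply, add_apply, smul_apply, Φ.Q_V hτ, smul_eq_mul]
  by_cases hj : j = i
  · subst hj
    rw [h.diag τ hτ, sub_self]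
  · rw [Φ.Q_coeff_succ hτ hj]
    have h1 := congrArg (fun x => Φ.Q x (Φ.Ψ j τ)) (h.euler τ hτ (Φ.ψ j τ))
    simp only [map_sub, map_add, map_smul, sub_apply, add_apply, smul_apply, Φ.Q_C hτ, Φ.Q_V hτ,
      smul_eq_mul, Φ.fderiv_u_ψ τ hτ, if_neg (Ne.symm hj), if_true] at h1
    linear_combination -h1

variable (Φ)

theorem fderiv_fderiv_symm {G : Type*} [NormedAddCommGroup G] [NormedSpace ℂ G] [CompleteSpace G]
    {f : H → G} {τ : H} (hf : AnalyticAt ℂ f τ) (a b : H) :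
    fderiv ℂ (fderiv ℂ f) τ a b = fderiv ℂ (fderiv ℂ f) τ b a :=
  (hf.contDiffAt.isSymmSndFDerivAt (n := 2) (by simp)).eq a b

theorem fderiv_fderiv_apply {G : Type*} [NormedAddCommGroup G] [NormedSpace ℂ G]
    [CompleteSpace G] {f : H → G} {τ : H} (hf : AnalyticAt ℂ f τ) (a b : H) :
    fderiv ℂ (fun σ => fderiv ℂ f σ a) τ b = fderiv ℂ (fderiv ℂ f) τ b a := by
  rw [fderiv_clm_apply_apply hf.fderiv.differentiableAt (differentiableAt_const a)]
  simp

theorem fderiv_C_apply {f : H → H} {τ : H} (hτ : τ ∈ S) (hf : AnalyticAt ℂ f τ) (a b : H) :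
    fderiv ℂ (fun σ => Φ.C σ a (f σ)) τ b =
      fderiv ℂ Φ.C τ b a (f τ) + Φ.C τ a (fderiv ℂ f τ b) := by
  have hC := (Φ.analytic_C τ hτ).differentiableAt
  rw [fderiv_clm_apply_apply (A := fun σ => Φ.C σ a)
    (hC.clm_apply (differentiableAt_const a)) hf.differentiableAt,
    fderiv_clm_apply_apply hC (differentiableAt_const a)]
  simp

theorem fderiv_smul_apply {c : H → ℂ} {f : H → H} {τ : H} (hc : DifferentiableAt ℂ c τ)
    (hf : DifferentiableAt ℂ f τ) (b : H) :
    fderiv ℂ (fun σ => c σ • f σ) τ b = fderiv ℂ c τ b • f τ + c τ • fderiv ℂ f τ b := by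
  rw [fderiv_fun_smul hc hf]
  simp [add_comm]

theorem differentiableAt_mu {f : H → H} {τ : H} (hf : DifferentiableAt ℂ f τ) :
    DifferentiableAt ℂ (fun σ => Φ.mu (f σ)) τ :=
  Φ.mu.differentiableAt.comp τ hf

theorem fderiv_mu_apply {f : H → H} {τ : H} (hf : DifferentiableAt ℂ f τ) (a : H) :
    fderiv ℂ (fun σ => Φ.mu (f σ)) τ a = Φ.mu (fderiv ℂ f τ a) := by
  rw [show (fun σ => Φ.mu (f σ)) = Φ.mu ∘ f from rfl,
    (Φ.mu.hasFDerivAt.comp τ hf.hasFDerivAt).fderiv]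
  rfl

theorem eventuallyEq_of_mem (Φ : SemisimpleFrame ι H S) {G : Type*} {f g : H → G}
    {τ : H} (hτ : τ ∈ S) (h : ∀ σ ∈ S, f σ = g σ) : f =ᶠ[𝓝 τ] g := by
  filter_upwards [Φ.isOpen.mem_nhds hτ] with σ hσ using h σ hσ

theorem Q_fderiv_Ψ_self {τ : H} (hτ : τ ∈ S) (i : ι) (a : H) :
    Φ.Q (fderiv ℂ (Φ.Ψ i) τ a) (Φ.Ψ i τ) = 0 := by
  have dΨ := (Φ.analytic_Ψ i τ hτ).differentiableAt
  have hN := congrArg (fun L : H →L[ℂ] ℂ => L a) ((Φ.eventuallyEq_of_mem hτ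
    (f := fun τ => Φ.Q (Φ.Ψ i τ) (Φ.Ψ i τ)) (g := fun _ => 1)
    fun σ hσ => by rw [Φ.Q_Ψ σ hσ, if_pos rfl]).fderiv_eq (𝕜 := ℂ))
  simp only [fderiv_bilinear_apply Φ.Q dΨ dΨ, fderiv_fun_const, Pi.zero_apply, zero_apply] at hN
  rw [Φ.Q_symm (Φ.Ψ i τ)] at hN
  have : (2 : ℂ) * Φ.Q (fderiv ℂ (Φ.Ψ i) τ a) (Φ.Ψ i τ) = 0 := by linear_combination hN
  simpa using this

/-- The derivatives of the eigenvector equations of `C τ a` and `V τ` on `Ψ i`, combined with the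
symmetry of `d²u_i` and of `dC` and with the formula for `dV`. -/
theorem isIntegrable_zero (i : ι) : Φ.IsIntegrable i 0 (Φ.coeff i 0) where
  symm τ hτ a b := by
    have key : ∀ a b, fderiv ℂ (Φ.u i) τ a • fderiv ℂ (Φ.Ψ i) τ b
        - Φ.C τ a (fderiv ℂ (Φ.Ψ i) τ b) = fderiv ℂ Φ.C τ b a (Φ.Ψ i τ)
        - fderiv ℂ (fderiv ℂ (Φ.u i)) τ b a • Φ.Ψ i τ := by
      intro a b
      have h := congrArg (fun L : H →L[ℂ] H => L b) ((Φ.eventuallyEq_of_mem hτ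
        (f := fun τ => Φ.C τ a (Φ.Ψ i τ)) (g := fun τ => fderiv ℂ (Φ.u i) τ a • Φ.Ψ i τ)
        fun σ hσ => Φ.C_Ψ σ hσ a i).fderiv_eq (𝕜 := ℂ))
      have hu := Φ.analytic_u i τ hτ
      simp only [Φ.fderiv_C_apply hτ (Φ.analytic_Ψ i τ hτ)] at h
      rw [fderiv_smul_apply (hu.fderiv.differentiableAt.clm_apply (differentiableAt_const a))
        (Φ.analytic_Ψ i τ hτ).differentiableAt, fderiv_fderiv_apply hu] at h
      rw [sub_eq_sub_iff_add_eq_add, h, add_comm]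
    simp only [coeff]
    rw [key, key, Φ.fderiv_C τ hτ, fderiv_fderiv_symm (Φ.analytic_u i τ hτ)]
  euler τ hτ a := by
    have h := congrArg (fun L : H →L[ℂ] H => L a) ((Φ.eventuallyEq_of_mem hτ
      (f := fun τ => Φ.V τ (Φ.Ψ i τ)) (g := fun τ => Φ.u i τ • Φ.Ψ i τ)
      fun σ hσ => Φ.V_Ψ σ hσ i).fderiv_eq (𝕜 := ℂ))
    have dΨ := (Φ.analytic_Ψ i τ hτ).differentiableAt
    rw [fderiv_clm_apply_apply (Φ.analytic_V τ hτ).differentiableAt dΨ, Φ.fderiv_V τ hτ,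
      fderiv_smul_apply (Φ.analytic_u i τ hτ).differentiableAt dΨ, Φ.C_Ψ τ hτ, map_smul] at h
    simp only [coeff, Nat.cast_zero, zero_smul, zero_add]
    linear_combination (norm := module) h
  diag τ hτ := by simp [coeff, Φ.Q_mu_self]
  diag_fderiv τ hτ a := Φ.Q_fderiv_Ψ_self hτ i a

end Pointwise

section Recursion

variable {ι H : Type*} [Fintype ι] [DecidableEq ι] [NormedAddCommGroup H] [NormedSpace ℂ H]
  [CompleteSpace H] {S : Set H} (Φ : SemisimpleFrame ι H S)

theorem analytic_offDiag (i : ι) {f : H → H} (hf : AnalyticOnNhd ℂ f S) :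
    AnalyticOnNhd ℂ (Φ.offDiag i f) S := by
  intro τ hτ
  refine Finset.analyticAt_fun_sum _ fun j _ => ?_
  refine AnalyticAt.smul ?_ (Φ.analytic_Ψ j τ hτ)
  refine AnalyticAt.neg (analyticAt_clm_apply ?_ (Φ.analytic_Ψ j τ hτ))
  exact (Φ.Q.analyticAt _).fun_comp
    (analyticAt_clm_apply (hf.fderiv τ hτ) (Φ.analytic_ψ j τ hτ))

theorem analytic_coeff (i : ι) (k : ℕ) : AnalyticOnNhd ℂ (Φ.coeff i k) S := by
  induction k with
  | zero => exact Φ.analytic_Ψ i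
  | succ k ih =>
    intro τ hτ
    have hw := Φ.analytic_offDiag i ih τ hτ
    refine hw.sub (AnalyticAt.smul (analyticAt_const.mul ?_) (Φ.analytic_Ψ i τ hτ))
    exact analyticAt_clm_apply ((Φ.Q.analyticAt _).fun_comp ((Φ.mu.analyticAt _).fun_comp hw))
      (Φ.analytic_Ψ i τ hτ)

/-- The equations obtained for `r_{k+1}` from the hypothesis at `k` are differentiated once more;
symmetry of second derivatives closes the induction. -/
theorem isIntegrable_succ {i : ι} {k : ℕ} (h : Φ.IsIntegrable i k (Φ.coeff i k)) :
    Φ.IsIntegrable i (k + 1) (Φ.coeff i (k + 1)) := by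
  have heul : ∀ τ ∈ S, ∀ a, Φ.V τ (fderiv ℂ (Φ.coeff i (k + 1)) τ a) -
      Φ.u i τ • fderiv ℂ (Φ.coeff i (k + 1)) τ a =
      fderiv ℂ (Φ.u i) τ a • (((k : ℂ) + 1) • Φ.coeff i (k + 1) τ + Φ.mu (Φ.coeff i (k + 1) τ)) -
      Φ.C τ a (((k : ℂ) + 1) • Φ.coeff i (k + 1) τ + Φ.mu (Φ.coeff i (k + 1) τ)) := by
    intro τ hτ a
    have e := congrArg (fun L : H →L[ℂ] H => L a) ((Φ.eventuallyEq_of_mem hτ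
      (f := fun τ => Φ.V τ (Φ.coeff i (k + 1) τ) - Φ.u i τ • Φ.coeff i (k + 1) τ)
      (g := fun τ => (k : ℂ) • Φ.coeff i k τ + Φ.mu (Φ.coeff i k τ))
      fun σ hσ => h.V_coeff hσ).fderiv_eq (𝕜 := ℂ))
    have dr := (Φ.analytic_coeff i (k + 1) τ hτ).differentiableAt
    have dr' := (Φ.analytic_coeff i k τ hτ).differentiableAt
    have dV := (Φ.analytic_V τ hτ).differentiableAt
    have du := (Φ.analytic_u i τ hτ).differentiableAt
    rw [fderiv_fun_sub (dV.clm_apply dr) (du.fun_smul dr),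
      fderiv_fun_add (dr'.fun_const_smul _) (Φ.differentiableAt_mu dr'), sub_apply, add_apply,
      fderiv_clm_apply_apply dV dr, Φ.fderiv_V τ hτ, fderiv_smul_apply du dr,
      fderiv_fun_const_smul dr', smul_apply,
      Φ.fderiv_mu_apply dr',
      h.fderiv_coeff hτ, map_sub, map_smul] at e
    simp only [map_add, map_smul]
    linear_combination (norm := module) e
  have hdiag : ∀ τ ∈ S, ((k : ℂ) + 1) * Φ.Q (Φ.coeff i (k + 1) τ) (Φ.Ψ i τ) +
      Φ.Q (Φ.mu (Φ.coeff i (k + 1) τ)) (Φ.Ψ i τ) = 0 := fun τ hτ => Φ.Q_mu_coeff_succ hτ i k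
  refine ⟨?_, ?_, ?_, ?_⟩
  · intro τ hτ a b
    have hu := Φ.analytic_u i τ hτ
    have hr := Φ.analytic_coeff i (k + 1) τ hτ
    have key : ∀ a b, fderiv ℂ (Φ.u i) τ a • fderiv ℂ (Φ.coeff i (k + 1)) τ b
        - Φ.C τ a (fderiv ℂ (Φ.coeff i (k + 1)) τ b) =
        fderiv ℂ (fderiv ℂ (Φ.coeff i k)) τ b a + fderiv ℂ Φ.C τ b a (Φ.coeff i (k + 1) τ)
        - fderiv ℂ (fderiv ℂ (Φ.u i)) τ b a • Φ.coeff i (k + 1) τ := by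
      intro a b
      have e := congrArg (fun L : H →L[ℂ] H => L b) ((Φ.eventuallyEq_of_mem hτ
        (f := fun τ => fderiv ℂ (Φ.coeff i k) τ a)
        (g := fun τ => fderiv ℂ (Φ.u i) τ a • Φ.coeff i (k + 1) τ -
          Φ.C τ a (Φ.coeff i (k + 1) τ))
        fun σ hσ => h.fderiv_coeff hσ a).fderiv_eq (𝕜 := ℂ))
      have dua := hu.fderiv.differentiableAt.clm_apply (differentiableAt_const a)
      have dC := (Φ.analytic_C τ hτ).differentiableAt.clm_apply (differentiableAt_const a)
      rw [fderiv_fderiv_apply (Φ.analytic_coeff i k τ hτ),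
        fderiv_fun_sub (dua.fun_smul hr.differentiableAt) (dC.clm_apply hr.differentiableAt),
        sub_apply,
        fderiv_smul_apply dua hr.differentiableAt, Φ.fderiv_C_apply hτ hr,
        fderiv_fderiv_apply hu] at e
      rw [e]
      abel
    rw [key, key, Φ.fderiv_C τ hτ, fderiv_fderiv_symm (Φ.analytic_u i τ hτ),
      fderiv_fderiv_symm (Φ.analytic_coeff i k τ hτ)]
  · intro τ hτ a
    push_cast
    exact heul τ hτ a
  · intro τ hτ
    push_cast
    exact hdiag τ hτ
  · intro τ hτ a
    have dr := (Φ.analytic_coeff i (k + 1) τ hτ).differentiableAt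
    have dΨ := (Φ.analytic_Ψ i τ hτ).differentiableAt
    have dm := Φ.differentiableAt_mu dr
    have e := congrArg (fun L : H →L[ℂ] ℂ => L a) ((Φ.eventuallyEq_of_mem hτ
      (f := fun τ => ((k : ℂ) + 1) * Φ.Q (Φ.coeff i (k + 1) τ) (Φ.Ψ i τ) +
      Φ.Q (Φ.mu (Φ.coeff i (k + 1) τ)) (Φ.Ψ i τ)) (g := fun _ => 0) hdiag).fderiv_eq (𝕜 := ℂ))
    have dQ1 : DifferentiableAt ℂ (fun τ => Φ.Q (Φ.coeff i (k + 1) τ) (Φ.Ψ i τ)) τ :=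
      (Φ.Q.differentiableAt.comp τ dr).clm_apply dΨ
    have dQ2 : DifferentiableAt ℂ (fun τ => Φ.Q (Φ.mu (Φ.coeff i (k + 1) τ)) (Φ.Ψ i τ)) τ :=
      (Φ.Q.differentiableAt.comp τ dm).clm_apply dΨ
    rw [fderiv_fun_add (dQ1.const_mul _) dQ2, fderiv_const_mul dQ1, add_apply, smul_apply,
      fderiv_bilinear_apply Φ.Q dr dΨ, fderiv_bilinear_apply Φ.Q dm dΨ, fderiv_fun_const,
      Pi.zero_apply, zero_apply,
      Φ.fderiv_mu_apply dr, Φ.Q_mu] at e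
    -- Write `r` for `r_{k+1}`. Then `(μ dr, Ψ) = -(dr, μ Ψ)` and `μ Ψ = (V - u) r₁`, so
    -- self-adjointness of `V` and `heul` turn this into minus the pairing of `(k + 1) r + μ r` with
    -- `dΨ = (du - C) r₁`. In the derivative of `hdiag` only `(k + 1) (dr, Ψ)` survives.
    have h0 := Φ.isIntegrable_zero i
    have hT := h0.fderiv_coeff hτ a
    have hZ := h0.V_coeff hτ
    simp only [coeff_zero, Nat.cast_zero, zero_smul, zero_add] at hT hZ
    have hE := congrArg (fun x => Φ.Q x (Φ.coeff i 1 τ)) (heul τ hτ a)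
    simp only [map_sub, map_add, map_smul, sub_apply, add_apply, smul_apply, smul_eq_mul,
      Φ.Q_V_comm hτ, Φ.Q_C_comm hτ] at hE
    rw [hT, ← hZ] at e
    simp only [map_sub, map_smul, smul_eq_mul] at e
    have hk : (k : ℂ) + 1 ≠ 0 := by exact_mod_cast k.succ_ne_zero
    refine (mul_eq_zero.1 ?_).resolve_left hk
    linear_combination e + hE

theorem isIntegrable (i : ι) (k : ℕ) : Φ.IsIntegrable i k (Φ.coeff i k) := by
  induction k with
  | zero => exact Φ.isIntegrable_zero i
  | succ k ih => exact Φ.isIntegrable_succ ih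

theorem fderiv_coeff (i : ι) (k : ℕ) {τ : H} (hτ : τ ∈ S) (a : H) :
    fderiv ℂ (Φ.coeff i k) τ a =
      fderiv ℂ (Φ.u i) τ a • Φ.coeff i (k + 1) τ - Φ.C τ a (Φ.coeff i (k + 1) τ) :=
  (Φ.isIntegrable i k).fderiv_coeff hτ a

theorem V_coeff (i : ι) (k : ℕ) {τ : H} (hτ : τ ∈ S) :
    Φ.V τ (Φ.coeff i (k + 1) τ) - Φ.u i τ • Φ.coeff i (k + 1) τ =
      (k : ℂ) • Φ.coeff i k τ + Φ.mu (Φ.coeff i k τ) :=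
  (Φ.isIntegrable i k).V_coeff hτ

end Recursion

/-! ### Factorial bounds for the coefficients. -/

section Bounds

/-- Cauchy's estimate on the line `x + t a`. The factor `2` comes from halving the radius, which
puts the closed disc inside the open ball. -/
theorem _root_.norm_fderiv_apply_le_of_norm_le {E G : Type*} [NormedAddCommGroup E]
    [NormedSpace ℂ E] [NormedAddCommGroup G] [NormedSpace ℂ G] {f : E → G} {x : E} {δ M : ℝ}
    (hδ : 0 < δ) (hf : DifferentiableOn ℂ f (Metric.ball x δ))
    (hM : ∀ y ∈ Metric.ball x δ, ‖f y‖ ≤ M) (a : E) :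
    ‖fderiv ℂ f x a‖ ≤ 2 / δ * M * ‖a‖ := by
  rcases eq_or_ne a 0 with rfl | ha
  · simp
  have ha' : 0 < ‖a‖ := norm_pos_iff.2 ha
  have hs : 0 < δ / (2 * ‖a‖) := by positivity
  have hmem : ∀ t ∈ Metric.closedBall (0 : ℂ) (δ / (2 * ‖a‖)), x + t • a ∈ Metric.ball x δ := by
    intro t ht
    rw [mem_closedBall_zero_iff, le_div_iff₀ (by positivity)] at ht
    rw [mem_ball_iff_norm, add_sub_cancel_left, norm_smul]
    nlinarith
  have hd : ∀ t ∈ Metric.closedBall (0 : ℂ) (δ / (2 * ‖a‖)),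
      DifferentiableAt ℂ (fun t : ℂ => f (x + t • a)) t := fun t ht =>
    ((hf.differentiableAt (Metric.isOpen_ball.mem_nhds (hmem t ht))).comp t
      ((differentiableAt_const x).add (differentiableAt_id.smul_const a)))
  have h := Complex.norm_deriv_le_of_forall_mem_sphere_norm_le (c := 0) hs
    (f := fun t : ℂ => f (x + t • a)) (C := M)
    ⟨fun t ht => (hd t (Metric.ball_subset_closedBall ht)).differentiableWithinAt, fun t ht =>
      (hd t (Metric.closure_ball_subset_closedBall ht)).continuousAt.continuousWithinAt⟩
    fun t ht => hM _ (hmem t (Metric.sphere_subset_closedBall ht))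
  have hx : DifferentiableAt ℂ f (x + (0 : ℂ) • a) :=
    hf.differentiableAt (Metric.isOpen_ball.mem_nhds (hmem 0 (by simp [hs.le])))
  have hline : HasDerivAt (fun t : ℂ => x + t • a) a 0 := by
    simpa using ((hasDerivAt_id (0 : ℂ)).smul_const a).const_add x
  have h2 := (hx.hasFDerivAt.comp_hasDerivAt (0 : ℂ) hline).deriv
  rw [Function.comp_def] at h2
  rw [h2, zero_smul, add_zero] at h
  refine h.trans (le_of_eq ?_)
  field_simp

variable {ι H : Type*} [Fintype ι] [DecidableEq ι] [NormedAddCommGroup H] [NormedSpace ℂ H]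
  [CompleteSpace H] {S : Set H} (Φ : SemisimpleFrame ι H S)

omit [CompleteSpace H] in
-- The recursion is linear in the first derivative of `r_k`, with coefficients bounded near `τ₀`.
-- The constant `A` does not depend on `k` because `(k + 1)⁻¹` is at most `1`.
theorem exists_norm_coeff_succ_le (i : ι) {τ₀ : H} (hτ₀ : τ₀ ∈ S) :
    ∃ R > 0, Metric.ball τ₀ R ⊆ S ∧ ∃ A > 0, (∀ τ ∈ Metric.ball τ₀ R, ‖Φ.Ψ i τ‖ ≤ A) ∧
      ∀ k, ∀ τ ∈ Metric.ball τ₀ R, ∀ K ≥ 0, (∀ a, ‖fderiv ℂ (Φ.coeff i k) τ a‖ ≤ K * ‖a‖) →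
        ‖Φ.coeff i (k + 1) τ‖ ≤ A * K := by
  set P : ℝ := 1 + ∑ j, (‖Φ.Ψ j τ₀‖ + ‖Φ.ψ j τ₀‖) with hP
  have hsum : ∀ j, ‖Φ.Ψ j τ₀‖ + ‖Φ.ψ j τ₀‖ < P := fun j => by
    have := Finset.single_le_sum (f := fun j => ‖Φ.Ψ j τ₀‖ + ‖Φ.ψ j τ₀‖)
      (fun j _ => by positivity) (Finset.mem_univ j)
    linarith
  have hP0 : 0 < P := by positivity
  have hev : ∀ᶠ τ in 𝓝 τ₀, τ ∈ S ∧ ∀ j, ‖Φ.Ψ j τ‖ < P ∧ ‖Φ.ψ j τ‖ < P := by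
    refine (Φ.isOpen.eventually_mem hτ₀).and (eventually_all.2 fun j => ?_)
    refine ((Φ.analytic_Ψ j τ₀ hτ₀).continuousAt.norm.eventually_lt_const ?_).and
      ((Φ.analytic_ψ j τ₀ hτ₀).continuousAt.norm.eventually_lt_const ?_)
    · linarith [hsum j, norm_nonneg (Φ.ψ j τ₀)]
    · linarith [hsum j, norm_nonneg (Φ.Ψ j τ₀)]
  obtain ⟨R, hR, hball⟩ := Metric.eventually_nhds_iff_ball.1 hev
  set W : ℝ := Fintype.card ι * (‖Φ.Q‖ * P * P * P) with hW
  have hW0 : 0 ≤ W := by positivity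
  refine ⟨R, hR, fun τ hτ => (hball τ hτ).1, W + ‖Φ.Q‖ * (‖Φ.mu‖ * W) * P * P + P,
    by positivity, fun τ hτ => ?_, fun k τ hτ K hK h => ?_⟩
  · have := ((hball τ hτ).2 i).1
    have : 0 ≤ W + ‖Φ.Q‖ * (‖Φ.mu‖ * W) * P * P := by positivity
    linarith
  have hΨ : ∀ j, ‖Φ.Ψ j τ‖ ≤ P := fun j => ((hball τ hτ).2 j).1.le
  have hψ : ∀ j, ‖Φ.ψ j τ‖ ≤ P := fun j => ((hball τ hτ).2 j).2.le
  have hoff : ‖Φ.offDiag i (Φ.coeff i k) τ‖ ≤ W * K := by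
    refine (norm_sum_le _ _).trans ((Finset.sum_le_sum
      (g := fun _ => ‖Φ.Q‖ * P * P * P * K) fun j _ => ?_).trans ?_)
    · rw [norm_smul, norm_neg]
      calc _ ≤ (‖Φ.Q‖ * (K * P) * P) * P := by
            gcongr
            · refine (Φ.Q.le_opNorm₂ _ _).trans ?_
              have := (h (Φ.ψ j τ)).trans (mul_le_mul_of_nonneg_left (hψ j) hK)
              gcongr
              exact hΨ j
            · exact hΨ j
        _ = _ := by ring
    · rw [Finset.sum_const, nsmul_eq_mul, hW, mul_assoc (Fintype.card ι : ℝ)]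
      gcongr
      exact Finset.card_le_univ _
  have hk : ‖(k + 1 : ℂ)⁻¹‖ ≤ 1 := by
    rw [norm_inv]
    refine inv_le_one_of_one_le₀ ?_
    rw [show (k + 1 : ℂ) = ((k + 1 : ℕ) : ℂ) by push_cast; ring, Complex.norm_natCast]
    exact_mod_cast Nat.le_add_left 1 k
  have hq : ‖Φ.Q (Φ.mu (Φ.offDiag i (Φ.coeff i k) τ)) (Φ.Ψ i τ)‖ ≤
      ‖Φ.Q‖ * (‖Φ.mu‖ * (W * K)) * P := by
    refine (Φ.Q.le_opNorm₂ _ _).trans ?_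
    have := (Φ.mu.le_opNorm _).trans (mul_le_mul_of_nonneg_left hoff (norm_nonneg Φ.mu))
    gcongr
    exact hΨ i
  have h2 : ‖((k + 1 : ℂ)⁻¹ * Φ.Q (Φ.mu (Φ.offDiag i (Φ.coeff i k) τ)) (Φ.Ψ i τ)) • Φ.Ψ i τ‖ ≤
      ‖Φ.Q‖ * (‖Φ.mu‖ * (W * K)) * P * P := by
    rw [norm_smul, norm_mul]
    calc _ ≤ (1 * (‖Φ.Q‖ * (‖Φ.mu‖ * (W * K)) * P)) * P := by
          gcongr
          exact hΨ i
      _ = _ := by ring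
  refine (norm_sub_le _ _).trans ((add_le_add hoff h2).trans ?_)
  have : 0 ≤ P * K := by positivity
  linarith

/-- To reach `r_k`, the radius shrinks from `R` to `R / 2` in `k` equal steps, each costing a factor
`4 A k / R` by Cauchy's estimate; and `k ^ k ≤ e ^ k k!`. -/
theorem exists_norm_coeff_le (i : ι) {τ₀ : H} (hτ₀ : τ₀ ∈ S) :
    ∃ R > 0, Metric.ball τ₀ R ⊆ S ∧ ∃ A > 0, ∃ M > 0, ∀ k, ∀ τ ∈ Metric.ball τ₀ R,
      ‖Φ.coeff i k τ‖ ≤ A * M ^ k * k.factorial := by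
  obtain ⟨R, hR, hS, A, hA, h0, hstep⟩ := Φ.exists_norm_coeff_succ_le i hτ₀
  refine ⟨R / 2, by positivity, (Metric.ball_subset_ball (by linarith)).trans hS, A, hA,
    4 * A / R * Real.exp 1, by positivity, fun k => ?_⟩
  -- For `k = 0` the division by zero makes the radius equal to `R`, and only `l = 0` occurs.
  have key : ∀ l : ℕ, l ≤ k → ∀ τ ∈ Metric.ball τ₀ (R * (1 - l / (2 * k))),
      ‖Φ.coeff i l τ‖ ≤ A * (4 * A / R * k) ^ l := by
    intro l
    induction l with
    | zero =>
      intro _ τ hτ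
      simpa [coeff_zero] using h0 τ (by simpa using hτ)
    | succ l ih =>
      intro hl τ hτ
      have hk : 0 < (k : ℝ) := by exact_mod_cast (Nat.succ_pos l).trans_le hl
      have hδ : 0 < R / (2 * k) := by positivity
      have hsub : Metric.ball τ (R / (2 * k)) ⊆ Metric.ball τ₀ (R * (1 - l / (2 * k))) := by
        refine Metric.ball_subset_ball' ?_
        rw [Metric.mem_ball] at hτ
        have : R * (1 - ((l + 1 : ℕ) : ℝ) / (2 * k)) = R * (1 - l / (2 * k)) - R / (2 * k) := by
          push_cast
          field_simp
          ring
        linarith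
      have hsub' : ∀ l : ℕ, Metric.ball τ₀ (R * (1 - l / (2 * k))) ⊆ Metric.ball τ₀ R := by
        intro l
        refine Metric.ball_subset_ball ?_
        have : 0 ≤ (l : ℝ) / (2 * k) := by positivity
        nlinarith
      have hd := norm_fderiv_apply_le_of_norm_le hδ (f := Φ.coeff i l) (x := τ)
        (M := A * (4 * A / R * k) ^ l)
        (((Φ.analytic_coeff i l).mono (hsub.trans ((hsub' l).trans hS))).differentiableOn)
        fun σ hσ => ih (by omega) σ (hsub hσ)
      refine (hstep l τ (hsub' (l + 1) (by exact_mod_cast hτ)) _ (by positivity) hd).trans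
        (le_of_eq ?_)
      rw [pow_succ]
      field_simp
      ring
  intro τ hτ
  have hk : R / 2 ≤ R * (1 - k / (2 * k)) := by
    rcases Nat.eq_zero_or_pos k with rfl | hk
    · simp only [Nat.cast_zero, zero_div, sub_zero]; linarith
    · have : (0 : ℝ) < k := by exact_mod_cast hk
      apply le_of_eq
      field_simp
      ring
  refine (key k le_rfl τ (Metric.ball_subset_ball hk hτ)).trans ?_
  rw [mul_pow, mul_pow, mul_assoc, mul_assoc]
  gcongr
  have he := Real.pow_div_factorial_le_exp (k : ℝ) (Nat.cast_nonneg k) k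
  rw [div_le_iff₀ (by positivity)] at he
  rwa [← Real.exp_nat_mul, mul_one]

end Bounds

end SemisimpleFrame

/-! ### Linear differential equations on star-shaped domains, with parameters. -/

section LinearODE

variable {E G : Type*} [NormedAddCommGroup E] [NormedSpace ℂ E] [NormedAddCommGroup G]
  [NormedSpace ℂ G]

/-- The primitive of `g` obtained by integrating along segments from `x₀`. -/
noncomputable def segmentPrimitive (x₀ : ℂ) (g : ℂ → G) (x : ℂ) : G :=
  ∫ s in (0 : ℝ)..1, (x - x₀) • g (x₀ + s * (x - x₀))

theorem StarConvex.add_mul_sub_mem {Ω : Set ℂ} {x₀ x : ℂ} (h : StarConvex ℝ x₀ Ω) (hx : x ∈ Ω)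
    {s : ℝ} (hs : s ∈ Set.Icc (0 : ℝ) 1) : x₀ + s * (x - x₀) ∈ Ω := by
  simpa using h.add_smul_sub_mem hx hs.1 hs.2

theorem segmentPrimitive_self (x₀ : ℂ) (g : ℂ → G) : segmentPrimitive x₀ g x₀ = 0 := by
  simp [segmentPrimitive]

theorem analyticOnNhd_segmentPrimitive [FiniteDimensional ℂ E] [CompleteSpace G]
    {U : Set E} {Ω : Set ℂ} {x₀ : ℂ} (hU : IsOpen U) (hΩ : IsOpen Ω) (hs : StarConvex ℝ x₀ Ω)
    {g : E → ℂ → G} (hg : AnalyticOnNhd ℂ (fun p : E × ℂ => g p.1 p.2) (U ×ˢ Ω)) :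
    AnalyticOnNhd ℂ (fun p : E × ℂ => segmentPrimitive x₀ (g p.1) p.2) (U ×ˢ Ω) := by
  have : ProperSpace (E × ℂ) := FiniteDimensional.proper ℂ _
  have hUΩ : IsOpen (U ×ˢ Ω) := hU.prod hΩ
  set F : E × ℂ → ℝ → G := fun p s => (p.2 - x₀) • g p.1 (x₀ + s * (p.2 - x₀)) with hF
  have hFan : ∀ s ∈ Set.Icc (0 : ℝ) 1, AnalyticOnNhd ℂ (fun p => F p s) (U ×ˢ Ω) := by
    intro s hs' p hp
    refine AnalyticAt.smul (analyticAt_snd.sub analyticAt_const) ?_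
    have h1 := hg (p.1, x₀ + s * (p.2 - x₀)) ⟨hp.1, hs.add_mul_sub_mem hp.2 hs'⟩
    exact h1.fun_comp (f := fun p : E × ℂ => (p.1, x₀ + (s : ℂ) * (p.2 - x₀)))
      (analyticAt_fst.prod (analyticAt_const.add
        (analyticAt_const.mul (analyticAt_snd.sub analyticAt_const))))
  have hcont : ContinuousOn (fun q : (E × ℂ) × ℝ => F q.1 q.2)
      ((U ×ˢ Ω) ×ˢ Set.Icc (0 : ℝ) 1) := by
    refine ContinuousOn.smul (by fun_prop) ?_
    refine hg.continuousOn.comp (f := fun q : (E × ℂ) × ℝ =>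
      (q.1.1, x₀ + (q.2 : ℂ) * (q.1.2 - x₀))) (by fun_prop) ?_
    exact fun q hq => ⟨hq.1.1, hs.add_mul_sub_mem hq.1.2 hq.2⟩
  have heq : (fun p : E × ℂ => segmentPrimitive x₀ (g p.1) p.2) =
      fun p => ∫ s in Set.Ioc (0 : ℝ) 1, F p s := by
    funext p
    rw [segmentPrimitive, intervalIntegral.integral_of_le zero_le_one]
  rw [heq]
  refine analyticOnNhd_integral hUΩ (fun p hp => ?_) ?_ fun p hp => ?_
  · refine ContinuousOn.aestronglyMeasurable ?_ measurableSet_Ioc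
    exact hcont.comp (f := fun s : ℝ => (p, s)) (by fun_prop)
      fun s hs' => ⟨hp, Set.Ioc_subset_Icc_self hs'⟩
  · filter_upwards [MeasureTheory.ae_restrict_mem measurableSet_Ioc] with s hs'
    exact hFan s (Set.Ioc_subset_Icc_self hs')
  · obtain ⟨r, hr, hball⟩ := Metric.nhds_basis_closedBall.mem_iff.1 (hUΩ.mem_nhds hp)
    obtain ⟨M, hM⟩ := ((isCompact_closedBall p r).prod
      (isCompact_Icc (a := (0 : ℝ)) (b := 1))).exists_bound_of_continuousOn
      (hcont.mono (Set.prod_mono hball subset_rfl))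
    refine ⟨_, Metric.closedBall_mem_nhds p hr, fun _ => M, ?_, ?_⟩
    · exact MeasureTheory.integrable_const _
    · filter_upwards [MeasureTheory.ae_restrict_mem measurableSet_Ioc] with s hs' q hq
      exact hM (q, s) ⟨hq, Set.Ioc_subset_Icc_self hs'⟩

/-- After differentiation under the integral, the integrand is the `s`-derivative of `s • g (x₀ + s
(x - x₀))`. -/
theorem hasDerivAt_segmentPrimitive [CompleteSpace G] {Ω : Set ℂ} {x₀ x : ℂ} (hΩ : IsOpen Ω)
    (hs : StarConvex ℝ x₀ Ω) {g : ℂ → G} (hg : AnalyticOnNhd ℂ g Ω) (hx : x ∈ Ω) :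
    HasDerivAt (segmentPrimitive x₀ g) (g x) x := by
  set F : ℂ → ℝ → G := fun x s => (x - x₀) • g (x₀ + s * (x - x₀)) with hF
  have hcont : ContinuousOn (fun q : ℂ × ℝ => F q.1 q.2) (Ω ×ˢ Set.Icc (0 : ℝ) 1) := by
    refine ContinuousOn.smul (by fun_prop) ?_
    refine hg.continuousOn.comp (f := fun q : ℂ × ℝ => x₀ + (q.2 : ℂ) * (q.1 - x₀))
      (by fun_prop) ?_
    exact fun q hq => hs.add_mul_sub_mem hq.1 hq.2
  have hFd : ∀ s ∈ Set.Icc (0 : ℝ) 1, ∀ y ∈ Ω, HasDerivAt (fun y => F y s)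
      (g (x₀ + s * (y - x₀)) + (s * (y - x₀)) • deriv g (x₀ + s * (y - x₀))) y := by
    intro s hs' y hy
    have h1 := (hg _ (hs.add_mul_sub_mem hy hs')).differentiableAt.hasDerivAt
    have h2 : HasDerivAt (fun y : ℂ => x₀ + s * (y - x₀)) (s : ℂ) y := by
      simpa using (((hasDerivAt_id y).sub_const x₀).const_mul (s : ℂ)).const_add x₀
    have h3 := ((hasDerivAt_id y).sub_const x₀).smul (h1.scomp y h2)
    refine HasDerivAt.congr_deriv (f := fun y => F y s) h3 ?_
    simp only [id, one_smul, smul_smul, Function.comp]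
    rw [add_comm, mul_comm (s : ℂ)]
  obtain ⟨r, hr, hball⟩ := Metric.nhds_basis_closedBall.mem_iff.1 (hΩ.mem_nhds hx)
  obtain ⟨M, hM⟩ := ((isCompact_closedBall x r).prod
    (isCompact_Icc (a := (0 : ℝ)) (b := 1))).exists_bound_of_continuousOn
    (hcont.mono (Set.prod_mono hball subset_rfl))
  have key := hasDerivAt_integral_of_differentiableOn (t₀ := x) (F := F) (bound := fun _ => M) hr
    (μ := MeasureTheory.volume.restrict (Set.Ioc (0 : ℝ) 1)) ?_ ?_
    (MeasureTheory.integrable_const _) ?_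
  · have heq : segmentPrimitive x₀ g = fun x => ∫ s in Set.Ioc (0 : ℝ) 1, F x s := by
      funext p
      rw [segmentPrimitive, intervalIntegral.integral_of_le zero_le_one]
    rw [heq]
    convert key using 1
    have hline : ∀ s : ℝ, HasDerivAt (fun s : ℝ => x₀ + (s : ℂ) * (x - x₀)) (x - x₀) s := by
      intro s
      simpa using ((ofRealCLM.hasDerivAt (x := s)).mul_const (x - x₀)).const_add x₀
    have hcl : ContinuousOn (fun s : ℝ => x₀ + (s : ℂ) * (x - x₀)) (Set.Icc 0 1) :=
      fun s _ => (hline s).continuousAt.continuousWithinAt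
    have hmaps : Set.MapsTo (fun s : ℝ => x₀ + (s : ℂ) * (x - x₀)) (Set.Icc 0 1) Ω :=
      fun s hs' => hs.add_mul_sub_mem hx hs'
    have hftc := intervalIntegral.integral_eq_sub_of_hasDerivAt (a := (0 : ℝ)) (b := 1)
      (f := fun s : ℝ => (s : ℂ) • g (x₀ + s * (x - x₀)))
      (f' := fun s : ℝ =>
        g (x₀ + s * (x - x₀)) + (s * (x - x₀)) • deriv g (x₀ + s * (x - x₀))) ?_ ?_
    · rw [intervalIntegral.integral_of_le zero_le_one] at hftc
      simp only [ofReal_one, one_smul, one_mul, add_sub_cancel, ofReal_zero, zero_smul,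
        sub_zero] at hftc
      rw [← hftc]
      refine MeasureTheory.setIntegral_congr_fun measurableSet_Ioc fun s hs' => ?_
      exact ((hFd s (Set.Ioc_subset_Icc_self hs') x hx).deriv).symm
    · intro s hs'
      rw [Set.uIcc_of_le zero_le_one] at hs'
      have h1 := (hg _ (hs.add_mul_sub_mem hx hs')).differentiableAt.hasDerivAt
      have h3 := (ofRealCLM.hasDerivAt (x := s)).smul (h1.scomp s (hline s))
      refine HasDerivAt.congr_deriv (f := fun s : ℝ => (s : ℂ) • g (x₀ + s * (x - x₀))) h3 ?_
      simp only [ofRealCLM_apply, ofReal_one, one_smul, smul_smul, Function.comp]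
      rw [add_comm]
    · refine ContinuousOn.intervalIntegrable ?_
      rw [Set.uIcc_of_le zero_le_one]
      refine (hg.continuousOn.comp hcl hmaps).add (ContinuousOn.smul (by fun_prop) ?_)
      exact hg.deriv.continuousOn.comp hcl hmaps
  · intro y hy
    refine ContinuousOn.aestronglyMeasurable ?_ measurableSet_Ioc
    exact hcont.comp (f := fun s : ℝ => (y, s)) (by fun_prop)
      fun s hs' => ⟨hball (Metric.ball_subset_closedBall hy), Set.Ioc_subset_Icc_self hs'⟩
  · filter_upwards [MeasureTheory.ae_restrict_mem measurableSet_Ioc] with s hs' y hy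
    exact hM (y, s) ⟨Metric.ball_subset_closedBall hy, Set.Ioc_subset_Icc_self hs'⟩
  · filter_upwards [MeasureTheory.ae_restrict_mem measurableSet_Ioc] with s hs' y hy
    exact (hFd s (Set.Ioc_subset_Icc_self hs') y
      (hball (Metric.ball_subset_closedBall hy))).differentiableAt.differentiableWithinAt

/-- The terms of the Picard series of the equation `f' = A f`. -/
noncomputable def picardTerm (x₀ : ℂ) (A : E → ℂ → G →L[ℂ] G) (f₀ : E → G) : ℕ → E → ℂ → G
  | 0 => fun τ _ => f₀ τ
  | n + 1 => fun τ => segmentPrimitive x₀ fun x => A τ x (picardTerm x₀ A f₀ n τ x)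

variable {U : Set E} {Ω : Set ℂ} {x₀ : ℂ} {A : E → ℂ → G →L[ℂ] G} {f₀ : E → G}

theorem analyticOnNhd_picardTerm [FiniteDimensional ℂ E] [CompleteSpace G] (hU : IsOpen U)
    (hΩ : IsOpen Ω) (hs : StarConvex ℝ x₀ Ω)
    (hA : AnalyticOnNhd ℂ (fun p : E × ℂ => A p.1 p.2) (U ×ˢ Ω)) (hf₀ : AnalyticOnNhd ℂ f₀ U)
    (n : ℕ) :
    AnalyticOnNhd ℂ (fun p : E × ℂ => picardTerm x₀ A f₀ n p.1 p.2) (U ×ˢ Ω) := by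
  induction n with
  | zero => exact fun p hp => (hf₀ p.1 hp.1).fun_comp analyticAt_fst
  | succ n ih =>
    exact analyticOnNhd_segmentPrimitive hU hΩ hs
      (g := fun τ x => A τ x (picardTerm x₀ A f₀ n τ x))
      fun p hp => analyticAt_clm_apply (hA p hp) (ih p hp)

omit [NormedAddCommGroup E] [NormedSpace ℂ E] in
-- With a coefficient of size `c / (1 + distance)`, each integration along a ray from `x₀` adds one
-- power of the logarithm: the integrated bound for `n` is exactly the bound for `n + 1`.
theorem norm_picardTerm_le (hs : StarConvex ℝ x₀ Ω) {c : ℝ} (hc : 0 ≤ c) {τ : E}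
    (hb : ∀ x ∈ Ω, ‖A τ x‖ ≤ c / (1 + ‖x - x₀‖)) (n : ℕ) {x : ℂ} (hx : x ∈ Ω) :
    ‖picardTerm x₀ A f₀ n τ x‖ ≤
      ‖f₀ τ‖ * ((c * Real.log (1 + ‖x - x₀‖)) ^ n / n.factorial) := by
  induction n generalizing x with
  | zero => simp [picardTerm]
  | succ n ih =>
    set h := ‖x - x₀‖ with hh
    have hh0 : 0 ≤ h := norm_nonneg _
    have hpos : ∀ s ∈ Set.Icc (0 : ℝ) 1, 0 < 1 + s * h := fun s hs' => by
      have := mul_nonneg hs'.1 hh0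
      linarith
    have hder : ∀ s ∈ Set.Icc (0 : ℝ) 1, HasDerivAt
        (fun s => ‖f₀ τ‖ * ((c * Real.log (1 + s * h)) ^ (n + 1) / (n + 1).factorial))
        (c * h / (1 + s * h) * (‖f₀ τ‖ * ((c * Real.log (1 + s * h)) ^ n / n.factorial))) s := by
      intro s hs'
      have h1 : HasDerivAt (fun s : ℝ => 1 + s * h) h s := by
        simpa using ((hasDerivAt_id s).mul_const h).const_add 1
      have h2 := ((((h1.log (hpos s hs').ne').const_mul c).pow (n + 1)).div_const
        ((n + 1).factorial : ℝ)).const_mul ‖f₀ τ‖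
      refine h2.congr_deriv ?_
      have := (hpos s hs').ne'
      rw [Nat.factorial_succ]
      push_cast
      have h3 : (n : ℝ) + 1 ≠ 0 := by positivity
      field_simp
    have hci : ContinuousOn (fun s : ℝ => c * h / (1 + s * h) *
        (‖f₀ τ‖ * ((c * Real.log (1 + s * h)) ^ n / n.factorial))) (Set.Icc 0 1) := by
      have hlin : ContinuousOn (fun s : ℝ => 1 + s * h) (Set.Icc 0 1) := by fun_prop
      have hne : ∀ s ∈ Set.Icc (0 : ℝ) 1, 1 + s * h ≠ 0 := fun s hs' => (hpos s hs').ne'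
      exact (continuousOn_const.div hlin hne).mul (continuousOn_const.mul
        (((continuousOn_const.mul (hlin.log hne)).pow n).div_const _))
    have hii : IntervalIntegrable (fun s : ℝ => c * h / (1 + s * h) *
        (‖f₀ τ‖ * ((c * Real.log (1 + s * h)) ^ n / n.factorial))) MeasureTheory.volume 0 1 :=
      ContinuousOn.intervalIntegrable (by rwa [Set.uIcc_of_le zero_le_one])
    have hftc := intervalIntegral.integral_eq_sub_of_hasDerivAt (a := (0 : ℝ)) (b := 1)
      (fun s hs' => hder s (by rwa [Set.uIcc_of_le zero_le_one] at hs')) hii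
    have hle := intervalIntegral.norm_integral_le_of_norm_le (a := (0 : ℝ)) (b := 1)
      (f := fun s : ℝ => (x - x₀) • A τ (x₀ + s * (x - x₀))
        (picardTerm x₀ A f₀ n τ (x₀ + s * (x - x₀)))) zero_le_one ?_ hii
    · rw [hftc] at hle
      simp only [one_mul, zero_mul, add_zero, Real.log_one, mul_zero, ne_eq, Nat.succ_ne_zero,
        not_false_eq_true, zero_pow, zero_div, sub_zero] at hle
      exact hle
    · filter_upwards with s hs'
      have hs'' := Set.Ioc_subset_Icc_self hs'
      have hmem := hs.add_mul_sub_mem hx hs''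
      have hnorm : ‖x₀ + (s : ℂ) * (x - x₀) - x₀‖ = s * h := by
        rw [add_sub_cancel_left, norm_mul, norm_real, Real.norm_of_nonneg hs''.1]
      have hA := hb _ hmem
      have hI := ih hmem
      rw [hnorm] at hA hI
      rw [norm_smul]
      have hp := hpos s hs''
      calc h * ‖A τ (x₀ + s * (x - x₀)) (picardTerm x₀ A f₀ n τ (x₀ + s * (x - x₀)))‖
          ≤ h * (c / (1 + s * h) *
            (‖f₀ τ‖ * ((c * Real.log (1 + s * h)) ^ n / n.factorial))) := by
            gcongr
            exact (ContinuousLinearMap.le_opNorm _ _).trans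
              (mul_le_mul hA hI (norm_nonneg _) (by positivity))
        _ = _ := by ring

/-- A linear differential equation on a star-shaped domain, with a coefficient that depends
analytically on a parameter and decays like `1 / |x|`, has a solution that depends analytically
on the parameter and grows polynomially. -/
theorem exists_analyticOnNhd_hasDerivAt [FiniteDimensional ℂ E] [CompleteSpace G] (hU : IsOpen U)
    (hΩ : IsOpen Ω) (hs : StarConvex ℝ x₀ Ω)
    (hA : AnalyticOnNhd ℂ (fun p : E × ℂ => A p.1 p.2) (U ×ˢ Ω)) (hf₀ : AnalyticOnNhd ℂ f₀ U)
    {c : ℕ} (hb : ∀ τ ∈ U, ∀ x ∈ Ω, ‖A τ x‖ ≤ c / (1 + ‖x - x₀‖)) :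
    ∃ f : E → ℂ → G, AnalyticOnNhd ℂ (fun p : E × ℂ => f p.1 p.2) (U ×ˢ Ω) ∧
      (∀ τ ∈ U, f τ x₀ = f₀ τ) ∧
      (∀ τ ∈ U, ∀ x ∈ Ω, HasDerivAt (f τ) (A τ x (f τ x)) x) ∧
      ∀ τ ∈ U, ∀ x ∈ Ω, ‖f τ x‖ ≤ ‖f₀ τ‖ * (1 + ‖x - x₀‖) ^ c := by
  have hUΩ : IsOpen (U ×ˢ Ω) := hU.prod hΩ
  have hterm := analyticOnNhd_picardTerm hU hΩ hs hA hf₀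
  have hbd : ∀ n, ∀ τ ∈ U, ∀ x ∈ Ω, ‖picardTerm x₀ A f₀ n τ x‖ ≤
      ‖f₀ τ‖ * ((c * Real.log (1 + ‖x - x₀‖)) ^ n / n.factorial) :=
    fun n τ hτ x hx => norm_picardTerm_le hs c.cast_nonneg (hb τ hτ) n hx
  have hlog : ∀ x : ℂ, 0 ≤ Real.log (1 + ‖x - x₀‖) := fun x =>
    Real.log_nonneg (by linarith [norm_nonneg (x - x₀)])
  have hloc : TendstoLocallyUniformlyOn
      (fun N (p : E × ℂ) => ∑ n ∈ Finset.range N, picardTerm x₀ A f₀ n p.1 p.2)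
      (fun p => ∑' n, picardTerm x₀ A f₀ n p.1 p.2) atTop (U ×ˢ Ω) := by
    refine tendstoLocallyUniformlyOn_of_forall_exists_nhds fun p hp => ?_
    have hev : ∀ᶠ q : E × ℂ in 𝓝 p, q ∈ U ×ˢ Ω ∧ ‖f₀ q.1‖ < ‖f₀ p.1‖ + 1 ∧
        ‖q.2 - x₀‖ < ‖p.2 - x₀‖ + 1 := by
      refine (hUΩ.eventually_mem hp).and (Eventually.and ?_ ?_)
      · exact (((hf₀ p.1 hp.1).continuousAt.comp continuousAt_fst).norm).eventually_lt_const
          (by simp)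
      · exact Continuous.continuousAt (by fun_prop) |>.eventually_lt_const (by simp)
    refine ⟨_, mem_nhdsWithin_of_mem_nhds hev, ?_⟩
    refine tendstoUniformlyOn_tsum_nat (u := fun n => (‖f₀ p.1‖ + 1) *
      ((c * Real.log (1 + (‖p.2 - x₀‖ + 1))) ^ n / n.factorial))
      ((Real.summable_pow_div_factorial _).mul_left _) ?_
    rintro n q ⟨hq, hq1, hq2⟩
    refine (hbd n q.1 hq.1 q.2 hq.2).trans ?_
    have h1 := hlog q.2
    have h2 : 0 ≤ ‖q.2 - x₀‖ := norm_nonneg _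
    gcongr
  have hpart : ∀ τ ∈ U, TendstoLocallyUniformlyOn
      (fun N x => ∑ n ∈ Finset.range N, picardTerm x₀ A f₀ n τ x)
      (fun x => ∑' n, picardTerm x₀ A f₀ n τ x) atTop Ω := fun τ hτ =>
    hloc.comp (fun x => (τ, x)) (fun x hx => ⟨hτ, hx⟩) (by fun_prop)
  have hterm' : ∀ n, ∀ τ ∈ U, AnalyticOnNhd ℂ (picardTerm x₀ A f₀ n τ) Ω := fun n τ hτ x hx =>
    (hterm n (τ, x) ⟨hτ, hx⟩).fun_comp (f := fun x : ℂ => (τ, x))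
      (analyticAt_const.prod analyticAt_id)
  refine ⟨fun τ x => ∑' n, picardTerm x₀ A f₀ n τ x, ?_, ?_, ?_, ?_⟩
  · refine hloc.analyticOnNhd hUΩ (Eventually.of_forall fun N => ?_)
    exact Finset.analyticOnNhd_fun_sum _ fun n _ => hterm n
  · intro τ hτ
    change ∑' n, picardTerm x₀ A f₀ n τ x₀ = f₀ τ
    rw [tsum_eq_single 0]
    · rfl
    · intro n hn
      obtain ⟨k, rfl⟩ := Nat.exists_eq_succ_of_ne_zero hn
      exact segmentPrimitive_self x₀ fun x => A τ x (picardTerm x₀ A f₀ k τ x)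
  · intro τ hτ x hx
    have hdiff : ∀ N, DifferentiableOn ℂ
        (fun x => ∑ n ∈ Finset.range N, picardTerm x₀ A f₀ n τ x) Ω := fun N =>
      (Finset.analyticOnNhd_fun_sum _ fun n _ => hterm' n τ hτ).differentiableOn
    have hd := ((hpart τ hτ).differentiableOn (Eventually.of_forall hdiff) hΩ).differentiableAt
      (hΩ.mem_nhds hx)
    have hderiv := ((hpart τ hτ).deriv (Eventually.of_forall hdiff) hΩ).tendsto_at hx
    have hsum : ∀ N, deriv (fun x => ∑ n ∈ Finset.range (N + 1), picardTerm x₀ A f₀ n τ x) x =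
        A τ x (∑ n ∈ Finset.range N, picardTerm x₀ A f₀ n τ x) := by
      intro N
      rw [deriv_fun_sum fun n _ => (hterm' n τ hτ x hx).differentiableAt,
        Finset.sum_range_succ', map_sum]
      have h0 : deriv (picardTerm x₀ A f₀ 0 τ) x = 0 := by
        rw [show picardTerm x₀ A f₀ 0 τ = fun _ => f₀ τ from rfl, deriv_const]
      rw [h0, add_zero]
      refine Finset.sum_congr rfl fun n _ => ?_
      refine (hasDerivAt_segmentPrimitive hΩ hs
        (g := fun x => A τ x (picardTerm x₀ A f₀ n τ x)) (fun y hy => ?_) hx).deriv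
      exact analyticAt_clm_apply ((hA (τ, y) ⟨hτ, hy⟩).fun_comp (f := fun x : ℂ => (τ, x))
        (analyticAt_const.prod analyticAt_id)) (hterm' n τ hτ y hy)
    have h1 := (tendsto_add_atTop_iff_nat 1).2 hderiv
    simp only [Function.comp, hsum] at h1
    have h2 := ((A τ x).continuous.tendsto _).comp ((hpart τ hτ).tendsto_at hx)
    rw [← tendsto_nhds_unique h1 h2]
    exact hd.hasDerivAt
  · intro τ hτ x hx
    refine (tsum_of_norm_bounded (HasSum.mul_left _ ?_) fun n => hbd n τ hτ x hx)
    -- The bounds sum to `exp (c log (1 + ‖x - x₀‖))`, a polynomial because `c` is a natural number.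
    have h := NormedSpace.expSeries_div_hasSum_exp (𝔸 := ℝ) (c * Real.log (1 + ‖x - x₀‖))
    rw [← Real.exp_eq_exp_ℝ, Real.exp_nat_mul, Real.exp_log (by positivity)] at h
    exact h

/-- Solutions of a linear differential equation on a star-shaped domain are determined by their
initial value. -/
theorem eqOn_of_hasDerivAt_linear (hs : StarConvex ℝ x₀ Ω) {B : ℂ → G →L[ℂ] G}
    (hB : ContinuousOn B Ω) {f g : ℂ → G} (hf : ∀ x ∈ Ω, HasDerivAt f (B x (f x)) x)
    (hg : ∀ x ∈ Ω, HasDerivAt g (B x (g x)) x) (h0 : f x₀ = g x₀) : Set.EqOn f g Ω := by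
  intro x hx
  have hline : ∀ s : ℝ, HasDerivAt (fun s : ℝ => x₀ + (s : ℂ) * (x - x₀)) (x - x₀) s := by
    intro s
    simpa using ((ofRealCLM.hasDerivAt (x := s)).mul_const (x - x₀)).const_add x₀
  have hcl : Continuous (fun s : ℝ => x₀ + (s : ℂ) * (x - x₀)) := by fun_prop
  have hmaps : Set.MapsTo (fun s : ℝ => x₀ + (s : ℂ) * (x - x₀)) (Set.Icc 0 1) Ω :=
    fun s hs' => hs.add_mul_sub_mem hx hs'
  obtain ⟨K, hK⟩ := isCompact_Icc.exists_bound_of_continuousOn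
    (((hB.comp hcl.continuousOn hmaps).const_smul (x - x₀)))
  have hd : ∀ {f : ℂ → G}, (∀ x ∈ Ω, HasDerivAt f (B x (f x)) x) → ∀ s ∈ Set.Icc (0 : ℝ) 1,
      HasDerivAt (fun s : ℝ => f (x₀ + s * (x - x₀)))
        (((x - x₀) • B (x₀ + s * (x - x₀))) (f (x₀ + s * (x - x₀)))) s := fun {f} hf s hs' => by
    exact (hf _ (hmaps hs')).scomp s (hline s)
  have := ODE_solution_unique_of_mem_Icc_right (a := (0 : ℝ)) (b := 1)
    (v := fun s : ℝ => fun y => ((x - x₀) • B (x₀ + s * (x - x₀))) y) (s := fun _ => Set.univ)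
    (K := K.toNNReal) (f := fun s : ℝ => f (x₀ + s * (x - x₀)))
    (g := fun s : ℝ => g (x₀ + s * (x - x₀))) ?_
    (fun s hs' => (hd hf s hs').continuousAt.continuousWithinAt)
    (fun s hs' => (hd hf s (Set.Ico_subset_Icc_self hs')).hasDerivWithinAt)
    (fun _ _ => Set.mem_univ _)
    (fun s hs' => (hd hg s hs').continuousAt.continuousWithinAt)
    (fun s hs' => (hd hg s (Set.Ico_subset_Icc_self hs')).hasDerivWithinAt)
    (fun _ _ => Set.mem_univ _) (by simpa using h0) (Set.right_mem_Icc.2 zero_le_one)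
  · simpa using this
  · intro s hs'
    refine (ContinuousLinearMap.lipschitz _).weaken ?_ |>.lipschitzOnWith
    rw [← NNReal.coe_le_coe, coe_nnnorm]
    exact (hK s (Set.Ico_subset_Icc_self hs')).trans (Real.le_coe_toNNReal K)

end LinearODE

/-! ### The formal Borel transform near the origin. -/

namespace SemisimpleFrame

section BorelSeries

variable {ι H : Type*} [Fintype ι] [DecidableEq ι] [NormedAddCommGroup H] [NormedSpace ℂ H]
  {S : Set H} (Φ : SemisimpleFrame ι H S)

/-- The partial sums of the formal Borel transform `∑ rₖ xᵏ / k!` of `∑ rₖ zᵏ`. -/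
noncomputable def borelPartial (i : ι) (N : ℕ) (τ : H) (x : ℂ) : H :=
  ∑ k ∈ Finset.range N, (x ^ k / k.factorial) • Φ.coeff i k τ

/-- The formal Borel transform `∑ rₖ xᵏ / k!` of `∑ rₖ zᵏ`. -/
noncomputable def borelSeries (i : ι) (τ : H) (x : ℂ) : H :=
  ∑' k : ℕ, (x ^ k / k.factorial) • Φ.coeff i k τ

/-- The partial sums of the derivative of the Borel transform. -/
noncomputable def borelDerivPartial (i : ι) (N : ℕ) (τ : H) (x : ℂ) : H :=
  ∑ k ∈ Finset.range N, (x ^ k / k.factorial) • Φ.coeff i (k + 1) τ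

theorem hasDerivAt_borelPartial_succ (i : ι) (N : ℕ) (τ : H) (x : ℂ) :
    HasDerivAt (Φ.borelPartial i (N + 1) τ) (Φ.borelDerivPartial i N τ x) x := by
  have h : ∀ k : ℕ, HasDerivAt (fun x : ℂ => (x ^ (k + 1) / (k + 1).factorial) •
      Φ.coeff i (k + 1) τ) ((x ^ k / k.factorial) • Φ.coeff i (k + 1) τ) x := by
    intro k
    refine (((hasDerivAt_pow (k + 1) x).div_const _).congr_deriv ?_).smul_const _
    rw [Nat.factorial_succ]
    have h3 : ((k : ℂ) + 1) ≠ 0 := by exact_mod_cast k.succ_ne_zero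
    have h4 : (k.factorial : ℂ) ≠ 0 := by exact_mod_cast k.factorial_ne_zero
    push_cast
    field_simp
  have heq : Φ.borelPartial i (N + 1) τ = fun x : ℂ =>
      (∑ k ∈ Finset.range N, (x ^ (k + 1) / (k + 1).factorial) • Φ.coeff i (k + 1) τ) +
        Φ.coeff i 0 τ := by
    funext x
    rw [borelPartial, Finset.sum_range_succ']
    simp
  rw [heq]
  exact (HasDerivAt.fun_sum fun k _ => h k).add_const _

/-- The relation `V_coeff` after the Borel transform: the factor `k` in `k r_k` becomes `x d/dx`.
Multiplication by `x` raises the degree by one, hence the partial sums of different length. -/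
theorem V_borelDerivPartial [CompleteSpace H] (i : ι) (N : ℕ) {τ : H} (hτ : τ ∈ S) (x : ℂ) :
    Φ.V τ (Φ.borelDerivPartial i (N + 1) τ x) - Φ.u i τ • Φ.borelDerivPartial i (N + 1) τ x =
      x • Φ.borelDerivPartial i N τ x + Φ.mu (Φ.borelPartial i (N + 1) τ x) := by
  have h1 : x • Φ.borelDerivPartial i N τ x =
      ∑ k ∈ Finset.range (N + 1), (k * (x ^ k / k.factorial)) • Φ.coeff i k τ := by
    rw [borelDerivPartial, Finset.sum_range_succ', Finset.smul_sum]
    simp only [Nat.cast_zero, zero_mul, zero_smul, add_zero, smul_smul]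
    refine Finset.sum_congr rfl fun k _ => ?_
    congr 1
    rw [Nat.factorial_succ]
    have h3 : ((k : ℂ) + 1) ≠ 0 := by exact_mod_cast k.succ_ne_zero
    have h4 : (k.factorial : ℂ) ≠ 0 := by exact_mod_cast k.factorial_ne_zero
    push_cast
    field_simp
    ring
  rw [h1]
  simp only [borelDerivPartial, borelPartial, map_sum, map_smul, Finset.smul_sum]
  rw [← Finset.sum_sub_distrib, ← Finset.sum_add_distrib]
  refine Finset.sum_congr rfl fun k _ => ?_
  have := Φ.V_coeff i k hτ
  rw [smul_comm, ← smul_sub, this]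
  module

variable {Φ} {i : ι} {W : Set H} {A M : ℝ}

theorem norm_borelTerm_le (hM : 0 < M) (hA : 0 < A)
    (hb : ∀ k, ∀ τ ∈ W, ‖Φ.coeff i k τ‖ ≤ A * M ^ k * k.factorial) (k : ℕ) {τ : H} (hτ : τ ∈ W)
    (x : ℂ) : ‖(x ^ k / k.factorial : ℂ) • Φ.coeff i k τ‖ ≤ A * (M * ‖x‖) ^ k := by
  rw [norm_smul, norm_div, norm_pow, norm_natCast]
  have hk : (0 : ℝ) < k.factorial := by exact_mod_cast k.factorial_pos
  calc ‖x‖ ^ k / k.factorial * ‖Φ.coeff i k τ‖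
      ≤ ‖x‖ ^ k / k.factorial * (A * M ^ k * k.factorial) := by
        gcongr
        exact hb k τ hτ
    _ = A * (M * ‖x‖) ^ k := by
        rw [mul_pow]
        field_simp

/-- The radius is half of the guaranteed radius of convergence `1 / M`, so the ratio is `1 / 2`. -/
theorem norm_borelTerm_le_geometric (hM : 0 < M) (hA : 0 < A)
    (hb : ∀ k, ∀ τ ∈ W, ‖Φ.coeff i k τ‖ ≤ A * M ^ k * k.factorial) (k : ℕ) {τ : H} (hτ : τ ∈ W)
    {x : ℂ} (hx : ‖x‖ < 1 / (2 * M)) :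
    ‖(x ^ k / k.factorial : ℂ) • Φ.coeff i k τ‖ ≤ A * (1 / 2) ^ k := by
  refine (norm_borelTerm_le hM hA hb k hτ x).trans ?_
  have : M * ‖x‖ ≤ 1 / 2 := by
    rw [lt_div_iff₀ (by positivity)] at hx
    linarith
  gcongr

theorem tendstoUniformlyOn_borelPartial [CompleteSpace H] (hM : 0 < M) (hA : 0 < A)
    (hb : ∀ k, ∀ τ ∈ W, ‖Φ.coeff i k τ‖ ≤ A * M ^ k * k.factorial) :
    TendstoUniformlyOn (fun N (p : H × ℂ) => Φ.borelPartial i N p.1 p.2)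
      (fun p => Φ.borelSeries i p.1 p.2) atTop (W ×ˢ Metric.ball 0 (1 / (2 * M))) :=
  tendstoUniformlyOn_tsum_nat (f := fun (k : ℕ) (p : H × ℂ) =>
      (p.2 ^ k / k.factorial) • Φ.coeff i k p.1) (u := fun n => A * (1 / 2) ^ n)
    (summable_geometric_two.mul_left A) fun n p hp =>
      norm_borelTerm_le_geometric hM hA hb n hp.1 (by simpa using hp.2)

theorem analyticOnNhd_borelPartial [CompleteSpace H] (hWS : W ⊆ S) (N : ℕ) :
    AnalyticOnNhd ℂ (fun p : H × ℂ => Φ.borelPartial i N p.1 p.2)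
      (W ×ˢ (Set.univ : Set ℂ)) := by
  refine Finset.analyticOnNhd_fun_sum _ fun k _ p hp => ?_
  refine AnalyticAt.smul ((analyticAt_snd.pow k).div_const) ?_
  exact (Φ.analytic_coeff i k p.1 (hWS hp.1)).fun_comp analyticAt_fst

theorem analyticOnNhd_borelSeries [FiniteDimensional ℂ H] (hM : 0 < M) (hA : 0 < A)
    (hW : IsOpen W) (hWS : W ⊆ S)
    (hb : ∀ k, ∀ τ ∈ W, ‖Φ.coeff i k τ‖ ≤ A * M ^ k * k.factorial) :
    AnalyticOnNhd ℂ (fun p : H × ℂ => Φ.borelSeries i p.1 p.2)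
      (W ×ˢ Metric.ball 0 (1 / (2 * M))) := by
  have : CompleteSpace H := FiniteDimensional.complete ℂ H
  refine (tendstoUniformlyOn_borelPartial hM hA hb).tendstoLocallyUniformlyOn.analyticOnNhd
    (hW.prod Metric.isOpen_ball) (Eventually.of_forall fun N => ?_)
  exact (analyticOnNhd_borelPartial hWS N).mono (Set.prod_mono subset_rfl (Set.subset_univ _))

theorem tendsto_borelDerivPartial [CompleteSpace H] (hM : 0 < M) (hA : 0 < A)
    (hb : ∀ k, ∀ τ ∈ W, ‖Φ.coeff i k τ‖ ≤ A * M ^ k * k.factorial) {τ : H} (hτ : τ ∈ W)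
    {x : ℂ} (hx : x ∈ Metric.ball (0 : ℂ) (1 / (2 * M))) :
    Tendsto (fun N => Φ.borelDerivPartial i N τ x) atTop (𝓝 (deriv (Φ.borelSeries i τ) x)) := by
  have h1 : TendstoLocallyUniformlyOn (fun N x => Φ.borelPartial i N τ x) (Φ.borelSeries i τ)
      atTop (Metric.ball 0 (1 / (2 * M))) :=
    (tendstoUniformlyOn_borelPartial hM hA hb).tendstoLocallyUniformlyOn.comp
      (fun x : ℂ => (τ, x)) (fun x hx => ⟨hτ, hx⟩) (by fun_prop)
  have h2 := ((tendsto_add_atTop_iff_nat 1).2 ((h1.deriv ?_ Metric.isOpen_ball).tendsto_at hx))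
  · simpa only [Function.comp, (Φ.hasDerivAt_borelPartial_succ i _ τ x).deriv] using h2
  · filter_upwards [eventually_ge_atTop 1] with N hN x _
    obtain ⟨N, rfl⟩ := Nat.exists_eq_add_of_le' hN
    exact (Φ.hasDerivAt_borelPartial_succ i N τ x).differentiableAt.differentiableWithinAt

theorem tendsto_borelPartial [CompleteSpace H] (hM : 0 < M) (hA : 0 < A)
    (hb : ∀ k, ∀ τ ∈ W, ‖Φ.coeff i k τ‖ ≤ A * M ^ k * k.factorial) {τ : H} (hτ : τ ∈ W)
    {x : ℂ} (hx : x ∈ Metric.ball (0 : ℂ) (1 / (2 * M))) :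
    Tendsto (fun N => Φ.borelPartial i N τ x) atTop (𝓝 (Φ.borelSeries i τ x)) :=
  (tendstoUniformlyOn_borelPartial hM hA hb).tendsto_at (x := (τ, x)) ⟨hτ, hx⟩

theorem V_deriv_borelSeries [CompleteSpace H] (hM : 0 < M) (hA : 0 < A) (hWS : W ⊆ S)
    (hb : ∀ k, ∀ τ ∈ W, ‖Φ.coeff i k τ‖ ≤ A * M ^ k * k.factorial) {τ : H} (hτ : τ ∈ W)
    {x : ℂ} (hx : x ∈ Metric.ball (0 : ℂ) (1 / (2 * M))) :
    Φ.V τ (deriv (Φ.borelSeries i τ) x) - Φ.u i τ • deriv (Φ.borelSeries i τ) x =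
      x • deriv (Φ.borelSeries i τ) x + Φ.mu (Φ.borelSeries i τ x) := by
  have hd := tendsto_borelDerivPartial hM hA hb hτ hx
  have hd' := (tendsto_add_atTop_iff_nat 1).2 hd
  have h0 := (tendsto_add_atTop_iff_nat 1).2 (tendsto_borelPartial hM hA hb hτ hx)
  have h1 := (((Φ.V τ).continuous.tendsto _).comp hd').sub (hd'.const_smul (Φ.u i τ))
  have h2 := (hd.const_smul x).add ((Φ.mu.continuous.tendsto _).comp h0)
  refine tendsto_nhds_unique h1 (h2.congr fun N => ?_)
  exact (Φ.V_borelDerivPartial i N (hWS hτ) x).symm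

/-- Termwise this is `Φ.fderiv_coeff`; uniform convergence allows differentiation of the series
along complex lines in `τ`. -/
theorem fderiv_borelSeries [FiniteDimensional ℂ H] (hM : 0 < M) (hA : 0 < A) (hW : IsOpen W)
    (hWS : W ⊆ S)
    (hb : ∀ k, ∀ τ ∈ W, ‖Φ.coeff i k τ‖ ≤ A * M ^ k * k.factorial) {τ : H} (hτ : τ ∈ W)
    {x : ℂ} (hx : x ∈ Metric.ball (0 : ℂ) (1 / (2 * M))) (a : H) :
    fderiv ℂ (fun σ => Φ.borelSeries i σ x) τ a =
      fderiv ℂ (Φ.u i) τ a • deriv (Φ.borelSeries i τ) x -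
        Φ.C τ a (deriv (Φ.borelSeries i τ) x) := by
  have : CompleteSpace H := FiniteDimensional.complete ℂ H
  have hd := tendsto_borelDerivPartial hM hA hb hτ hx
  have h2 := (hd.const_smul (fderiv ℂ (Φ.u i) τ a)).sub (((Φ.C τ a).continuous.tendsto _).comp hd)
  have hopen : IsOpen {t : ℂ | τ + t • a ∈ W} := hW.preimage (by fun_prop)
  have h0mem : (0 : ℂ) ∈ {t : ℂ | τ + t • a ∈ W} := by simpa using hτ
  have h1 : TendstoLocallyUniformlyOn (fun N (t : ℂ) => Φ.borelPartial i N (τ + t • a) x)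
      (fun t => Φ.borelSeries i (τ + t • a) x) atTop {t : ℂ | τ + t • a ∈ W} :=
    (tendstoUniformlyOn_borelPartial hM hA hb).tendstoLocallyUniformlyOn.comp
      (fun t : ℂ => (τ + t • a, x)) (fun t ht => ⟨ht, hx⟩) (by fun_prop)
  have hline : ∀ t : ℂ, HasDerivAt (fun t : ℂ => τ + t • a) a t := fun t => by
    simpa using ((hasDerivAt_id t).smul_const a).const_add τ
  have hcd : ∀ k : ℕ, ∀ t ∈ {t : ℂ | τ + t • a ∈ W},
      HasDerivAt (fun t : ℂ => (x ^ k / k.factorial : ℂ) • Φ.coeff i k (τ + t • a))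
        ((x ^ k / k.factorial : ℂ) • fderiv ℂ (Φ.coeff i k) (τ + t • a) a) t := fun k t ht =>
    (((Φ.analytic_coeff i k _ (hWS ht)).differentiableAt.hasFDerivAt.comp_hasDerivAt t
      (hline t))).const_smul _
  have hsd : ∀ N, ∀ t ∈ {t : ℂ | τ + t • a ∈ W},
      HasDerivAt (fun t : ℂ => Φ.borelPartial i N (τ + t • a) x)
        (∑ k ∈ Finset.range N, (x ^ k / k.factorial : ℂ) •
          fderiv ℂ (Φ.coeff i k) (τ + t • a) a) t := fun N t ht =>
    HasDerivAt.fun_sum fun k _ => hcd k t ht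
  have h3 := (h1.deriv (Eventually.of_forall fun N t ht =>
    (hsd N t ht).differentiableAt.differentiableWithinAt) hopen).tendsto_at h0mem
  have h4 : deriv (fun t : ℂ => Φ.borelSeries i (τ + t • a) x) 0 =
      fderiv ℂ (fun σ => Φ.borelSeries i σ x) τ a := by
    have han : AnalyticAt ℂ (fun σ => Φ.borelSeries i σ x) τ :=
      (analyticOnNhd_borelSeries hM hA hW hWS hb (τ, x) ⟨hτ, hx⟩).fun_comp
        (f := fun σ : H => (σ, x)) (analyticAt_id.prod analyticAt_const)
    have h5 : HasFDerivAt (fun σ => Φ.borelSeries i σ x)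
        (fderiv ℂ (fun σ => Φ.borelSeries i σ x) τ) (τ + (0 : ℂ) • a) := by
      simpa using han.differentiableAt.hasFDerivAt
    exact (h5.comp_hasDerivAt (0 : ℂ) (hline 0)).deriv
  rw [← h4]
  refine tendsto_nhds_unique h3 (h2.congr fun N => ?_)
  simp only [Function.comp]
  rw [(hsd N 0 h0mem).deriv]
  simp only [zero_smul, add_zero, Φ.fderiv_coeff i _ (hWS hτ), borelDerivPartial, map_sum,
    map_smul, Finset.smul_sum]
  rw [← Finset.sum_sub_distrib]
  refine Finset.sum_congr rfl fun k _ => ?_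
  module

theorem norm_borelSeries_sub_le [CompleteSpace H] (hM : 0 < M) (hA : 0 < A)
    (hb : ∀ k, ∀ τ ∈ W, ‖Φ.coeff i k τ‖ ≤ A * M ^ k * k.factorial) (n : ℕ) {τ : H} (hτ : τ ∈ W)
    {x : ℂ} (hx : x ∈ Metric.ball (0 : ℂ) (1 / (2 * M))) :
    ‖Φ.borelSeries i τ x - Φ.borelPartial i n τ x‖ ≤ 2 * A * M ^ n * ‖x‖ ^ n := by
  rw [mem_ball_zero_iff] at hx
  have hs : Summable fun k : ℕ => (x ^ k / k.factorial : ℂ) • Φ.coeff i k τ :=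
    Summable.of_norm_bounded (summable_geometric_two.mul_left A) fun k =>
      norm_borelTerm_le_geometric hM hA hb k hτ hx
  rw [borelSeries, borelPartial, ← hs.sum_add_tsum_nat_add n, add_sub_cancel_left]
  have hx2 : M * ‖x‖ ≤ 1 / 2 := by
    rw [lt_div_iff₀ (by positivity)] at hx
    linarith
  have hg : HasSum (fun k : ℕ => A * (M * ‖x‖) ^ n * (1 / 2) ^ k) (A * (M * ‖x‖) ^ n * 2) :=
    hasSum_geometric_two.mul_left _
  refine (tsum_of_norm_bounded hg fun k => ?_).trans (le_of_eq (by ring))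
  refine (norm_borelTerm_le hM hA hb (k + n) hτ x).trans ?_
  rw [pow_add, mul_comm ((M * ‖x‖) ^ k), ← mul_assoc]
  gcongr

theorem norm_borelPartial_le (hM : 0 < M) (hA : 0 < A)
    (hb : ∀ k, ∀ τ ∈ W, ‖Φ.coeff i k τ‖ ≤ A * M ^ k * k.factorial) (n : ℕ) {τ : H} (hτ : τ ∈ W)
    (x : ℂ) : ‖Φ.borelPartial i n τ x‖ ≤ n * A * ((1 + M) * (1 + ‖x‖)) ^ n := by
  have h1 : 1 ≤ (1 + M) * (1 + ‖x‖) := by nlinarith [norm_nonneg x]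
  refine (norm_sum_le_of_le _ (n := fun _ => A * ((1 + M) * (1 + ‖x‖)) ^ n) fun k hk => ?_).trans
    (le_of_eq ?_)
  · refine (norm_borelTerm_le hM hA hb k hτ x).trans ?_
    gcongr
    calc (M * ‖x‖) ^ k ≤ ((1 + M) * (1 + ‖x‖)) ^ k := by gcongr <;> linarith
      _ ≤ _ := pow_le_pow_right₀ h1 (Finset.mem_range.1 hk).le
  · simp [mul_assoc]

end BorelSeries

end SemisimpleFrame

/-! ### Cones around the ray, and continuation of the Borel transform. -/

/-- The cone `|Im (e^{-iφ} x)| < m Re (e^{-iφ} x)` around the ray `ℝ_{>0} e^{iφ}`. -/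
def phaseCone (φ m : ℝ) : Set ℂ :=
  {x | |(exp (-(I * φ)) * x).im| < m * (exp (-(I * φ)) * x).re}

theorem norm_exp_neg_I_mul (φ : ℝ) : ‖exp (-(I * φ))‖ = 1 := by
  rw [show -(I * (φ : ℂ)) = ((-φ : ℝ) : ℂ) * I by push_cast; ring, norm_exp_ofReal_mul_I]

theorem norm_phase_mul (φ : ℝ) (x : ℂ) : ‖exp (-(I * φ)) * x‖ = ‖x‖ := by
  rw [norm_mul, norm_exp_neg_I_mul, one_mul]

theorem isOpen_phaseCone (φ m : ℝ) : IsOpen (phaseCone φ m) :=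
  isOpen_lt (by fun_prop) (by fun_prop)

theorem phaseCone_re_pos {φ m : ℝ} (hm : 0 < m) {x : ℂ} (hx : x ∈ phaseCone φ m) :
    0 < (exp (-(I * φ)) * x).re :=
  pos_of_mul_pos_right ((abs_nonneg _).trans_lt hx) hm.le

theorem norm_le_of_mem_phaseCone {φ m : ℝ} (hm : 0 < m) (hm1 : m ≤ 1) {x : ℂ}
    (hx : x ∈ phaseCone φ m) : ‖x‖ ≤ 2 * (exp (-(I * φ)) * x).re := by
  have h0 := phaseCone_re_pos hm hx
  rw [← norm_phase_mul φ]
  refine (norm_le_abs_re_add_abs_im _).trans ?_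
  rw [abs_of_pos h0]
  have : |(exp (-(I * φ)) * x).im| < m * (exp (-(I * φ)) * x).re := hx
  nlinarith

theorem convex_phaseCone (φ m : ℝ) : Convex ℝ (phaseCone φ m) := by
  intro x hx y hy a b ha hb hab
  have he : exp (-(I * φ)) * (a • x + b • y) =
      a * (exp (-(I * φ)) * x) + b * (exp (-(I * φ)) * y) := by
    simp only [real_smul]
    ring
  change |(exp (-(I * φ)) * x).im| < m * (exp (-(I * φ)) * x).re at hx
  change |(exp (-(I * φ)) * y).im| < m * (exp (-(I * φ)) * y).re at hy
  change |(exp (-(I * φ)) * (a • x + b • y)).im| < m * (exp (-(I * φ)) * (a • x + b • y)).re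
  rw [he, add_im, add_re, re_ofReal_mul, im_ofReal_mul, re_ofReal_mul, im_ofReal_mul]
  have h1 : |a * (exp (-(I * φ)) * x).im + b * (exp (-(I * φ)) * y).im| ≤
      a * |(exp (-(I * φ)) * x).im| + b * |(exp (-(I * φ)) * y).im| := by
    refine (abs_add_le _ _).trans (le_of_eq ?_)
    rw [abs_mul, abs_mul, abs_of_nonneg ha, abs_of_nonneg hb]
  rcases ha.eq_or_lt with rfl | ha'
  · have : b = 1 := by linarith
    subst this
    simpa using hy
  · have h2 := mul_lt_mul_of_pos_left hx ha'
    have h3 := mul_le_mul_of_nonneg_left hy.le hb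
    linarith

/-- A point off the positive real axis has positive distance, in the scale-invariant sense, from
thin cones around that axis. -/
theorem eventually_le_norm_sub_of_cone {a : ℂ} (ha : ¬ ∃ r : ℝ, 0 < r ∧ a = r) :
    ∀ᶠ m in 𝓝[>] (0 : ℝ), ∀ X : ℂ, |X.im| ≤ m * X.re → m * X.re ≤ ‖X - a‖ := by
  have hre : ∀ X : ℂ, |X.re - a.re| ≤ ‖X - a‖ := fun X => by
    simpa using abs_re_le_norm (X - a)
  have him : ∀ X : ℂ, |X.im - a.im| ≤ ‖X - a‖ := fun X => by
    simpa using abs_im_le_norm (X - a)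
  rcases le_or_gt a.re 0 with h0 | h0
  · filter_upwards [Ioo_mem_nhdsGT (zero_lt_one (α := ℝ))] with m hm X hX
    have hX0 : 0 ≤ X.re := by
      by_contra h
      have := (abs_nonneg _).trans hX
      nlinarith [hm.1]
    have h1 := hre X
    rw [abs_of_nonneg (by linarith)] at h1
    nlinarith [hm.2]
  · have hq : 0 < |a.im| := by
      rw [abs_pos]
      intro h
      exact ha ⟨a.re, h0, Complex.ext (by simp) (by simp [h])⟩
    have hpos : 0 < min (1 / 2) (|a.im| / (4 * a.re)) := by positivity
    filter_upwards [Ioo_mem_nhdsGT hpos] with m hm X hX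
    have hm1 : m < 1 / 2 := hm.2.trans_le (min_le_left _ _)
    have hm2 : m < |a.im| / (4 * a.re) := hm.2.trans_le (min_le_right _ _)
    rw [lt_div_iff₀ (by positivity)] at hm2
    have hX0 : 0 ≤ X.re := by
      by_contra h
      have := (abs_nonneg _).trans hX
      nlinarith [hm.1]
    have h1 := (le_abs_self _).trans (hre X)
    have h2 : |a.im| - |X.im| ≤ ‖X - a‖ := by
      have := (abs_sub_abs_le_abs_sub a.im X.im)
      rw [abs_sub_comm] at this
      exact this.trans (him X)
    -- For small `Re X` the imaginary part of `a` dominates, since `|Im X| ≤ 2 m Re a < |Im a| / 2`;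
    -- for large `Re X` the real parts differ by more than `Re X / 2`.
    rcases le_or_gt X.re (2 * a.re) with h | h
    · nlinarith [hm.1]
    · nlinarith [hm.1]

namespace SemisimpleFrame

variable {ι H : Type*} [Fintype ι] [DecidableEq ι] [NormedAddCommGroup H] [NormedSpace ℂ H]
  {S : Set H} (Φ : SemisimpleFrame ι H S)

/-- `y` is the analytic continuation of the Borel transform of `∑ rₖ zᵏ` to a cone around
`ℝ_{>0} e^{iφ}`, and grows polynomially there. -/
structure IsBorelTransform (i : ι) (U : Set H) (φ m : ℝ) (y : H → ℂ → H) : Prop where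
  analytic : AnalyticOnNhd ℂ (fun p : H × ℂ => y p.1 p.2) (U ×ˢ phaseCone φ m)
  euler : ∀ τ ∈ U, ∀ x ∈ phaseCone φ m, x • deriv (y τ) x + Φ.u i τ • deriv (y τ) x -
    Φ.V τ (deriv (y τ) x) = -Φ.mu (y τ x)
  fderiv_eq : ∀ τ ∈ U, ∀ x ∈ phaseCone φ m, ∀ a, fderiv ℂ (fun σ => y σ x) τ a =
    fderiv ℂ (Φ.u i) τ a • deriv (y τ) x - Φ.C τ a (deriv (y τ) x)
  deriv_bound : ∃ (c : ℝ) (q : ℕ), 0 ≤ c ∧ ∀ τ ∈ U, ∀ x ∈ phaseCone φ m,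
    ‖deriv (y τ) x‖ ≤ c * (1 + ‖x‖) ^ q
  remainder : ∀ n, ∃ (c : ℝ) (q : ℕ), 0 ≤ c ∧ ∀ τ ∈ U, ∀ x ∈ phaseCone φ m,
    ‖y τ x - Φ.borelPartial i n τ x‖ ≤ c * ‖x‖ ^ n * (1 + ‖x‖) ^ q

/-- The operator `v ↦ (μ v, Ψⱼ) Ψⱼ`. -/
noncomputable def muProj (j : ι) (τ : H) : H →L[ℂ] H :=
  ContinuousLinearMap.smulRightL ℂ H H
    ((ContinuousLinearMap.compL ℂ H H ℂ).flip Φ.mu (Φ.Q.flip (Φ.Ψ j τ))) (Φ.Ψ j τ)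

theorem muProj_apply (j : ι) (τ v : H) :
    Φ.muProj j τ v = Φ.Q (Φ.mu v) (Φ.Ψ j τ) • Φ.Ψ j τ := rfl

theorem analytic_muProj (j : ι) : AnalyticOnNhd ℂ (Φ.muProj j) S := by
  intro τ hτ
  have h1 := Φ.analytic_Ψ j τ hτ
  refine analyticAt_clm_apply ?_ h1
  refine (ContinuousLinearMap.analyticAt _ _).fun_comp ?_
  refine (ContinuousLinearMap.analyticAt _ _).fun_comp ?_
  exact (ContinuousLinearMap.analyticAt _ _).fun_comp h1

/-- The operator `-(x + uᵢ - V)⁻¹ μ`. -/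
noncomputable def borelOp (i : ι) (τ : H) (x : ℂ) : H →L[ℂ] H :=
  ∑ j, (-(x + Φ.u i τ - Φ.u j τ)⁻¹) • Φ.muProj j τ

theorem borelOp_apply (i : ι) (τ : H) (x : ℂ) (v : H) : Φ.borelOp i τ x v =
    ∑ j, (-(x + Φ.u i τ - Φ.u j τ)⁻¹ * Φ.Q (Φ.mu v) (Φ.Ψ j τ)) • Φ.Ψ j τ := by
  simp [borelOp, smul_apply, muProj_apply, smul_smul]

theorem analyticAt_borelOp (i : ι) {τ : H} (hτ : τ ∈ S) {x : ℂ}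
    (hx : ∀ j, x + Φ.u i τ - Φ.u j τ ≠ 0) :
    AnalyticAt ℂ (fun p : H × ℂ => Φ.borelOp i p.1 p.2) (τ, x) := by
  refine Finset.analyticAt_fun_sum _ fun j _ => AnalyticAt.fun_smul (AnalyticAt.fun_neg ?_) ?_
  · refine AnalyticAt.fun_inv ?_ (hx j)
    exact (analyticAt_snd.add ((Φ.analytic_u i τ hτ).fun_comp (f := Prod.fst) (x := (τ, x))
      analyticAt_fst)).sub ((Φ.analytic_u j τ hτ).fun_comp (f := Prod.fst) (x := (τ, x))
      analyticAt_fst)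
  · exact (Φ.analytic_muProj j τ hτ).fun_comp (f := Prod.fst) (x := (τ, x)) analyticAt_fst

theorem euler_borelOp (i : ι) {τ : H} (hτ : τ ∈ S) {x : ℂ}
    (hx : ∀ j, x + Φ.u i τ - Φ.u j τ ≠ 0) (v : H) :
    x • Φ.borelOp i τ x v + Φ.u i τ • Φ.borelOp i τ x v - Φ.V τ (Φ.borelOp i τ x v) =
      -Φ.mu v := by
  refine Φ.ext_Q hτ fun j => ?_
  have h1 : Φ.Q (Φ.borelOp i τ x v) (Φ.Ψ j τ) =
      -(x + Φ.u i τ - Φ.u j τ)⁻¹ * Φ.Q (Φ.mu v) (Φ.Ψ j τ) := by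
    rw [borelOp_apply, Φ.Q_sum_smul hτ
      (fun j => -(x + Φ.u i τ - Φ.u j τ)⁻¹ * Φ.Q (Φ.mu v) (Φ.Ψ j τ)), if_pos (Finset.mem_univ _)]
  simp only [map_sub, map_add, map_neg, map_smul, sub_apply, add_apply, smul_apply, neg_apply,
    Φ.Q_V hτ, smul_eq_mul, h1]
  field_simp [hx j]
  have := hx j
  field_simp
  ring

theorem eq_borelOp_of_euler (i : ι) {τ : H} (hτ : τ ∈ S) {x : ℂ}
    (hx : ∀ j, x + Φ.u i τ - Φ.u j τ ≠ 0) {v w : H}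
    (h : x • w + Φ.u i τ • w - Φ.V τ w = -Φ.mu v) : w = Φ.borelOp i τ x v := by
  refine Φ.ext_Q hτ fun j => ?_
  rw [borelOp_apply, Φ.Q_sum_smul hτ
    (fun j => -(x + Φ.u i τ - Φ.u j τ)⁻¹ * Φ.Q (Φ.mu v) (Φ.Ψ j τ)), if_pos (Finset.mem_univ _)]
  have h1 := congrArg (fun y => Φ.Q y (Φ.Ψ j τ)) h
  simp only [map_sub, map_add, map_neg, map_smul, sub_apply, add_apply, smul_apply, neg_apply,
    Φ.Q_V hτ, smul_eq_mul] at h1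
  have := hx j
  field_simp
  linear_combination h1

theorem norm_borelOp_le (i : ι) {τ : H} {x : ℂ} {K d : ℝ} (hd : 0 < d)
    (hK : ∀ j, ‖Φ.muProj j τ‖ ≤ K) (hx : ∀ j, d ≤ ‖x + Φ.u i τ - Φ.u j τ‖) :
    ‖Φ.borelOp i τ x‖ ≤ Fintype.card ι * K / d := by
  refine (norm_sum_le_of_le _ (n := fun _ => d⁻¹ * K) fun j _ => ?_).trans (le_of_eq ?_)
  · rw [norm_smul, norm_neg, norm_inv]
    have := hx j
    have := hK j
    gcongr
  · simp only [Finset.sum_const, Finset.card_univ, nsmul_eq_mul]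
    field_simp

end SemisimpleFrame

namespace SemisimpleFrame

variable {ι H : Type*} [Fintype ι] [DecidableEq ι] [NormedAddCommGroup H] [NormedSpace ℂ H]
  {S : Set H} (Φ : SemisimpleFrame ι H S)

/-- Near `τ₀`, the eigenvalues `uⱼ - uᵢ` keep away from the truncated cone. -/
theorem exists_cone_separation (i : ι) {τ₀ : H} (hτ₀ : τ₀ ∈ S) {φ : ℝ}
    (hφ : ∀ j, ¬ ∃ r : ℝ, 0 < r ∧ exp (-(I * φ)) * (Φ.u j τ₀ - Φ.u i τ₀) = r) {ρ : ℝ}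
    (hρ : 0 < ρ) :
    ∃ m : ℝ, 0 < m ∧ m ≤ 1 ∧ ∃ c : ℝ, 0 < c ∧ ∀ᶠ τ in 𝓝 τ₀, ∀ j, ∀ x ∈ phaseCone φ m,
      ρ / 4 < (exp (-(I * φ)) * x).re →
        c * (1 + ‖x - (ρ / 2 : ℝ) * exp (I * φ)‖) ≤ ‖x + Φ.u i τ - Φ.u j τ‖ := by
  obtain ⟨m, hm, hm0, hm1⟩ := ((eventually_all.2 fun j =>
    eventually_le_norm_sub_of_cone (hφ j)).and (Ioo_mem_nhdsGT (zero_lt_one (α := ℝ)))).exists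
  -- At `τ₀` the distance is at least `m Re X`, which exceeds `m ρ / 4` on the truncated cone. A
  -- perturbation below `m ρ / 8` costs at most half of it. Eigenvalues that coincide at `τ₀` are
  -- included, as `0` is not on the open ray.
  have hev : ∀ᶠ τ in 𝓝 τ₀, ∀ j,
      ‖(Φ.u j τ - Φ.u i τ) - (Φ.u j τ₀ - Φ.u i τ₀)‖ < m * (ρ / 8) := by
    refine eventually_all.2 fun j => ?_
    have hc : ContinuousAt (fun τ => ‖(Φ.u j τ - Φ.u i τ) - (Φ.u j τ₀ - Φ.u i τ₀)‖) τ₀ :=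
      (((Φ.analytic_u j τ₀ hτ₀).continuousAt.sub (Φ.analytic_u i τ₀ hτ₀).continuousAt).sub
        continuousAt_const).norm
    exact hc.eventually_lt_const (by simpa using by positivity)
  -- The distance is at least `(m / 2) Re X`, while `1 + ‖x - x₀‖ ≤ (4 / ρ + 4) Re X` as soon as `Re
  -- X > ρ / 4`.
  refine ⟨m, hm0, hm1.le, m / 2 / (4 / ρ + 4), by positivity, ?_⟩
  filter_upwards [hev] with τ hτ j x hx hxρ
  set X := exp (-(I * φ)) * x with hX
  have h1 := hm j X (le_of_lt hx)
  have h2 : ‖x + Φ.u i τ - Φ.u j τ‖ = ‖X - exp (-(I * φ)) * (Φ.u j τ - Φ.u i τ)‖ := by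
    rw [hX, ← mul_sub, norm_phase_mul]
    congr 1
    ring
  have h3 : ‖exp (-(I * φ)) * (Φ.u j τ - Φ.u i τ) - exp (-(I * φ)) * (Φ.u j τ₀ - Φ.u i τ₀)‖ <
      m * (ρ / 8) := by
    rw [← mul_sub, norm_phase_mul]
    exact hτ j
  have h4 : m / 2 * X.re ≤ ‖x + Φ.u i τ - Φ.u j τ‖ := by
    rw [h2]
    have h5 := norm_sub_le_norm_sub_add_norm_sub X (exp (-(I * φ)) * (Φ.u j τ - Φ.u i τ))
      (exp (-(I * φ)) * (Φ.u j τ₀ - Φ.u i τ₀))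
    nlinarith
  refine le_trans ?_ h4
  have h6 : ‖x - (ρ / 2 : ℝ) * exp (I * φ)‖ ≤ 2 * X.re + ρ / 2 := by
    refine (norm_sub_le _ _).trans (add_le_add (norm_le_of_mem_phaseCone hm0 hm1.le hx) ?_)
    rw [norm_mul, norm_real, mul_comm I, norm_exp_ofReal_mul_I, mul_one,
      Real.norm_of_nonneg (by positivity)]
  have h7 : 1 + ‖x - (ρ / 2 : ℝ) * exp (I * φ)‖ ≤ (4 / ρ + 4) * X.re := by
    have : 1 ≤ 4 / ρ * X.re := by
      rw [div_mul_eq_mul_div, le_div_iff₀ hρ]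
      linarith
    linarith
  calc m / 2 / (4 / ρ + 4) * (1 + ‖x - (ρ / 2 : ℝ) * exp (I * φ)‖)
      ≤ m / 2 / (4 / ρ + 4) * ((4 / ρ + 4) * X.re) := by gcongr
    _ = m / 2 * X.re := by field_simp

/-- On the disc of radius `ρ` the Borel series converges. On the truncated cone `Ω` the equation `y'
= borelOp y` has no singularity and a coefficient of order `1 / |x|`, so its solution starting from
the series at `x₀` exists with polynomial growth. Both agree on the overlap by uniqueness, and the
cone is the union of the two regions' traces. -/
theorem exists_isBorelTransform [FiniteDimensional ℂ H] (i : ι) {τ₀ : H} (hτ₀ : τ₀ ∈ S) {φ : ℝ}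
    (hφ : ∀ j, ¬ ∃ r : ℝ, 0 < r ∧ exp (-(I * φ)) * (Φ.u j τ₀ - Φ.u i τ₀) = r) :
    ∃ R > 0, Metric.ball τ₀ R ⊆ S ∧ ∃ m > 0, ∃ y,
      Φ.IsBorelTransform i (Metric.ball τ₀ R) φ m y := by
  have : CompleteSpace H := FiniteDimensional.complete ℂ H
  obtain ⟨R₁, hR₁, hS₁, A, hA, M, hM, hb⟩ := Φ.exists_norm_coeff_le i hτ₀
  set ρ : ℝ := 1 / (2 * M) with hρdef
  have hρ : 0 < ρ := by positivity
  obtain ⟨m, hm0, hm1, c, hc, hsep⟩ := Φ.exists_cone_separation i hτ₀ hφ hρ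
  have hP : ∀ᶠ τ in 𝓝 τ₀, ∀ j, ‖Φ.muProj j τ‖ < 1 + ∑ k, ‖Φ.muProj k τ₀‖ := by
    refine eventually_all.2 fun j => ?_
    refine (Φ.analytic_muProj j τ₀ hτ₀).continuousAt.norm.eventually_lt_const ?_
    have := Finset.single_le_sum (f := fun k => ‖Φ.muProj k τ₀‖) (fun k _ => norm_nonneg _)
      (Finset.mem_univ j)
    linarith
  set K : ℝ := 1 + ∑ k, ‖Φ.muProj k τ₀‖ with hK
  have hK0 : 0 < K := by positivity
  obtain ⟨R, hR, hball⟩ := Metric.eventually_nhds_iff_ball.1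
    ((Metric.isOpen_ball.eventually_mem (Metric.mem_ball_self hR₁)).and (hsep.and hP))
  set U := Metric.ball τ₀ R with hUdef
  have hU : IsOpen U := Metric.isOpen_ball
  have hUW : U ⊆ Metric.ball τ₀ R₁ := fun τ hτ => (hball τ hτ).1
  have hUS : U ⊆ S := hUW.trans hS₁
  have hbU : ∀ k, ∀ τ ∈ U, ‖Φ.coeff i k τ‖ ≤ A * M ^ k * k.factorial :=
    fun k τ hτ => hb k τ (hUW hτ)
  -- A point of the ray that lies both in the disc of convergence and in `Ω`.
  set x₀ : ℂ := (ρ / 2 : ℝ) * exp (I * φ) with hx₀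
  have hX₀ : exp (-(I * φ)) * x₀ = (ρ / 2 : ℝ) := by
    rw [hx₀, mul_left_comm, ← exp_add, neg_add_cancel, exp_zero, mul_one]
  set Ω : Set ℂ := {x | ρ / 4 < (exp (-(I * φ)) * x).re} ∩ phaseCone φ m with hΩdef
  have hΩ : IsOpen Ω := (isOpen_lt (by fun_prop) (by fun_prop)).inter (isOpen_phaseCone φ m)
  have hΩc : Convex ℝ Ω := by
    refine Convex.inter ?_ (convex_phaseCone φ m)
    have hlin : IsLinearMap ℝ fun x : ℂ => (exp (-(I * φ)) * x).re :=
      ⟨fun x y => by rw [mul_add, add_re], fun a x => by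
        rw [real_smul, mul_left_comm, re_ofReal_mul, smul_eq_mul]⟩
    exact convex_halfSpace_gt hlin _
  have hx₀Ω : x₀ ∈ Ω := by
    constructor
    · change ρ / 4 < (exp (-(I * φ)) * x₀).re
      rw [hX₀, ofReal_re]
      linarith
    · change |(exp (-(I * φ)) * x₀).im| < m * (exp (-(I * φ)) * x₀).re
      rw [hX₀, ofReal_re, ofReal_im, abs_zero]
      positivity
  have hx₀b : x₀ ∈ Metric.ball (0 : ℂ) ρ := by
    rw [mem_ball_zero_iff, ← norm_phase_mul φ, hX₀, norm_real, Real.norm_of_nonneg (by positivity)]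
    linarith
  -- As `m ≤ 1`, the part of the cone below `Ω` has norm at most `ρ / 2`, well inside the disc.
  have hcone : ∀ x ∈ phaseCone φ m, x ∈ Ω ∨ ‖x‖ ≤ ρ / 2 := by
    intro x hx
    rcases lt_or_ge (ρ / 4) (exp (-(I * φ)) * x).re with h | h
    · exact Or.inl ⟨h, hx⟩
    · have := norm_le_of_mem_phaseCone hm0 hm1 hx
      exact Or.inr (by linarith)
  have hsep' : ∀ τ ∈ U, ∀ x ∈ Ω, ∀ j, c * (1 + ‖x - x₀‖) ≤ ‖x + Φ.u i τ - Φ.u j τ‖ :=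
    fun τ hτ x hx j => (hball τ hτ).2.1 j x hx.2 hx.1
  have hne : ∀ τ ∈ U, ∀ x ∈ Ω, ∀ j, x + Φ.u i τ - Φ.u j τ ≠ 0 := fun τ hτ x hx j =>
    norm_pos_iff.1 (lt_of_lt_of_le (by positivity) (hsep' τ hτ x hx j))
  -- The constant is rounded up because it becomes the exponent of the polynomial growth.
  have hopb : ∀ τ ∈ U, ∀ x ∈ Ω, ‖Φ.borelOp i τ x‖ ≤
      (⌈Fintype.card ι * K / c⌉₊ : ℕ) / (1 + ‖x - x₀‖) := by
    intro τ hτ x hx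
    refine (Φ.norm_borelOp_le i (by positivity) (fun j => ((hball τ hτ).2.2 j).le)
      (hsep' τ hτ x hx)).trans ?_
    rw [← div_div]
    gcongr
    exact Nat.le_ceil _
  set q : ℕ := ⌈Fintype.card ι * K / c⌉₊ with hq
  have hopan : AnalyticOnNhd ℂ (fun p : H × ℂ => Φ.borelOp i p.1 p.2) (U ×ˢ Ω) :=
    fun p hp => Φ.analyticAt_borelOp i (hUS hp.1) (hne p.1 hp.1 p.2 hp.2)
  have hser := analyticOnNhd_borelSeries hM hA hU hUS hbU
  rw [← hρdef] at hser
  have hserτ : AnalyticOnNhd ℂ (fun τ => Φ.borelSeries i τ x₀) U := fun τ hτ =>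
    (hser (τ, x₀) ⟨hτ, hx₀b⟩).fun_comp (f := fun τ : H => (τ, x₀))
      (analyticAt_id.prod analyticAt_const)
  have hserx : ∀ τ ∈ U, AnalyticOnNhd ℂ (Φ.borelSeries i τ) (Metric.ball 0 ρ) :=
    fun τ hτ x hx => (hser (τ, x) ⟨hτ, hx⟩).fun_comp (f := fun x : ℂ => (τ, x))
      (analyticAt_const.prod analyticAt_id)
  obtain ⟨f, hfan, hf0, hfd, hfb⟩ := exists_analyticOnNhd_hasDerivAt hU hΩ
    (hΩc.starConvex hx₀Ω) hopan hserτ hopb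
  have hagree : ∀ τ ∈ U, Set.EqOn (Φ.borelSeries i τ) (f τ) (Ω ∩ Metric.ball 0 ρ) := by
    intro τ hτ
    refine eqOn_of_hasDerivAt_linear (x₀ := x₀)
      ((hΩc.inter (convex_ball 0 ρ)).starConvex ⟨hx₀Ω, hx₀b⟩) (B := fun x => Φ.borelOp i τ x)
      ?_ ?_ (fun x hx => hfd τ hτ x hx.1) (hf0 τ hτ).symm
    · intro x hx
      exact ((hopan (τ, x) ⟨hτ, hx.1⟩).fun_comp (f := fun x : ℂ => (τ, x))
        (analyticAt_const.prod analyticAt_id)).continuousAt.continuousWithinAt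
    · intro x hx
      refine (hserx τ hτ x hx.2).differentiableAt.hasDerivAt.congr_deriv ?_
      refine Φ.eq_borelOp_of_euler i (hUS hτ) (hne τ hτ x hx.1) ?_
      have := V_deriv_borelSeries hM hA hUS hbU hτ hx.2
      linear_combination (norm := module) -this
  classical
  set y : H → ℂ → H := fun τ x => if ‖x‖ < ρ then Φ.borelSeries i τ x else f τ x with hy
  have hyb : ∀ τ, ∀ x ∈ Metric.ball (0 : ℂ) ρ, y τ x = Φ.borelSeries i τ x := fun τ x hx => by
    rw [hy]
    exact if_pos (mem_ball_zero_iff.1 hx)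
  have hyΩ : ∀ τ ∈ U, ∀ x ∈ Ω, y τ x = f τ x := fun τ hτ x hx => by
    by_cases h : ‖x‖ < ρ
    · rw [hyb τ x (mem_ball_zero_iff.2 h)]
      exact hagree τ hτ ⟨hx, mem_ball_zero_iff.2 h⟩
    · rw [hy]
      exact if_neg h
  have hyb1 : ∀ τ, ∀ x ∈ Metric.ball (0 : ℂ) ρ, y τ =ᶠ[𝓝 x] Φ.borelSeries i τ := fun τ x hx =>
    eventually_of_mem (Metric.isOpen_ball.mem_nhds hx) fun x' hx' => hyb τ x' hx'
  have hyΩ1 : ∀ τ ∈ U, ∀ x ∈ Ω, y τ =ᶠ[𝓝 x] f τ := fun τ hτ x hx =>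
    eventually_of_mem (hΩ.mem_nhds hx) fun x' hx' => hyΩ τ hτ x' hx'
  have hyΩ2 : ∀ τ ∈ U, ∀ x ∈ Ω, (fun σ => y σ x) =ᶠ[𝓝 τ] fun σ => f σ x := fun τ hτ x hx =>
    eventually_of_mem (hU.mem_nhds hτ) fun σ hσ => hyΩ σ hσ x hx
  -- The identity holds near `x₀`, where `f` is the Borel series; both sides are analytic in `x`, so
  -- it holds on the convex set `Ω`.
  have hfderiv : ∀ τ ∈ U, ∀ a, ∀ x ∈ Ω, fderiv ℂ (fun σ => f σ x) τ a =
      fderiv ℂ (Φ.u i) τ a • deriv (f τ) x - Φ.C τ a (deriv (f τ) x) := by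
    intro τ hτ a
    have hfx : AnalyticOnNhd ℂ (f τ) Ω := fun x hx =>
      (hfan (τ, x) ⟨hτ, hx⟩).fun_comp (f := fun x : ℂ => (τ, x))
        (analyticAt_const.prod analyticAt_id)
    have hL : ∀ x ∈ Ω, fderiv ℂ (fun σ => f σ x) τ a =
        fderiv ℂ (fun p : H × ℂ => f p.1 p.2) (τ, x) (a, 0) := by
      intro x hx
      have h1 := (hfan (τ, x) ⟨hτ, hx⟩).differentiableAt.hasFDerivAt
      have h2 : HasFDerivAt (fun σ : H => (σ, x)) (ContinuousLinearMap.inl ℂ H ℂ) τ :=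
        hasFDerivAt_prodMk_left τ x
      rw [show (fun σ => f σ x) = (fun p : H × ℂ => f p.1 p.2) ∘ fun σ : H => (σ, x) from rfl,
        (h1.comp τ h2).fderiv]
      rfl
    intro x hx
    rw [hL x hx]
    refine AnalyticOnNhd.eqOn_of_preconnected_of_eventuallyEq (𝕜 := ℂ)
      (f := fun x => fderiv ℂ (fun p : H × ℂ => f p.1 p.2) (τ, x) (a, 0))
      (g := fun x => fderiv ℂ (Φ.u i) τ a • deriv (f τ) x - Φ.C τ a (deriv (f τ) x))
      (z₀ := x₀) (U := Ω) ?_ ?_ hΩc.isPreconnected hx₀Ω ?_ hx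
    · intro x hx
      refine analyticAt_clm_apply ?_ analyticAt_const
      exact (hfan.fderiv (τ, x) ⟨hτ, hx⟩).fun_comp (f := fun x : ℂ => (τ, x))
        (analyticAt_const.prod analyticAt_id)
    · intro x hx
      have hd := hfx.deriv x hx
      exact (analyticAt_const.fun_smul hd).fun_sub
        ((ContinuousLinearMap.analyticAt _ _).fun_comp hd)
    · filter_upwards [hΩ.mem_nhds hx₀Ω, Metric.isOpen_ball.mem_nhds hx₀b] with x hx hxb
      rw [← hL x hx]
      have h1 : (fun σ => f σ x) =ᶠ[𝓝 τ] fun σ => Φ.borelSeries i σ x :=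
        eventually_of_mem (hU.mem_nhds hτ) fun σ hσ => (hagree σ hσ ⟨hx, hxb⟩).symm
      have h2 : f τ =ᶠ[𝓝 x] Φ.borelSeries i τ :=
        eventually_of_mem ((hΩ.inter Metric.isOpen_ball).mem_nhds ⟨hx, hxb⟩)
          fun x' hx' => (hagree τ hτ hx').symm
      rw [h1.fderiv_eq, h2.deriv_eq]
      exact fderiv_borelSeries hM hA hU hUS hbU hτ hxb a
  have hsubball : ∀ x : ℂ, ‖x‖ ≤ ρ / 2 → x ∈ Metric.ball (0 : ℂ) ρ := fun x hx => by
    rw [mem_ball_zero_iff]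
    linarith
  have hserb : ∀ τ ∈ U, ∀ x ∈ Metric.ball (0 : ℂ) ρ, ‖Φ.borelSeries i τ x‖ ≤ 2 * A := by
    intro τ hτ x hx
    simpa [borelPartial] using norm_borelSeries_sub_le hM hA hbU 0 hτ hx
  have hfbound : ∀ τ ∈ U, ∀ x ∈ Ω, ‖f τ x‖ ≤ 2 * A * (1 + ρ) ^ q * (1 + ‖x‖) ^ q := by
    intro τ hτ x hx
    refine (hfb τ hτ x hx).trans ?_
    rw [mul_assoc, ← mul_pow]
    have h1 := hserb τ hτ x₀ hx₀b
    have h2 : 1 + ‖x - x₀‖ ≤ (1 + ρ) * (1 + ‖x‖) := by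
      have := norm_sub_le x x₀
      rw [mem_ball_zero_iff] at hx₀b
      nlinarith [norm_nonneg x]
    gcongr
  refine ⟨R, hR, hUS, m, hm0, y, ?_, ?_, ?_, ?_, ?_⟩
  · rintro ⟨τ, x⟩ ⟨hτ, hx⟩
    rcases hcone x hx with h | h
    · refine (hfan (τ, x) ⟨hτ, h⟩).congr ?_
      filter_upwards [(hU.prod hΩ).mem_nhds (show (τ, x) ∈ U ×ˢ Ω from ⟨hτ, h⟩)] with p hp
      exact (hyΩ p.1 hp.1 p.2 hp.2).symm
    · refine (hser (τ, x) ⟨hτ, hsubball x h⟩).congr ?_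
      filter_upwards [(hU.prod Metric.isOpen_ball).mem_nhds
        (show (τ, x) ∈ U ×ˢ Metric.ball 0 ρ from ⟨hτ, hsubball x h⟩)] with p hp
      exact (hyb p.1 p.2 hp.2).symm
  · intro τ hτ x hx
    rcases hcone x hx with h | h
    · rw [(hyΩ1 τ hτ x h).deriv_eq, hyΩ τ hτ x h, (hfd τ hτ x h).deriv]
      exact Φ.euler_borelOp i (hUS hτ) (hne τ hτ x h) _
    · rw [(hyb1 τ x (hsubball x h)).deriv_eq, hyb τ x (hsubball x h)]
      have := V_deriv_borelSeries hM hA hUS hbU hτ (hsubball x h)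
      linear_combination (norm := module) -this
  · intro τ hτ x hx a
    rcases hcone x hx with h | h
    · rw [(hyΩ1 τ hτ x h).deriv_eq, (hyΩ2 τ hτ x h).fderiv_eq]
      exact hfderiv τ hτ a x h
    · rw [(hyb1 τ x (hsubball x h)).deriv_eq,
        show (fun σ => y σ x) = fun σ => Φ.borelSeries i σ x from
          funext fun σ => hyb σ x (hsubball x h)]
      exact fderiv_borelSeries hM hA hU hUS hbU hτ (hsubball x h) a
  · refine ⟨2 * A * (1 + ρ) ^ q * q + 2 / (ρ / 2) * (2 * A), q, by positivity,
      fun τ hτ x hx => ?_⟩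
    have h1x : 1 ≤ 1 + ‖x‖ := by linarith [norm_nonneg x]
    have hpow : 1 ≤ (1 + ‖x‖) ^ q := one_le_pow₀ h1x
    rw [add_mul]
    rcases hcone x hx with h | h
    · rw [(hyΩ1 τ hτ x h).deriv_eq, (hfd τ hτ x h).deriv]
      refine (ContinuousLinearMap.le_opNorm _ _).trans ?_
      have h2 : ‖Φ.borelOp i τ x‖ ≤ q := (hopb τ hτ x h).trans
        (div_le_self q.cast_nonneg (by linarith [norm_nonneg (x - x₀)]))
      have h3 : 0 ≤ 2 / (ρ / 2) * (2 * A) * (1 + ‖x‖) ^ q := by positivity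
      calc _ ≤ q * (2 * A * (1 + ρ) ^ q * (1 + ‖x‖) ^ q) := by
            gcongr
            exact hfbound τ hτ x h
        _ ≤ _ := by linarith
    · rw [(hyb1 τ x (hsubball x h)).deriv_eq]
      have hsub : Metric.ball x (ρ / 2) ⊆ Metric.ball 0 ρ := by
        refine Metric.ball_subset_ball' ?_
        rw [dist_zero_right]
        linarith
      have h2 := norm_fderiv_apply_le_of_norm_le (half_pos hρ)
        ((hserx τ hτ).mono hsub).differentiableOn (fun x' hx' => hserb τ hτ x' (hsub hx')) 1
      rw [fderiv_apply_one_eq_deriv, norm_one, mul_one] at h2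
      refine h2.trans ?_
      have h3 : 0 ≤ 2 * A * (1 + ρ) ^ q * q * (1 + ‖x‖) ^ q := by positivity
      have h4 : 0 ≤ 2 / (ρ / 2) * (2 * A) := by positivity
      nlinarith
  · intro n
    -- In the disc the remainder is a tail of the series. On `Ω` one has `4 ‖x‖ / ρ ≥ 1`, so a bound
    -- by `c₁ (1 + ‖x‖) ^ (q + n)` may be multiplied by `(4 ‖x‖ / ρ) ^ n`.
    set c₁ : ℝ := 2 * A * (1 + ρ) ^ q + n * A * (1 + M) ^ n with hc₁
    refine ⟨2 * A * M ^ n + c₁ * (4 / ρ) ^ n, q + n, by positivity, fun τ hτ x hx => ?_⟩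
    have h1x : 1 ≤ 1 + ‖x‖ := by linarith [norm_nonneg x]
    rw [add_mul, add_mul]
    rcases hcone x hx with h | h
    · rw [hyΩ τ hτ x h]
      have hx4 : 1 ≤ 4 / ρ * ‖x‖ := by
        have h5 : (exp (-(I * φ)) * x).re ≤ ‖x‖ :=
          ((le_abs_self _).trans (abs_re_le_norm _)).trans (norm_phase_mul φ x).le
        have h6 : ρ / 4 < (exp (-(I * φ)) * x).re := h.1
        rw [div_mul_eq_mul_div, le_div_iff₀ hρ]
        linarith
      have h2 : ‖f τ x - Φ.borelPartial i n τ x‖ ≤ c₁ * (1 + ‖x‖) ^ (q + n) := by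
        refine (norm_sub_le _ _).trans ?_
        rw [hc₁, add_mul]
        refine add_le_add ((hfbound τ hτ x h).trans ?_)
          ((norm_borelPartial_le hM hA hbU n hτ x).trans ?_)
        · gcongr
          omega
        · rw [mul_pow, ← mul_assoc]
          gcongr
          omega
      have h3 : 1 ≤ (4 / ρ) ^ n * ‖x‖ ^ n := by
        rw [← mul_pow]
        exact one_le_pow₀ hx4
      have h4 : 0 ≤ 2 * A * M ^ n * ‖x‖ ^ n * (1 + ‖x‖) ^ (q + n) := by positivity
      have h5 : 0 ≤ c₁ * (1 + ‖x‖) ^ (q + n) := by positivity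
      calc _ ≤ _ := h2
        _ ≤ c₁ * (1 + ‖x‖) ^ (q + n) * ((4 / ρ) ^ n * ‖x‖ ^ n) := le_mul_of_one_le_right h5 h3
        _ = c₁ * (4 / ρ) ^ n * ‖x‖ ^ n * (1 + ‖x‖) ^ (q + n) := by ring
        _ ≤ _ := by linarith
    · rw [hyb τ x (hsubball x h)]
      refine (norm_borelSeries_sub_le hM hA hbU n hτ (hsubball x h)).trans ?_
      have h3 : 0 ≤ c₁ * (4 / ρ) ^ n * ‖x‖ ^ n * (1 + ‖x‖) ^ (q + n) := by positivity
      have h4 : 0 ≤ 2 * A * M ^ n * ‖x‖ ^ n := by positivity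
      have h5 := le_mul_of_one_le_right h4 (one_le_pow₀ (n := q + n) h1x)
      linarith

end SemisimpleFrame

/-! ### Laplace integrals along rays, and their independence of the ray. -/

section Laplace

theorem isBigO_pow_mul_exp_neg (k q : ℕ) (b : ℝ) {c : ℝ} (hc : 0 < c) :
    (fun t : ℝ => t ^ k * (1 + b * t) ^ q * Real.exp (-(c * t))) =O[atTop]
      fun t => Real.exp (-(c / 2) * t) := by
  have h1 : (fun t : ℝ => 1 + b * t) =O[atTop] fun t => t := by
    refine IsBigO.add ?_ (isBigO_const_mul_self _ _ _)
    exact (isLittleO_const_id_atTop (1 : ℝ)).isBigO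
  have h2 : (fun t : ℝ => t ^ k * (1 + b * t) ^ q) =O[atTop] fun t => t ^ (k + q) := by
    simpa only [pow_add] using (isBigO_refl (fun t : ℝ => t ^ k) atTop).mul (h1.pow q)
  have h3 := h2.trans (isLittleO_pow_exp_pos_mul_atTop (k + q) (half_pos hc)).isBigO
  refine (h3.mul (isBigO_refl (fun t : ℝ => Real.exp (-(c * t))) atTop)).congr_right fun t => ?_
  rw [← Real.exp_add]
  congr 1
  ring

theorem integrableOn_pow_mul_exp_neg (k q : ℕ) (b : ℝ) {c : ℝ} (hc : 0 < c) :
    MeasureTheory.IntegrableOn (fun t : ℝ => t ^ k * (1 + b * t) ^ q * Real.exp (-(c * t)))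
      (Set.Ioi 0) :=
  integrable_of_isBigO_exp_neg (half_pos hc) (by fun_prop) (isBigO_pow_mul_exp_neg k q b hc)

theorem tendsto_pow_mul_exp_neg (k q : ℕ) (b : ℝ) {c : ℝ} (hc : 0 < c) :
    Tendsto (fun t : ℝ => t ^ k * (1 + b * t) ^ q * Real.exp (-(c * t))) atTop (𝓝 0) := by
  refine (isBigO_pow_mul_exp_neg k q b hc).trans_tendsto ?_
  refine Real.tendsto_exp_atBot.comp ?_
  exact (tendsto_id).const_mul_atTop_of_neg (by linarith)

theorem mul_ofReal_mem_phaseCone {φ m : ℝ} {x : ℂ} (hx : x ∈ phaseCone φ m) {t : ℝ} (ht : 0 < t) :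
    x * t ∈ phaseCone φ m := by
  change |(exp (-(I * φ)) * x).im| < m * (exp (-(I * φ)) * x).re at hx
  change |(exp (-(I * φ)) * (x * t)).im| < m * (exp (-(I * φ)) * (x * t)).re
  rw [← mul_assoc, mul_comm _ (t : ℂ), im_ofReal_mul, re_ofReal_mul, abs_mul, abs_of_pos ht]
  nlinarith

variable {H : Type*} [NormedAddCommGroup H] [NormedSpace ℂ H]

theorem norm_laplace_term_le {φ m : ℝ} {G : ℂ → H} {c : ℝ} {q : ℕ}
    (hG : ∀ x ∈ phaseCone φ m, ‖G x‖ ≤ c * (1 + ‖x‖) ^ q) {w : ℂ} (hw : w ∈ phaseCone φ m) (v : ℂ)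
    (k : ℕ) {t : ℝ} (ht : 0 < t) :
    ‖(exp (-(v * t)) * t ^ k) • G (w * t)‖ ≤
      c * (t ^ k * (1 + ‖w‖ * t) ^ q * Real.exp (-(v.re * t))) := by
  rw [norm_smul, norm_mul, norm_pow, norm_real, Real.norm_of_nonneg ht.le, norm_exp]
  have h1 := hG _ (mul_ofReal_mem_phaseCone hw ht)
  rw [norm_mul, norm_real, Real.norm_of_nonneg ht.le] at h1
  rw [neg_re, re_mul_ofReal]
  calc _ ≤ Real.exp (-(v.re * t)) * t ^ k * (c * (1 + ‖w‖ * t) ^ q) := by gcongr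
    _ = _ := by ring

theorem continuousOn_laplace_term {φ m : ℝ} {G : ℂ → H} (hGc : ContinuousOn G (phaseCone φ m))
    {w : ℂ} (hw : w ∈ phaseCone φ m) (v : ℂ) (k : ℕ) :
    ContinuousOn (fun t : ℝ => (exp (-(v * t)) * t ^ k) • G (w * t)) (Set.Ioi 0) :=
  ContinuousOn.smul (by fun_prop) (hGc.comp (f := fun t : ℝ => w * t) (by fun_prop)
    fun _ ht => mul_ofReal_mem_phaseCone hw ht)

theorem integrableOn_laplace_term {φ m : ℝ} {G : ℂ → H} (hGc : ContinuousOn G (phaseCone φ m))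
    (hG : ∃ (c : ℝ) (q : ℕ), 0 ≤ c ∧ ∀ x ∈ phaseCone φ m, ‖G x‖ ≤ c * (1 + ‖x‖) ^ q) {w v : ℂ}
    (hw : w ∈ phaseCone φ m) (hv : 0 < v.re) (k : ℕ) :
    MeasureTheory.IntegrableOn (fun t : ℝ => (exp (-(v * t)) * t ^ k) • G (w * t))
      (Set.Ioi 0) := by
  obtain ⟨c, q, -, hG⟩ := hG
  refine MeasureTheory.Integrable.mono'
    ((integrableOn_pow_mul_exp_neg k q ‖w‖ hv).const_mul c)
    ((continuousOn_laplace_term hGc hw v k).aestronglyMeasurable measurableSet_Ioi) ?_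
  filter_upwards [MeasureTheory.ae_restrict_mem measurableSet_Ioi] with t ht
  exact norm_laplace_term_le hG hw v k ht

theorem tendsto_laplace_term {φ m : ℝ} {G : ℂ → H}
    (hG : ∃ (c : ℝ) (q : ℕ), 0 ≤ c ∧ ∀ x ∈ phaseCone φ m, ‖G x‖ ≤ c * (1 + ‖x‖) ^ q) {w v : ℂ}
    (hw : w ∈ phaseCone φ m) (hv : 0 < v.re) (k : ℕ) :
    Tendsto (fun t : ℝ => (exp (-(v * t)) * t ^ k) • G (w * t)) atTop (𝓝 0) := by
  obtain ⟨c, q, -, hG⟩ := hG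
  refine squeeze_zero_norm' ?_ (by simpa using (tendsto_pow_mul_exp_neg k q ‖w‖ hv).const_mul c)
  filter_upwards [eventually_gt_atTop 0] with t ht
  exact norm_laplace_term_le hG hw v k ht

/-- The Laplace integral `z⁻¹ ∫ e^{-x/z} G(x) dx` along the ray `ℝ_{>0} z v`. -/
noncomputable def laplaceIntegral (G : ℂ → H) (z v : ℂ) : H :=
  ∫ t in Set.Ioi (0 : ℝ), (exp (-(v * t)) * v) • G (z * v * t)

/-- The directions `v` for which the Laplace integral converges at `z`. -/
def laplaceDirections (φ m : ℝ) (z : ℂ) : Set ℂ := {v | z * v ∈ phaseCone φ m ∧ 0 < v.re}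

theorem isOpen_laplaceDirections (φ m : ℝ) (z : ℂ) : IsOpen (laplaceDirections φ m z) :=
  ((isOpen_phaseCone φ m).preimage (by fun_prop : Continuous fun v => z * v)).inter
    (isOpen_lt continuous_const continuous_re)

theorem convex_laplaceDirections (φ m : ℝ) (z : ℂ) : Convex ℝ (laplaceDirections φ m z) := by
  intro v hv w hw a b ha hb hab
  refine ⟨?_, ?_⟩
  · have := convex_phaseCone φ m hv.1 hw.1 ha hb hab
    convert this using 1
    simp only [real_smul]
    ring
  · exact convex_halfSpace_re_gt 0 hv.2 hw.2 ha hb hab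

theorem hasDerivAt_ofReal_mul (w : ℂ) (t : ℝ) : HasDerivAt (fun t : ℝ => w * (t : ℂ)) w t := by
  simpa using (ofRealCLM.hasDerivAt (x := t)).const_mul w

theorem hasDerivAt_exp_neg_mul (v : ℂ) (t : ℝ) :
    HasDerivAt (fun t : ℝ => exp (-(v * t))) (-v * exp (-(v * t))) t := by
  refine ((hasDerivAt_ofReal_mul v t).neg.cexp).congr_deriv ?_
  simp only [Pi.neg_apply]
  ring

variable {φ m : ℝ} {G : ℂ → H}

/-- The Laplace integral does not depend on the direction. -/
theorem hasDerivAt_laplaceIntegral_direction [CompleteSpace H]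
    (hGa : AnalyticOnNhd ℂ G (phaseCone φ m))
    (hG : ∃ (c : ℝ) (q : ℕ), 0 ≤ c ∧ ∀ x ∈ phaseCone φ m, ‖G x‖ ≤ c * (1 + ‖x‖) ^ q)
    (hG' : ∃ (c : ℝ) (q : ℕ), 0 ≤ c ∧ ∀ x ∈ phaseCone φ m, ‖deriv G x‖ ≤ c * (1 + ‖x‖) ^ q)
    {z v : ℂ} (hv : v ∈ laplaceDirections φ m z) :
    HasDerivAt (laplaceIntegral G z) 0 v := by
  obtain ⟨r, hr, hball⟩ := Metric.mem_nhds_iff.1 (((isOpen_laplaceDirections φ m z).inter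
    (isOpen_lt continuous_const continuous_re : IsOpen {w : ℂ | v.re / 2 < w.re})).mem_nhds
      ⟨hv, by have := hv.2; change v.re / 2 < v.re; linarith⟩)
  obtain ⟨c, q, hc, hGb⟩ := hG
  have hv2 : 0 < v.re / 2 := half_pos hv.2
  have hmem : ∀ w ∈ Metric.ball v r, ∀ t : ℝ, 0 < t → z * w * t ∈ phaseCone φ m :=
    fun w hw t ht => mul_ofReal_mem_phaseCone (hball hw).1.1 ht
  have hd : ∀ w ∈ Metric.ball v r, ∀ t : ℝ, 0 < t →
      HasDerivAt (fun w => (exp (-(w * t)) * w) • G (z * w * t))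
        ((exp (-(w * t)) * t ^ 0) • G (z * w * t) - w • ((exp (-(w * t)) * t ^ 1) • G (z * w * t)) +
          (w * z) • ((exp (-(w * t)) * t ^ 1) • deriv G (z * w * t))) w := by
    intro w hw t ht
    have h1 := (hGa _ (hmem w hw t ht)).differentiableAt.hasDerivAt
    have h2 : HasDerivAt (fun w : ℂ => z * w * t) (z * t) w := by
      simpa using ((hasDerivAt_id w).const_mul z).mul_const (t : ℂ)
    have h3 : HasDerivAt (fun w : ℂ => exp (-(w * t))) (exp (-(w * t)) * (-t)) w := by
      have := (((hasDerivAt_id w).mul_const (t : ℂ)).neg).cexp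
      simpa using this
    refine ((h3.mul (hasDerivAt_id w)).smul (h1.scomp w h2)).congr_deriv ?_
    simp only [id, Function.comp, Pi.mul_apply]
    module
  have key := hasDerivAt_integral_of_differentiableOn (t₀ := v)
    (F := fun w (t : ℝ) => (exp (-(w * t)) * w) • G (z * w * t))
    (μ := MeasureTheory.volume.restrict (Set.Ioi (0 : ℝ)))
    (bound := fun t => (‖v‖ + r) * (c * (t ^ 0 * (1 + (‖z‖ * (‖v‖ + r)) * t) ^ q *
      Real.exp (-(v.re / 2 * t))))) hr ?_ ?_ ?_ ?_
  · refine key.congr_deriv ?_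
    have hint : ∀ k, MeasureTheory.IntegrableOn
        (fun t : ℝ => (exp (-(v * t)) * t ^ k) • G (z * v * t)) (Set.Ioi 0) := fun k =>
      integrableOn_laplace_term hGa.continuousOn ⟨c, q, hc, hGb⟩ hv.1 hv.2 k
    have hint' : ∀ k, MeasureTheory.IntegrableOn
        (fun t : ℝ => (exp (-(v * t)) * t ^ k) • deriv G (z * v * t)) (Set.Ioi 0) := fun k =>
      integrableOn_laplace_term hGa.deriv.continuousOn hG' hv.1 hv.2 k
    -- The `v`-derivative of the integrand is the `t`-derivative of `t e^{-vt} G(zvt)`, which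
    -- vanishes at both ends. The value at `t = 0` is set by hand, because `G` is not controlled at
    -- the vertex of the cone.
    have hftc := MeasureTheory.integral_Ioi_of_hasDerivAt_of_tendsto (a := 0)
      (f := fun t : ℝ => if t = 0 then 0 else (exp (-(v * t)) * t ^ 1) • G (z * v * t))
      (f' := fun t : ℝ => (exp (-(v * t)) * t ^ 0) • G (z * v * t) -
        v • ((exp (-(v * t)) * t ^ 1) • G (z * v * t)) +
          (v * z) • ((exp (-(v * t)) * t ^ 1) • deriv G (z * v * t))) (m := 0) ?_ ?_ ?_ ?_
    · rw [if_pos rfl, sub_zero] at hftc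
      rw [← hftc]
      refine MeasureTheory.setIntegral_congr_fun measurableSet_Ioi fun t ht => ?_
      exact (hd v (Metric.mem_ball_self hr) t ht).deriv
    · have h1 : Tendsto (fun t : ℝ => c * (t ^ 1 * (1 + ‖z * v‖ * t) ^ q * Real.exp (-(v.re * t))))
          (𝓝[Set.Ici 0] 0) (𝓝 0) := by
        have : Continuous fun t : ℝ =>
          c * (t ^ 1 * (1 + ‖z * v‖ * t) ^ q * Real.exp (-(v.re * t))) := by fun_prop
        simpa using (this.tendsto 0).mono_left nhdsWithin_le_nhds
      change Tendsto _ _ (𝓝 (if (0 : ℝ) = 0 then (0 : H) else _))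
      rw [if_pos rfl]
      refine squeeze_zero_norm' ?_ h1
      filter_upwards [self_mem_nhdsWithin] with t ht
      rcases (Set.mem_Ici.1 ht).eq_or_lt with rfl | ht'
      · simp
      · rw [if_neg ht'.ne']
        exact norm_laplace_term_le hGb hv.1 v 1 ht'
    · intro t ht
      have ht' : (0 : ℝ) < t := ht
      have h1 := (hGa _ (hmem v (Metric.mem_ball_self hr) t ht)).differentiableAt.hasDerivAt
      have h2 := ((hasDerivAt_exp_neg_mul v t).mul (ofRealCLM.hasDerivAt (x := t))).smul
        (h1.scomp t (hasDerivAt_ofReal_mul (z * v) t))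
      refine HasDerivAt.congr_of_eventuallyEq (h2.congr_deriv ?_) ?_
      · simp only [ofRealCLM_apply, ofReal_one, Function.comp, Pi.mul_apply]
        module
      · filter_upwards [eventually_gt_nhds ht'] with s hs
        rw [if_neg hs.ne', pow_one]
        rfl
    · exact ((hint 0).sub ((hint 1).smul v)).add ((hint' 1).smul (v * z))
    · refine (tendsto_laplace_term ⟨c, q, hc, hGb⟩ hv.1 hv.2 1).congr' ?_
      filter_upwards [eventually_gt_atTop 0] with t ht
      rw [if_neg ht.ne']
  · intro w hw
    refine ContinuousOn.aestronglyMeasurable ?_ measurableSet_Ioi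
    refine ContinuousOn.smul (by fun_prop) ?_
    exact hGa.continuousOn.comp (f := fun t : ℝ => z * w * t) (by fun_prop) fun t ht =>
      hmem w hw t ht
  · filter_upwards [MeasureTheory.ae_restrict_mem measurableSet_Ioi] with t ht w hw
    have ht' : (0 : ℝ) < t := ht
    have h1 := norm_laplace_term_le hGb (hball hw).1.1 w 0 ht
    have hwn : ‖w‖ ≤ ‖v‖ + r := by
      have := norm_le_norm_add_norm_sub v w
      rw [mem_ball_iff_norm, norm_sub_rev] at hw
      linarith
    have hwr : v.re / 2 ≤ w.re := le_of_lt (hball hw).2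
    rw [pow_zero, mul_one] at h1
    rw [mul_comm (exp _), mul_smul, norm_smul]
    refine (mul_le_mul hwn h1 (norm_nonneg _) (by positivity)).trans ?_
    rw [norm_mul]
    have h5 : 0 ≤ ‖v‖ + r := by positivity
    have h6 : 0 ≤ ‖z‖ * ‖w‖ * t := by positivity
    rw [pow_zero, one_mul, one_mul]
    gcongr
  · exact ((integrableOn_pow_mul_exp_neg 0 q _ hv2).const_mul c).const_mul _
  · filter_upwards [MeasureTheory.ae_restrict_mem measurableSet_Ioi] with t ht w hw
    exact (hd w hw t ht).differentiableAt.differentiableWithinAt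

/-- The admissible directions form an open convex set, on which the derivative in the direction is
zero. -/
theorem laplaceIntegral_direction_eq [CompleteSpace H] (hGa : AnalyticOnNhd ℂ G (phaseCone φ m))
    (hG : ∃ (c : ℝ) (q : ℕ), 0 ≤ c ∧ ∀ x ∈ phaseCone φ m, ‖G x‖ ≤ c * (1 + ‖x‖) ^ q)
    (hG' : ∃ (c : ℝ) (q : ℕ), 0 ≤ c ∧ ∀ x ∈ phaseCone φ m, ‖deriv G x‖ ≤ c * (1 + ‖x‖) ^ q)
    {z v w : ℂ} (hv : v ∈ laplaceDirections φ m z) (hw : w ∈ laplaceDirections φ m z) :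
    laplaceIntegral G z v = laplaceIntegral G z w := by
  have hd : ∀ v ∈ laplaceDirections φ m z, HasDerivAt (laplaceIntegral G z) 0 v :=
    fun v hv => hasDerivAt_laplaceIntegral_direction hGa hG hG' hv
  refine (isOpen_laplaceDirections φ m z).is_const_of_deriv_eq_zero
    (convex_laplaceDirections φ m z).isPreconnected
    (fun v hv => (hd v hv).differentiableAt.differentiableWithinAt) (fun v hv => ?_) hv hw
  exact (hd v hv).deriv

end Laplace

/-! ### The Laplace transform turns the equations of the Borel transform into flatness. -/

namespace SemisimpleFrame

variable {ι H : Type*} [Fintype ι] [DecidableEq ι] [NormedAddCommGroup H] [NormedSpace ℂ H]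
  {S : Set H} {Φ : SemisimpleFrame ι H S} {i : ι} {U : Set H} {φ m : ℝ} {y : H → ℂ → H}

namespace IsBorelTransform

theorem analytic_slice (hy : Φ.IsBorelTransform i U φ m y) {τ : H} (hτ : τ ∈ U) :
    AnalyticOnNhd ℂ (y τ) (phaseCone φ m) := fun x hx =>
  (hy.analytic (τ, x) ⟨hτ, hx⟩).fun_comp (f := fun x : ℂ => (τ, x))
    (analyticAt_const.prod analyticAt_id)

theorem bound (hy : Φ.IsBorelTransform i U φ m y) : ∃ (c : ℝ) (q : ℕ), 0 ≤ c ∧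
    ∀ τ ∈ U, ∀ x ∈ phaseCone φ m, ‖y τ x‖ ≤ c * (1 + ‖x‖) ^ q := by
  simpa [borelPartial] using hy.remainder 0

theorem bound_slice (hy : Φ.IsBorelTransform i U φ m y) {τ : H} (hτ : τ ∈ U) :
    ∃ (c : ℝ) (q : ℕ), 0 ≤ c ∧ ∀ x ∈ phaseCone φ m, ‖y τ x‖ ≤ c * (1 + ‖x‖) ^ q := by
  obtain ⟨c, q, hc, h⟩ := hy.bound
  exact ⟨c, q, hc, h τ hτ⟩

theorem deriv_bound_slice (hy : Φ.IsBorelTransform i U φ m y) {τ : H} (hτ : τ ∈ U) :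
    ∃ (c : ℝ) (q : ℕ), 0 ≤ c ∧ ∀ x ∈ phaseCone φ m, ‖deriv (y τ) x‖ ≤ c * (1 + ‖x‖) ^ q := by
  obtain ⟨c, q, hc, h⟩ := hy.deriv_bound
  exact ⟨c, q, hc, h τ hτ⟩

/-- A dominating function for the Laplace integrals at points near `z`. -/
theorem exists_laplace_bound (hy : Φ.IsBorelTransform i U φ m y) {v : ℂ} (hv : 0 < v.re) (L : ℝ) :
    ∃ b : ℝ → ℝ, MeasureTheory.IntegrableOn b (Set.Ioi 0) ∧ ∀ τ ∈ U, ∀ z : ℂ, ‖z‖ ≤ L →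
      z * v ∈ phaseCone φ m → ∀ t : ℝ, 0 < t →
        ‖(exp (-(v * t)) * v) • y τ (z * v * t)‖ ≤ b t := by
  obtain ⟨c, q, hc, hb⟩ := hy.bound
  refine ⟨_, ((integrableOn_pow_mul_exp_neg 0 q (L * ‖v‖) hv).const_mul c).const_mul ‖v‖,
    fun τ hτ z hz hzv t ht => ?_⟩
  have h1 := norm_laplace_term_le (hb τ hτ) hzv v 0 ht
  rw [pow_zero, mul_one] at h1
  rw [mul_comm (exp _), mul_smul, norm_smul]
  refine mul_le_mul_of_nonneg_left (h1.trans ?_) (norm_nonneg v)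
  rw [norm_mul]
  gcongr

theorem continuousOn_term (hy : Φ.IsBorelTransform i U φ m y) {τ : H} (hτ : τ ∈ U) {z v : ℂ}
    (hv : z * v ∈ phaseCone φ m) :
    ContinuousOn (fun t : ℝ => (exp (-(v * t)) * v) • y τ (z * v * t)) (Set.Ioi 0) :=
  ContinuousOn.smul (by fun_prop) ((hy.analytic_slice hτ).continuousOn.comp
    (f := fun t : ℝ => z * v * t) (by fun_prop) fun _ ht => mul_ofReal_mem_phaseCone hv ht)

theorem analyticOnNhd_laplaceIntegral [FiniteDimensional ℂ H]
    (hy : Φ.IsBorelTransform i U φ m y) (hU : IsOpen U) {v : ℂ} (hv : 0 < v.re) :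
    AnalyticOnNhd ℂ (fun p : H × ℂ => laplaceIntegral (y p.1) p.2 v)
      (U ×ˢ {z | z * v ∈ phaseCone φ m}) := by
  have : CompleteSpace H := FiniteDimensional.complete ℂ H
  have hZ : IsOpen {z | z * v ∈ phaseCone φ m} :=
    (isOpen_phaseCone φ m).preimage (by fun_prop : Continuous fun z : ℂ => z * v)
  refine analyticOnNhd_integral
    (F := fun (p : H × ℂ) (t : ℝ) => (exp (-(v * t)) * v) • y p.1 (p.2 * v * t)) (hU.prod hZ)
    (fun p hp => (hy.continuousOn_term hp.1 hp.2).aestronglyMeasurable measurableSet_Ioi) ?_ ?_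
  · filter_upwards [MeasureTheory.ae_restrict_mem measurableSet_Ioi] with t ht p hp
    refine analyticAt_const.fun_smul ?_
    have h1 := hy.analytic (p.1, p.2 * v * t) ⟨hp.1, mul_ofReal_mem_phaseCone hp.2 ht⟩
    exact h1.fun_comp (f := fun p : H × ℂ => (p.1, p.2 * v * (t : ℂ)))
      (analyticAt_fst.prod ((analyticAt_snd.mul analyticAt_const).mul analyticAt_const))
  · rintro ⟨τ, z⟩ hp
    obtain ⟨b, hbi, hb⟩ := hy.exists_laplace_bound hv (‖z‖ + 1)
    refine ⟨(U ×ˢ {z | z * v ∈ phaseCone φ m}) ∩ {p | ‖p.2‖ < ‖z‖ + 1}, ?_, b, hbi, ?_⟩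
    · refine ((hU.prod hZ).inter (isOpen_lt (by fun_prop) (by fun_prop))).mem_nhds ⟨hp, ?_⟩
      change ‖z‖ < ‖z‖ + 1
      linarith
    · filter_upwards [MeasureTheory.ae_restrict_mem measurableSet_Ioi] with t ht p hp'
      exact hb p.1 hp'.1.1 p.2 (le_of_lt hp'.2) hp'.1.2 t ht

variable [CompleteSpace H]

/-- Integration by parts in the Laplace integral. -/
theorem smul_laplaceIntegral_deriv (hy : Φ.IsBorelTransform i U φ m y) {τ : H}
    (hτ : τ ∈ U) {z v : ℂ} (hzv : v ∈ laplaceDirections φ m z) :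
    z • laplaceIntegral (deriv (y τ)) z v = laplaceIntegral (y τ) z v - Φ.Ψ i τ := by
  have hGa := hy.analytic_slice hτ
  have hint := integrableOn_laplace_term hGa.continuousOn (hy.bound_slice hτ) hzv.1 hzv.2 0
  have hint' := integrableOn_laplace_term hGa.deriv.continuousOn (hy.deriv_bound_slice hτ)
    hzv.1 hzv.2 0
  -- The prescribed value `Ψ i` at `t = 0` is the limit of `y` at the vertex, by the remainder
  -- estimate with `n = 1`; it is the boundary term.
  have hftc := MeasureTheory.integral_Ioi_of_hasDerivAt_of_tendsto (a := 0)
    (f := fun t : ℝ => if t = 0 then Φ.Ψ i τ else (exp (-(v * t)) * t ^ 0) • y τ (z * v * t))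
    (f' := fun t : ℝ => (z * v) • ((exp (-(v * t)) * t ^ 0) • deriv (y τ) (z * v * t)) -
      v • ((exp (-(v * t)) * t ^ 0) • y τ (z * v * t))) (m := 0) ?_ ?_ ?_ ?_
  · rw [MeasureTheory.integral_sub (hint'.fun_smul (z * v)) (hint.fun_smul v),
      MeasureTheory.integral_smul, MeasureTheory.integral_smul, if_pos rfl, zero_sub] at hftc
    have h1 : laplaceIntegral (deriv (y τ)) z v =
        v • ∫ t in Set.Ioi (0 : ℝ), (exp (-(v * t)) * t ^ 0) • deriv (y τ) (z * v * t) := by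
      rw [laplaceIntegral, ← MeasureTheory.integral_smul]
      refine MeasureTheory.setIntegral_congr_fun measurableSet_Ioi fun t _ => ?_
      simp only [pow_zero, mul_one, smul_smul]
      rw [mul_comm]
    have h2 : laplaceIntegral (y τ) z v =
        v • ∫ t in Set.Ioi (0 : ℝ), (exp (-(v * t)) * t ^ 0) • y τ (z * v * t) := by
      rw [laplaceIntegral, ← MeasureTheory.integral_smul]
      refine MeasureTheory.setIntegral_congr_fun measurableSet_Ioi fun t _ => ?_
      simp only [pow_zero, mul_one, smul_smul]
      rw [mul_comm]
    rw [h1, h2, smul_smul]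
    linear_combination (norm := module) hftc
  · obtain ⟨c, q, hc, hb⟩ := hy.remainder 1
    change Tendsto _ _ (𝓝 (if (0 : ℝ) = 0 then Φ.Ψ i τ else _))
    rw [if_pos rfl]
    have h1 : Tendsto (fun t : ℝ => (exp (-(v * t)) : ℂ) • Φ.Ψ i τ) (𝓝[Set.Ici 0] 0)
        (𝓝 (Φ.Ψ i τ)) := by
      have : Continuous fun t : ℝ => (exp (-(v * t)) : ℂ) • Φ.Ψ i τ := by fun_prop
      simpa using (this.tendsto 0).mono_left nhdsWithin_le_nhds
    have h2 : Tendsto (fun t : ℝ => Real.exp (-(v.re * t)) * (c * (‖z * v‖ * t) ^ 1 *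
        (1 + ‖z * v‖ * t) ^ q)) (𝓝[Set.Ici 0] 0) (𝓝 0) := by
      have : Continuous fun t : ℝ => Real.exp (-(v.re * t)) * (c * (‖z * v‖ * t) ^ 1 *
        (1 + ‖z * v‖ * t) ^ q) := by fun_prop
      simpa using (this.tendsto 0).mono_left nhdsWithin_le_nhds
    have h3 : Tendsto (fun t : ℝ => (if t = 0 then Φ.Ψ i τ else
        (exp (-(v * t)) * t ^ 0) • y τ (z * v * t)) - (exp (-(v * t)) : ℂ) • Φ.Ψ i τ)
        (𝓝[Set.Ici 0] 0) (𝓝 0) := by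
      refine squeeze_zero_norm' ?_ h2
      filter_upwards [self_mem_nhdsWithin] with t ht
      rcases (Set.mem_Ici.1 ht).eq_or_lt with rfl | ht'
      · simp
      · rw [if_neg ht'.ne', pow_zero, mul_one, ← smul_sub, norm_smul, norm_exp, neg_re,
          re_mul_ofReal]
        refine mul_le_mul_of_nonneg_left ?_ (Real.exp_pos _).le
        have h4 := hb τ hτ _ (mul_ofReal_mem_phaseCone hzv.1 ht')
        rw [norm_mul (z * v), norm_real, Real.norm_of_nonneg ht] at h4
        simpa [borelPartial, coeff_zero] using h4
    simpa using h3.add h1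
  · intro t ht
    have ht' : (0 : ℝ) < t := ht
    have h1 := (hGa _ (mul_ofReal_mem_phaseCone hzv.1 ht')).differentiableAt.hasDerivAt
    have h2 := (hasDerivAt_exp_neg_mul v t).smul (h1.scomp t (hasDerivAt_ofReal_mul (z * v) t))
    refine HasDerivAt.congr_of_eventuallyEq (h2.congr_deriv ?_) ?_
    · simp only [Function.comp]
      module
    · filter_upwards [eventually_gt_nhds ht'] with s hs
      rw [if_neg hs.ne', pow_zero, mul_one]
      rfl
  · exact (hint'.smul (z * v)).sub (hint.smul v)
  · refine (tendsto_laplace_term (hy.bound_slice hτ) hzv.1 hzv.2 0).congr' ?_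
    filter_upwards [eventually_gt_atTop 0] with t ht
    rw [if_neg ht.ne']

omit [CompleteSpace H] in
theorem integrableOn_term (hy : Φ.IsBorelTransform i U φ m y) {τ : H} (hτ : τ ∈ U)
    {z v : ℂ} (hzv : v ∈ laplaceDirections φ m z) :
    MeasureTheory.IntegrableOn (fun t : ℝ => (exp (-(v * t)) * v) • y τ (z * v * t))
      (Set.Ioi 0) := by
  have := (integrableOn_laplace_term (hy.analytic_slice hτ).continuousOn (hy.bound_slice hτ)
    hzv.1 hzv.2 0).smul v
  refine this.congr (Eventually.of_forall fun t => ?_)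
  simp only [Pi.smul_apply, pow_zero, mul_one, smul_smul]
  rw [mul_comm]

theorem integrableOn_deriv_term (hy : Φ.IsBorelTransform i U φ m y) {τ : H} (hτ : τ ∈ U)
    {z v : ℂ} (hzv : v ∈ laplaceDirections φ m z) :
    MeasureTheory.IntegrableOn (fun t : ℝ => (exp (-(v * t)) * v) • deriv (y τ) (z * v * t))
      (Set.Ioi 0) := by
  have := (integrableOn_laplace_term (hy.analytic_slice hτ).deriv.continuousOn
    (hy.deriv_bound_slice hτ) hzv.1 hzv.2 0).smul v
  refine this.congr (Eventually.of_forall fun t => ?_)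
  simp only [Pi.smul_apply, pow_zero, mul_one, smul_smul]
  rw [mul_comm]

/-- Under the Laplace transform `z ∂_z` becomes `x d/dx`, so the transform of `x y'` is that of `(V
- u) y' - μ y`. Integration by parts replaces the transform of `y'` by `z⁻¹` times that of `y` minus
`Ψ i`, and `V - u` kills `Ψ i`. -/
theorem euler_laplaceIntegral (hy : Φ.IsBorelTransform i U φ m y) (hUS : U ⊆ S)
    {τ : H} (hτ : τ ∈ U) {z v : ℂ} (hz : z ≠ 0) (hzv : v ∈ laplaceDirections φ m z) :
    ∃ g' : H, HasDerivAt (fun z => laplaceIntegral (y τ) z v) g' z ∧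
      z • g' + z⁻¹ • (Φ.u i τ • laplaceIntegral (y τ) z v - Φ.V τ (laplaceIntegral (y τ) z v)) +
        Φ.mu (laplaceIntegral (y τ) z v) = 0 := by
  have hGa := hy.analytic_slice hτ
  have hZ : IsOpen {z | z * v ∈ phaseCone φ m} :=
    (isOpen_phaseCone φ m).preimage (by fun_prop : Continuous fun z : ℂ => z * v)
  obtain ⟨r, hr, hball⟩ := Metric.mem_nhds_iff.1 (hZ.mem_nhds hzv.1)
  obtain ⟨b, hbi, hb⟩ := hy.exists_laplace_bound hzv.2 (‖z‖ + r)
  have hd : ∀ w ∈ Metric.ball z r, ∀ t : ℝ, 0 < t →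
      HasDerivAt (fun w => (exp (-(v * t)) * v) • y τ (w * v * t))
        ((exp (-(v * t)) * v) • (v * t) • deriv (y τ) (w * v * t)) w := by
    intro w hw t ht
    have h1 := (hGa _ (mul_ofReal_mem_phaseCone (hball hw) ht)).differentiableAt.hasDerivAt
    have h2 : HasDerivAt (fun w : ℂ => w * v * t) (v * t) w := by
      simpa using ((hasDerivAt_id w).mul_const v).mul_const (t : ℂ)
    exact (h1.scomp w h2).const_smul _
  have key := hasDerivAt_integral_of_differentiableOn (t₀ := z) (bound := b)
    (F := fun w (t : ℝ) => (exp (-(v * t)) * v) • y τ (w * v * t))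
    (μ := MeasureTheory.volume.restrict (Set.Ioi (0 : ℝ))) hr
    (fun w hw => (hy.continuousOn_term hτ (hball hw)).aestronglyMeasurable measurableSet_Ioi)
    ?_ hbi ?_
  · refine ⟨_, key, ?_⟩
    have hP := hy.integrableOn_deriv_term hτ hzv
    have hg := hy.integrableOn_term hτ hzv
    have h1 := hy.smul_laplaceIntegral_deriv hτ hzv
    have h2 : z • (∫ t in Set.Ioi (0 : ℝ),
          deriv (fun w => (exp (-(v * t)) * v) • y τ (w * v * t)) z) =
        Φ.V τ (laplaceIntegral (deriv (y τ)) z v) - Φ.u i τ • laplaceIntegral (deriv (y τ)) z v -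
          Φ.mu (laplaceIntegral (y τ) z v) := by
      rw [laplaceIntegral, laplaceIntegral, ← ContinuousLinearMap.integral_comp_comm _ hP,
        ← ContinuousLinearMap.integral_comp_comm _ hg, ← MeasureTheory.integral_smul,
        ← MeasureTheory.integral_smul,
        ← MeasureTheory.integral_sub ((Φ.V τ).integrable_comp hP) (hP.fun_smul (Φ.u i τ)),
        ← MeasureTheory.integral_sub
          (MeasureTheory.Integrable.sub' ((Φ.V τ).integrable_comp hP) (hP.fun_smul (Φ.u i τ)))
          (Φ.mu.integrable_comp hg)]
      refine MeasureTheory.setIntegral_congr_fun measurableSet_Ioi fun t ht => ?_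
      have h3 := hy.euler τ hτ _ (mul_ofReal_mem_phaseCone hzv.1 (t := t) ht)
      simp only [(hd z (Metric.mem_ball_self hr) t ht).deriv, map_smul]
      have h4 := congrArg (fun x => (exp (-(v * t)) * v) • x) h3
      linear_combination (norm := module) h4
    rw [h2]
    have h5 : ∀ L : H →L[ℂ] H, L (Φ.Ψ i τ) = 0 →
        L (laplaceIntegral (deriv (y τ)) z v) = z⁻¹ • L (laplaceIntegral (y τ) z v) := by
      intro L hL
      have h6 := congrArg L h1
      rw [map_smul, map_sub, hL, sub_zero] at h6
      rw [← h6, inv_smul_smul₀ hz]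
    have h7 := h5 (Φ.u i τ • ContinuousLinearMap.id ℂ H - Φ.V τ) (by
      simp [Φ.V_Ψ τ (hUS hτ)])
    simp only [sub_apply, smul_apply, ContinuousLinearMap.id_apply] at h7
    rw [← h7]
    module
  · filter_upwards [MeasureTheory.ae_restrict_mem measurableSet_Ioi] with t ht w hw
    refine hb τ hτ w ?_ (hball hw) t ht
    have := norm_le_norm_add_norm_sub z w
    rw [mem_ball_iff_norm, norm_sub_rev] at hw
    linarith
  · filter_upwards [MeasureTheory.ae_restrict_mem measurableSet_Ioi] with t ht w hw
    exact (hd w hw t ht).differentiableAt.differentiableWithinAt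

/-- The same argument for the derivative in `τ`: the boundary term `Ψ i` is killed by `du_i(a) - C τ
a`. -/
theorem hasDerivAt_laplaceIntegral_line (hy : Φ.IsBorelTransform i U φ m y) (hU : IsOpen U)
    (hUS : U ⊆ S) {τ : H} (hτ : τ ∈ U) {z v : ℂ} (hz : z ≠ 0)
    (hzv : v ∈ laplaceDirections φ m z) (a : H) :
    HasDerivAt (fun s : ℂ => laplaceIntegral (y (τ + s • a)) z v)
      (z⁻¹ • (fderiv ℂ (Φ.u i) τ a • laplaceIntegral (y τ) z v -
        Φ.C τ a (laplaceIntegral (y τ) z v))) 0 := by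
  have hT : IsOpen {s : ℂ | τ + s • a ∈ U} := hU.preimage (by fun_prop)
  obtain ⟨r, hr, hball⟩ := Metric.mem_nhds_iff.1
    (hT.mem_nhds (show (0 : ℂ) ∈ {s : ℂ | τ + s • a ∈ U} by simpa using hτ))
  obtain ⟨b, hbi, hb⟩ := hy.exists_laplace_bound hzv.2 ‖z‖
  have hline : ∀ s : ℂ, HasDerivAt (fun s : ℂ => τ + s • a) a s := fun s => by
    simpa using ((hasDerivAt_id s).smul_const a).const_add τ
  have hd : ∀ s ∈ Metric.ball (0 : ℂ) r, ∀ t : ℝ, 0 < t →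
      HasDerivAt (fun s : ℂ => (exp (-(v * t)) * v) • y (τ + s • a) (z * v * t))
        ((exp (-(v * t)) * v) • fderiv ℂ (fun σ => y σ (z * v * t)) (τ + s • a) a) s := by
    intro s hs t ht
    have h1 : AnalyticAt ℂ (fun σ => y σ (z * v * t)) (τ + s • a) :=
      (hy.analytic (τ + s • a, z * v * t) ⟨hball hs, mul_ofReal_mem_phaseCone hzv.1 ht⟩).fun_comp
        (f := fun σ : H => (σ, z * v * (t : ℂ))) (analyticAt_id.prod analyticAt_const)
    exact (h1.differentiableAt.hasFDerivAt.comp_hasDerivAt s (hline s)).const_smul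
      (exp (-(v * t)) * v)
  have key := hasDerivAt_integral_of_differentiableOn (t₀ := 0) (bound := b)
    (F := fun (s : ℂ) (t : ℝ) => (exp (-(v * t)) * v) • y (τ + s • a) (z * v * t))
    (μ := MeasureTheory.volume.restrict (Set.Ioi (0 : ℝ))) hr
    (fun s hs => (hy.continuousOn_term (hball hs) hzv.1).aestronglyMeasurable measurableSet_Ioi)
    ?_ hbi ?_
  · refine key.congr_deriv ?_
    have hP := hy.integrableOn_deriv_term hτ hzv
    have h1 := hy.smul_laplaceIntegral_deriv hτ hzv
    set L : H →L[ℂ] H := fderiv ℂ (Φ.u i) τ a • ContinuousLinearMap.id ℂ H - Φ.C τ a with hL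
    have hLΨ : L (Φ.Ψ i τ) = 0 := by
      simp [hL, Φ.C_Ψ τ (hUS hτ)]
    have h6 := congrArg L h1
    rw [map_smul, map_sub, hLΨ, sub_zero] at h6
    have h7 : fderiv ℂ (Φ.u i) τ a • laplaceIntegral (y τ) z v -
        Φ.C τ a (laplaceIntegral (y τ) z v) = L (laplaceIntegral (y τ) z v) := by
      simp [hL]
    rw [h7, ← h6, inv_smul_smul₀ hz, laplaceIntegral,
      ← ContinuousLinearMap.integral_comp_comm _ hP]
    refine MeasureTheory.setIntegral_congr_fun measurableSet_Ioi fun t ht => ?_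
    have h8 := hy.fderiv_eq τ hτ _ (mul_ofReal_mem_phaseCone hzv.1 (t := t) ht) a
    simp only [(hd 0 (Metric.mem_ball_self hr) t ht).deriv, zero_smul, add_zero, h8, map_smul, hL,
      sub_apply, smul_apply, ContinuousLinearMap.id_apply]
  · filter_upwards [MeasureTheory.ae_restrict_mem measurableSet_Ioi] with t ht s hs
    exact hb _ (hball hs) z le_rfl hzv.1 t ht
  · filter_upwards [MeasureTheory.ae_restrict_mem measurableSet_Ioi] with t ht s hs
    exact (hd s hs t ht).differentiableAt.differentiableWithinAt

end IsBorelTransform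

end SemisimpleFrame

/-! ### Asymptotics of the Borel sum in a sector of opening greater than `π`. -/

theorem integrableOn_exp_neg_mul_pow {v : ℂ} (hv : 0 < v.re) (k : ℕ) :
    MeasureTheory.IntegrableOn (fun t : ℝ => exp (-(v * t)) * (t : ℂ) ^ k) (Set.Ioi 0) := by
  refine MeasureTheory.Integrable.mono' (integrableOn_pow_mul_exp_neg k 0 0 hv) ?_ ?_
  · exact ContinuousOn.aestronglyMeasurable (by fun_prop) measurableSet_Ioi
  · filter_upwards [MeasureTheory.ae_restrict_mem measurableSet_Ioi] with t ht
    have ht' : (0 : ℝ) < t := ht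
    rw [norm_mul, norm_pow, norm_exp, neg_re, re_mul_ofReal, norm_real,
      Real.norm_of_nonneg ht'.le]
    apply le_of_eq
    ring

theorem integral_exp_neg_mul_pow {v : ℂ} (hv : 0 < v.re) (k : ℕ) :
    v ^ (k + 1) * ∫ t in Set.Ioi (0 : ℝ), exp (-(v * t)) * (t : ℂ) ^ k = k.factorial := by
  have htend : ∀ k : ℕ, Tendsto (fun t : ℝ => exp (-(v * t)) * (t : ℂ) ^ k) atTop (𝓝 0) := by
    intro k
    refine squeeze_zero_norm' ?_ (tendsto_pow_mul_exp_neg k 0 0 hv)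
    filter_upwards [eventually_gt_atTop 0] with t ht
    rw [norm_mul, norm_pow, norm_exp, neg_re, re_mul_ofReal, norm_real, Real.norm_of_nonneg ht.le]
    apply le_of_eq
    ring
  induction k with
  | zero =>
    have h := MeasureTheory.integral_Ioi_of_hasDerivAt_of_tendsto' (a := 0)
      (f := fun t : ℝ => exp (-(v * t))) (f' := fun t : ℝ => -v * exp (-(v * t))) (m := 0)
      (fun t _ => hasDerivAt_exp_neg_mul v t)
      (by simpa [MeasureTheory.IntegrableOn] using
        (integrableOn_exp_neg_mul_pow hv 0).const_mul (-v))
      (by simpa using htend 0)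
    rw [MeasureTheory.integral_const_mul] at h
    simp only [ofReal_zero, mul_zero, neg_zero, exp_zero, zero_sub] at h
    simp only [pow_zero, mul_one, zero_add, pow_one, Nat.factorial_zero, Nat.cast_one]
    linear_combination -h
  | succ k ih =>
    have h := MeasureTheory.integral_Ioi_of_hasDerivAt_of_tendsto' (a := 0)
      (f := fun t : ℝ => exp (-(v * t)) * (t : ℂ) ^ (k + 1))
      (f' := fun t : ℝ => -v * (exp (-(v * t)) * (t : ℂ) ^ (k + 1)) +
        (k + 1) * (exp (-(v * t)) * (t : ℂ) ^ k)) (m := 0) ?_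
      (((integrableOn_exp_neg_mul_pow hv (k + 1)).const_mul (-v)).add
        ((integrableOn_exp_neg_mul_pow hv k).const_mul ((k : ℂ) + 1)))
      (htend (k + 1))
    · rw [MeasureTheory.integral_add ((integrableOn_exp_neg_mul_pow hv (k + 1)).const_mul (-v))
        ((integrableOn_exp_neg_mul_pow hv k).const_mul ((k : ℂ) + 1)),
        MeasureTheory.integral_const_mul, MeasureTheory.integral_const_mul] at h
      simp only [ofReal_zero, ne_eq, Nat.succ_ne_zero, not_false_eq_true, zero_pow, mul_zero,
        sub_zero] at h
      rw [Nat.factorial_succ, pow_succ]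
      push_cast
      rw [← ih]
      linear_combination -v ^ (k + 1) * h
    · intro t _
      have h2 : HasDerivAt (fun t : ℝ => (t : ℂ) ^ (k + 1)) ((k + 1) * (t : ℂ) ^ k) t := by
        refine ((hasDerivAt_pow (k + 1) (t : ℂ)).comp_ofReal).congr_deriv ?_
        simp
      refine ((hasDerivAt_exp_neg_mul v t).mul h2).congr_deriv ?_
      ring

/-- The Laplace transform undoes the formal Borel transform. -/
theorem integral_laplace_monomial {v : ℂ} (hv : 0 < v.re) (z : ℂ) (k : ℕ) :
    ∫ t in Set.Ioi (0 : ℝ), (exp (-(v * t)) * v) * ((z * v * t) ^ k / k.factorial) = z ^ k := by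
  have hk : (k.factorial : ℂ) ≠ 0 := by exact_mod_cast k.factorial_ne_zero
  have h2 : ∀ t ∈ Set.Ioi (0 : ℝ), (exp (-(v * t)) * v) * ((z * v * t) ^ k / k.factorial) =
      (z ^ k / k.factorial * v ^ (k + 1)) * (exp (-(v * t)) * (t : ℂ) ^ k) := by
    intro t _
    rw [mul_pow, mul_pow, pow_succ]
    ring
  rw [MeasureTheory.setIntegral_congr_fun measurableSet_Ioi h2, MeasureTheory.integral_const_mul,
    mul_assoc, integral_exp_neg_mul_pow hv]
  field_simp

theorem integrableOn_laplace_monomial {v : ℂ} (hv : 0 < v.re) (z : ℂ) (k : ℕ) :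
    MeasureTheory.IntegrableOn
      (fun t : ℝ => (exp (-(v * t)) * v) * ((z * v * t) ^ k / k.factorial)) (Set.Ioi 0) := by
  refine ((integrableOn_exp_neg_mul_pow hv k).const_mul
    (z ^ k / k.factorial * v ^ (k + 1))).congr (Eventually.of_forall fun t => ?_)
  simp only [mul_pow, pow_succ]
  ring

/-- A point of the sector `|arg z - φ| < π/2 + ε` can be rotated into a thin cone around
`ℝ_{>0} e^{iφ}` by an angle that stays away from `±π/2`. -/
theorem exists_laplaceDirection {φ m ε : ℝ} (hm : 0 < m) (hε : 2 * ε = Real.arctan m) {z : ℂ}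
    (hz : z ∈ sector φ ε) :
    ∃ v ∈ laplaceDirections φ m z, ‖v‖ = 1 ∧ Real.sin ε ≤ v.re := by
  have hπ := Real.pi_pos
  have hε0 : 0 < ε := by
    have := Real.arctan_pos.2 hm
    linarith
  have hε1 : ε < Real.pi / 4 := by
    have := Real.arctan_lt_pi_div_two m
    linarith
  set Z := exp (-(I * φ)) * z with hZ
  have hZ0 : Z ≠ 0 := mul_ne_zero (exp_ne_zero _) hz.1
  set α := arg Z with hα
  have hα1 : |α| < Real.pi / 2 + ε := hz.2
  -- The angle `α` is shared out: `κ α` stays within `π / 2 - ε`, which keeps `Re v` at least `sin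
  -- ε`, and the rest `(1 - κ) α` stays below `2 ε = arctan m`, the half-opening of the cone.
  set κ : ℝ := (Real.pi / 2 - ε) / (Real.pi / 2 + ε) with hκ
  have hden : 0 < Real.pi / 2 + ε := by linarith
  have hκ0 : 0 < κ := div_pos (by linarith) hden
  have hκ1 : (Real.pi / 2 + ε) * κ = Real.pi / 2 - ε := by
    rw [hκ]
    field_simp
  have hβ : |κ * α| ≤ Real.pi / 2 - ε := by
    rw [abs_mul, abs_of_pos hκ0]
    nlinarith
  have hκlt : κ < 1 := by
    rw [hκ, div_lt_one hden]
    linarith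
  have hγ : |α - κ * α| < Real.arctan m := by
    rw [show α - κ * α = (1 - κ) * α by ring, abs_mul, abs_of_pos (by linarith), ← hε]
    nlinarith
  have hcos : Real.sin ε ≤ Real.cos (κ * α) := by
    rw [← Real.cos_pi_div_two_sub, ← Real.cos_abs (κ * α)]
    exact Real.cos_le_cos_of_nonneg_of_le_pi (abs_nonneg _) (by linarith) hβ
  have hsin : 0 < Real.sin ε := Real.sin_pos_of_pos_of_lt_pi hε0 (by linarith)
  refine ⟨exp (((-(κ * α) : ℝ) : ℂ) * I), ⟨?_, ?_⟩, norm_exp_ofReal_mul_I _, ?_⟩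
  · have h1 : exp (-(I * φ)) * (z * exp (((-(κ * α) : ℝ) : ℂ) * I)) =
        (‖Z‖ : ℝ) * exp (((α - κ * α : ℝ) : ℂ) * I) := by
      rw [← mul_assoc, ← hZ]
      conv_lhs => rw [← norm_mul_exp_arg_mul_I Z]
      rw [mul_assoc, ← exp_add]
      congr 2
      push_cast
      ring
    change |(exp (-(I * φ)) * (z * exp (((-(κ * α) : ℝ) : ℂ) * I))).im| <
      m * (exp (-(I * φ)) * (z * exp (((-(κ * α) : ℝ) : ℂ) * I))).re
    rw [h1, im_ofReal_mul, re_ofReal_mul, exp_ofReal_mul_I_im, exp_ofReal_mul_I_re, abs_mul,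
      abs_of_pos (norm_pos_iff.2 hZ0)]
    have harc := Real.arctan_lt_pi_div_two m
    have hcosγ : 0 < Real.cos |α - κ * α| :=
      Real.cos_pos_of_mem_Ioo ⟨by linarith [abs_nonneg (α - κ * α)], by linarith⟩
    have htan := Real.tan_lt_tan_of_nonneg_of_lt_pi_div_two (abs_nonneg (α - κ * α)) harc hγ
    rw [Real.tan_arctan, Real.tan_eq_sin_div_cos, div_lt_iff₀ hcosγ, Real.cos_abs] at htan
    have hs : |Real.sin (α - κ * α)| = Real.sin |α - κ * α| := by
      rw [Real.abs_sin_eq_sin_abs_of_abs_le_pi]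
      linarith
    rw [hs]
    have := norm_pos_iff.2 hZ0
    nlinarith
  · rw [exp_ofReal_mul_I_re, Real.cos_neg]
    exact hsin.trans_le hcos
  · rw [exp_ofReal_mul_I_re, Real.cos_neg]
    exact hcos

namespace SemisimpleFrame

variable {ι H : Type*} [Fintype ι] [DecidableEq ι] [NormedAddCommGroup H] [NormedSpace ℂ H]
  {S : Set H} {Φ : SemisimpleFrame ι H S} {i : ι} {U : Set H} {φ m : ℝ} {y : H → ℂ → H}

namespace IsBorelTransform

/-- Watson's lemma: the partial sum is the Laplace integral of the Taylor polynomial, and a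
remainder of order `‖x‖ ^ n (1 + ‖x‖) ^ q` integrates to order `‖z‖ ^ n`. The lower bound on `Re v`
makes the constant uniform. -/
theorem exists_norm_laplaceIntegral_sub_le [CompleteSpace H] (hy : Φ.IsBorelTransform i U φ m y)
    {c₀ : ℝ} (hc₀ : 0 < c₀) (n : ℕ) :
    ∃ C : ℝ, ∀ τ ∈ U, ∀ z v : ℂ, ‖z‖ ≤ 1 → z * v ∈ phaseCone φ m → ‖v‖ = 1 → c₀ ≤ v.re →
      ‖laplaceIntegral (y τ) z v - ∑ k ∈ Finset.range n, z ^ k • Φ.coeff i k τ‖ ≤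
        C * ‖z‖ ^ n := by
  obtain ⟨c, q, hc, hb⟩ := hy.remainder n
  refine ⟨∫ t in Set.Ioi (0 : ℝ), c * (t ^ n * (1 + 1 * t) ^ q * Real.exp (-(c₀ * t))),
    fun τ hτ z v hz hzv hv hvr => ?_⟩
  have hv0 : 0 < v.re := hc₀.trans_le hvr
  have hsum : ∑ k ∈ Finset.range n, z ^ k • Φ.coeff i k τ =
      ∫ t in Set.Ioi (0 : ℝ), (exp (-(v * t)) * v) • Φ.borelPartial i n τ (z * v * t) := by
    have h1 : ∀ k, z ^ k • Φ.coeff i k τ = ∫ t in Set.Ioi (0 : ℝ),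
        ((exp (-(v * t)) * v) * ((z * v * t) ^ k / k.factorial)) • Φ.coeff i k τ := fun k => by
      rw [integral_smul_const, integral_laplace_monomial hv0]
    simp only [h1]
    rw [← MeasureTheory.integral_finsetSum]
    · simp only [borelPartial, Finset.smul_sum, smul_smul]
    · exact fun k _ => (integrableOn_laplace_monomial hv0 z k).smul_const _
  have hint : MeasureTheory.IntegrableOn
      (fun t : ℝ => (exp (-(v * t)) * v) • Φ.borelPartial i n τ (z * v * t)) (Set.Ioi 0) := by
    have : MeasureTheory.IntegrableOn (fun t : ℝ => ∑ k ∈ Finset.range n,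
        ((exp (-(v * t)) * v) * ((z * v * t) ^ k / k.factorial)) • Φ.coeff i k τ) (Set.Ioi 0) :=
      MeasureTheory.integrable_finsetSum _ fun k _ =>
        (integrableOn_laplace_monomial hv0 z k).smul_const _
    refine this.congr (Eventually.of_forall fun t => ?_)
    simp only [borelPartial, Finset.smul_sum, smul_smul]
  rw [hsum, laplaceIntegral, ← MeasureTheory.integral_sub
    (hy.integrableOn_term hτ ⟨hzv, hv0⟩) hint, mul_comm _ (‖z‖ ^ n),
    ← MeasureTheory.integral_const_mul]
  refine MeasureTheory.norm_integral_le_of_norm_le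
    (((integrableOn_pow_mul_exp_neg n q 1 hc₀).const_mul c).const_mul _) ?_
  filter_upwards [MeasureTheory.ae_restrict_mem measurableSet_Ioi] with t ht
  have ht' : (0 : ℝ) < t := ht
  have h2 := hb τ hτ _ (mul_ofReal_mem_phaseCone hzv ht)
  rw [norm_mul, norm_mul, hv, mul_one, norm_real, Real.norm_of_nonneg ht'.le] at h2
  rw [← smul_sub, norm_smul, norm_mul, hv, mul_one, norm_exp, neg_re, re_mul_ofReal]
  calc _ ≤ Real.exp (-(c₀ * t)) * (c * (‖z‖ * t) ^ n * (1 + 1 * t) ^ q) := by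
        gcongr
        refine h2.trans ?_
        gcongr
    _ = _ := by ring

/-- The Borel sum `z⁻¹ ∫ e^{-x/z} y(x) dx`. -/
noncomputable def borelSum (φ m : ℝ) (y : H → ℂ → H) (τ : H) (z : ℂ) : H :=
  open Classical in
  if h : (laplaceDirections φ m z).Nonempty then laplaceIntegral (y τ) z h.some else 0

theorem borelSum_eq [CompleteSpace H] (hy : Φ.IsBorelTransform i U φ m y) {τ : H} (hτ : τ ∈ U)
    {z v : ℂ} (hv : v ∈ laplaceDirections φ m z) :
    borelSum φ m y τ z = laplaceIntegral (y τ) z v := by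
  have h : (laplaceDirections φ m z).Nonempty := ⟨v, hv⟩
  rw [borelSum, dif_pos h]
  exact laplaceIntegral_direction_eq (hy.analytic_slice hτ) (hy.bound_slice hτ)
    (hy.deriv_bound_slice hτ) h.some_mem hv

/-- The Borel sum of the formal solution is a flat section with the expected asymptotics. -/
theorem exists_flatSection [FiniteDimensional ℂ H] (hy : Φ.IsBorelTransform i U φ m y)
    (hU : IsOpen U) (hUS : U ⊆ S) (hm : 0 < m) :
    ∃ ε : ℝ, 0 < ε ∧ ε < Real.pi / 2 ∧ ∃ Y : H → ℂ → H,
      AnalyticOnNhd ℂ (fun p : H × ℂ => Y p.1 p.2) (U ×ˢ sector φ ε) ∧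
      (∀ τ ∈ U, ∀ z ∈ sector φ ε, ∀ a,
        fderiv ℂ (fun σ => Y σ z) τ a + z⁻¹ • Φ.C τ a (Y τ z) = 0) ∧
      (∀ τ ∈ U, ∀ z ∈ sector φ ε, DifferentiableAt ℂ (Y τ) z ∧
        z • deriv (Y τ) z - z⁻¹ • Φ.V τ (Y τ z) + Φ.mu (Y τ z) = 0) ∧
      ∀ τ ∈ U, ∀ n : ℕ, (fun z => exp (Φ.u i τ / z) • Y τ z -
        ∑ k ∈ Finset.range n, z ^ k • Φ.coeff i k τ) =O[𝓝[sector φ ε] 0] fun z => z ^ n := by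
  have : CompleteSpace H := FiniteDimensional.complete ℂ H
  have harc := Real.arctan_lt_pi_div_two m
  have harc0 := Real.arctan_pos.2 hm
  set ε := Real.arctan m / 2 with hε
  have hε2 : 2 * ε = Real.arctan m := by rw [hε]; ring
  have hsin : 0 < Real.sin ε := Real.sin_pos_of_pos_of_lt_pi (by linarith)
    (by linarith [Real.pi_pos])
  set Y : H → ℂ → H := fun τ z => exp (-(Φ.u i τ / z)) • borelSum φ m y τ z with hY
  have hopen : ∀ v : ℂ, IsOpen {z | z * v ∈ phaseCone φ m} := fun v =>
    (isOpen_phaseCone φ m).preimage (by fun_prop : Continuous fun z : ℂ => z * v)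
  have hYv : ∀ {v : ℂ}, 0 < v.re → ∀ τ ∈ U, ∀ z, z * v ∈ phaseCone φ m →
      Y τ z = exp (-(Φ.u i τ / z)) • laplaceIntegral (y τ) z v := fun {v} hv τ hτ z hz => by
    rw [hY]
    simp only [hy.borelSum_eq hτ (show v ∈ laplaceDirections φ m z from ⟨hz, hv⟩)]
  have han : AnalyticOnNhd ℂ (fun p : H × ℂ => Y p.1 p.2) (U ×ˢ sector φ ε) := by
    rintro ⟨τ, z⟩ ⟨hτ, hz⟩
    obtain ⟨v, hv, -, -⟩ := exists_laplaceDirection hm hε2 hz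
    have h1 := hy.analyticOnNhd_laplaceIntegral hU hv.2 (τ, z) ⟨hτ, hv.1⟩
    have h2 : AnalyticAt ℂ (fun p : H × ℂ => exp (-(Φ.u i p.1 / p.2))) (τ, z) :=
      (((Φ.analytic_u i τ (hUS hτ)).fun_comp (f := Prod.fst) (x := (τ, z))
        analyticAt_fst).fun_div analyticAt_snd hz.1).fun_neg.cexp
    refine (h2.fun_smul h1).congr ?_
    filter_upwards [(hU.prod (hopen v)).mem_nhds
      (show (τ, z) ∈ U ×ˢ {z | z * v ∈ phaseCone φ m} from ⟨hτ, hv.1⟩)] with p hp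
    exact (hYv hv.2 p.1 hp.1 p.2 hp.2).symm
  refine ⟨ε, by linarith, by linarith, Y, han, ?_, ?_, ?_⟩
  · intro τ hτ z hz a
    obtain ⟨v, hv, -, -⟩ := exists_laplaceDirection hm hε2 hz
    have h1 := hy.hasDerivAt_laplaceIntegral_line hU hUS hτ hz.1 hv a
    have hline : HasDerivAt (fun s : ℂ => τ + s • a) a 0 := by
      simpa using ((hasDerivAt_id (0 : ℂ)).smul_const a).const_add τ
    have hu : HasDerivAt (fun s : ℂ => Φ.u i (τ + s • a)) (fderiv ℂ (Φ.u i) τ a) 0 := by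
      have h : HasFDerivAt (Φ.u i) (fderiv ℂ (Φ.u i) τ) (τ + (0 : ℂ) • a) := by
        simpa using (Φ.analytic_u i τ (hUS hτ)).differentiableAt.hasFDerivAt
      exact h.comp_hasDerivAt (0 : ℂ) hline
    have hYa : AnalyticAt ℂ (fun σ => Y σ z) τ :=
      (han (τ, z) ⟨hτ, hz⟩).fun_comp (f := fun σ : H => (σ, z))
        (analyticAt_id.prod analyticAt_const)
    have h2 : HasDerivAt (fun s : ℂ => Y (τ + s • a) z) (fderiv ℂ (fun σ => Y σ z) τ a) 0 := by
      have h : HasFDerivAt (fun σ => Y σ z) (fderiv ℂ (fun σ => Y σ z) τ) (τ + (0 : ℂ) • a) := by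
        simpa using hYa.differentiableAt.hasFDerivAt
      exact h.comp_hasDerivAt (0 : ℂ) hline
    have h3 := ((hu.div_const z).neg.cexp).smul h1
    have h4 : (fun s : ℂ => Y (τ + s • a) z) =ᶠ[𝓝 0]
        fun s => exp (-(Φ.u i (τ + s • a) / z)) • laplaceIntegral (y (τ + s • a)) z v := by
      have hT : IsOpen {s : ℂ | τ + s • a ∈ U} := hU.preimage (by fun_prop)
      filter_upwards [hT.mem_nhds (show (0 : ℂ) ∈ {s : ℂ | τ + s • a ∈ U} by simpa using hτ)]
        with s hs
      exact hYv hv.2 _ hs z hv.1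
    have h5 := h2.unique (HasDerivAt.congr_of_eventuallyEq h3 h4)
    rw [h5, hYv hv.2 τ hτ z hv.1]
    simp only [Pi.neg_apply, zero_smul, add_zero, map_smul]
    rw [div_eq_mul_inv]
    module
  · intro τ hτ z hz
    obtain ⟨v, hv, -, -⟩ := exists_laplaceDirection hm hε2 hz
    obtain ⟨g', h1, h2⟩ := hy.euler_laplaceIntegral hUS hτ hz.1 hv
    have hu : HasDerivAt (fun z : ℂ => exp (-(Φ.u i τ / z)))
        (exp (-(Φ.u i τ / z)) * (Φ.u i τ * (z⁻¹ * z⁻¹))) z := by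
      have h := (((hasDerivAt_inv hz.1).const_mul (Φ.u i τ)).neg).cexp
      simp only [Pi.neg_apply] at h
      simp only [div_eq_mul_inv]
      refine HasDerivAt.congr_deriv (f := fun z : ℂ => exp (-(Φ.u i τ * z⁻¹))) h ?_
      rw [pow_two, mul_inv]
      ring
    have h3 := hu.smul h1
    have h4 : Y τ =ᶠ[𝓝 z] fun z => exp (-(Φ.u i τ / z)) • laplaceIntegral (y τ) z v := by
      filter_upwards [(hopen v).mem_nhds hv.1] with w hw using hYv hv.2 τ hτ w hw
    have h5 := HasDerivAt.congr_of_eventuallyEq h3 h4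
    refine ⟨h5.differentiableAt, ?_⟩
    rw [h5.deriv, hYv hv.2 τ hτ z hv.1]
    have h6 := congrArg (fun x => exp (-(Φ.u i τ / z)) • x) h2
    simp only [smul_zero] at h6
    rw [← h6]
    simp only [map_smul, smul_add, smul_smul, smul_sub]
    have hzz : z * (exp (-(Φ.u i τ / z)) * (Φ.u i τ * (z⁻¹ * z⁻¹))) =
        exp (-(Φ.u i τ / z)) * (z⁻¹ * Φ.u i τ) := by
      have := hz.1
      field_simp
    rw [hzz]
    module
  · intro τ hτ n
    obtain ⟨C, hC⟩ := hy.exists_norm_laplaceIntegral_sub_le hsin n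
    refine IsBigO.of_bound C ?_
    have hz1 : ∀ᶠ z : ℂ in 𝓝[sector φ ε] 0, ‖z‖ < 1 :=
      (continuous_norm.tendsto' (0 : ℂ) 0 norm_zero).mono_left nhdsWithin_le_nhds
        |>.eventually_lt_const one_pos
    filter_upwards [hz1, self_mem_nhdsWithin] with z hz1 hz
    obtain ⟨v, hv, hvn, hvr⟩ := exists_laplaceDirection hm hε2 hz
    rw [hYv hv.2 τ hτ z hv.1, smul_smul, ← exp_add, add_neg_cancel, exp_zero, one_smul, norm_pow]
    exact hC τ hτ z v hz1.le hv.1 hvn hvr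

end IsBorelTransform

end SemisimpleFrame

/-! ### Geometry of sectors. -/

section Sector

theorem sector_mono {φ δ ε : ℝ} (h : δ ≤ ε) : sector φ δ ⊆ sector φ ε :=
  fun _ hz => ⟨hz.1, hz.2.trans_le (by linarith)⟩

theorem exp_neg_I_mul_add_pi (φ : ℝ) :
    exp (-(I * ((φ + Real.pi : ℝ) : ℂ))) = -exp (-(I * φ)) := by
  rw [show -(I * ((φ + Real.pi : ℝ) : ℂ)) = -(I * φ) - Real.pi * I by push_cast; ring, exp_sub,
    exp_pi_mul_I, div_neg, div_one]

theorem neg_mem_sector_add_pi {φ δ : ℝ} {z : ℂ} :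
    -z ∈ sector (φ + Real.pi) δ ↔ z ∈ sector φ δ := by
  change (-z ≠ 0 ∧ |arg (exp (-(I * ((φ + Real.pi : ℝ) : ℂ))) * -z)| < Real.pi / 2 + δ) ↔
    (z ≠ 0 ∧ |arg (exp (-(I * φ)) * z)| < Real.pi / 2 + δ)
  rw [exp_neg_I_mul_add_pi, neg_mul_neg, neg_ne_zero]

theorem sector_add_pi_add_pi (φ δ : ℝ) : sector (φ + Real.pi + Real.pi) δ = sector φ δ := by
  ext z
  rw [← neg_neg z, neg_mem_sector_add_pi, neg_mem_sector_add_pi, neg_neg]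

/-- In logarithmic coordinates the sector is a horizontal strip, which gives its connectedness. -/
theorem sector_eq_image {φ δ : ℝ} (hδ : δ < Real.pi / 2) :
    sector φ δ = (fun w => exp (I * φ) * exp w) '' {w : ℂ | |w.im| < Real.pi / 2 + δ} := by
  ext z
  constructor
  · intro hz
    have hZ : exp (-(I * φ)) * z ≠ 0 := mul_ne_zero (exp_ne_zero _) hz.1
    refine ⟨log (exp (-(I * φ)) * z), ?_, ?_⟩
    · change |(log (exp (-(I * φ)) * z)).im| < _
      rw [log_im]
      exact hz.2
    · simp only [exp_log hZ]
      rw [← mul_assoc, ← exp_add, add_neg_cancel, exp_zero, one_mul]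
  · rintro ⟨w, hw, rfl⟩
    have hw' : |w.im| < Real.pi / 2 + δ := hw
    obtain ⟨h1, h2⟩ := abs_lt.1 hw'
    refine ⟨mul_ne_zero (exp_ne_zero _) (exp_ne_zero _), ?_⟩
    rw [← mul_assoc, ← exp_add, neg_add_cancel, exp_zero, one_mul, ← log_im,
      log_exp (by linarith) (by linarith)]
    exact hw'

theorem isPreconnected_sector {φ δ : ℝ} (hδ : δ < Real.pi / 2) : IsPreconnected (sector φ δ) := by
  rw [sector_eq_image hδ]
  refine IsPreconnected.image (Convex.isPreconnected ?_) _ (by fun_prop)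
  have : {w : ℂ | |w.im| < Real.pi / 2 + δ} =
      {w : ℂ | w.im < Real.pi / 2 + δ} ∩ {w : ℂ | -(Real.pi / 2 + δ) < w.im} := by
    ext w
    change |w.im| < _ ↔ w.im < _ ∧ _ < w.im
    rw [abs_lt]
    exact and_comm
  rw [this]
  exact (convex_halfSpace_im_lt _).inter (convex_halfSpace_im_gt _)

theorem isOpen_sector {φ δ : ℝ} (hδ : δ < Real.pi / 2) : IsOpen (sector φ δ) := by
  refine isOpen_iff_mem_nhds.2 fun z hz => ?_
  have hZ : exp (-(I * φ)) * z ≠ 0 := mul_ne_zero (exp_ne_zero _) hz.1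
  have hslit : exp (-(I * φ)) * z ∈ slitPlane := by
    rw [mem_slitPlane_iff_arg]
    refine ⟨fun h => ?_, hZ⟩
    have := hz.2
    rw [h, abs_of_pos Real.pi_pos] at this
    linarith
  have hc : ContinuousAt (fun z => |arg (exp (-(I * φ)) * z)|) z :=
    (ContinuousAt.comp (f := fun z => exp (-(I * φ)) * z) (continuousAt_arg hslit)
      (by fun_prop)).abs
  filter_upwards [isOpen_ne.mem_nhds hz.1, hc.eventually_lt_const hz.2] with w h1 h2
  exact ⟨h1, h2⟩

/-- In a sector of opening at least `π`, one can approach `0` without `e^{c/z}` decaying. -/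
theorem exists_direction_mem_sector (φ : ℝ) {δ : ℝ} (hδ : 0 < δ) (c : ℂ) :
    ∃ d : ℂ, (∀ s : ℝ, 0 < s → s * d ∈ sector φ δ) ∧ 0 ≤ (c / d).re := by
  -- The opening exceeds `π`, so both rays `± i e^{iφ}` lie in the sector; the real parts of `c / d`
  -- along them are opposite, and one is nonnegative.
  have hmem : ∀ D : ℂ, D = I ∨ D = -I → ∀ s : ℝ, 0 < s → s * (exp (I * φ) * D) ∈ sector φ δ := by
    intro D hD s hs
    have hs' : (s : ℂ) ≠ 0 := by exact_mod_cast hs.ne'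
    have hD0 : D ≠ 0 := by
      rcases hD with rfl | rfl <;> simp
    refine ⟨mul_ne_zero hs' (mul_ne_zero (exp_ne_zero _) hD0), ?_⟩
    rw [show exp (-(I * φ)) * (s * (exp (I * φ) * D)) = s * ((exp (-(I * φ)) * exp (I * φ)) * D) by
      ring, ← exp_add, neg_add_cancel, exp_zero, one_mul, arg_real_mul _ hs]
    rcases hD with rfl | rfl
    · rw [arg_I, abs_of_pos (by positivity)]
      linarith
    · rw [arg_neg_I, abs_neg, abs_of_pos (by positivity)]
      linarith
  have hI : (c / (exp (I * φ) * I)).re = (c / exp (I * φ)).im := by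
    rw [← div_div, div_I, neg_re, mul_I_re, neg_neg]
  have hI' : (c / (exp (I * φ) * -I)).re = -(c / exp (I * φ)).im := by
    rw [mul_neg, div_neg, neg_re, hI]
  rcases le_total 0 (c / exp (I * φ)).im with h | h
  · exact ⟨_, hmem I (Or.inl rfl), by rw [hI]; exact h⟩
  · exact ⟨_, hmem (-I) (Or.inr rfl), by rw [hI']; linarith⟩

end Sector

/-! ### Duality of solutions in opposite sectors, and uniqueness. -/

namespace GromovWittenTheory

noncomputable section

variable {H D : Type*} [NormedCommRing H] [NormedAlgebra ℂ H] [FiniteDimensional ℂ H]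
  [AddCommMonoid D] [Finset.HasAntidiagonal D] {F : GromovWittenTheory H D} {B : Set H}

omit [FiniteDimensional ℂ H] in
theorem linearIndependent_of_pairing {n : ℕ} {a b : Fin n → H}
    (h : ∀ i j, F.pairing (b i) (a j) = if i = j then 1 else 0) : LinearIndependent ℂ a := by
  rw [Fintype.linearIndependent_iff]
  intro g hg i
  have := congrArg (F.pairing (b i)) hg
  simpa [map_sum, h] using this

theorem eq_of_pairing_dual {a b : Fin (Module.finrank ℂ H) → H}
    (h : ∀ i j, F.pairing (b i) (a j) = if i = j then 1 else 0) {x x' : H}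
    (hx : ∀ i, F.pairing (b i) x = F.pairing (b i) x') : x = x' := by
  have hli := linearIndependent_of_pairing h
  let e := basisOfLinearIndependentOfCardEqFinrank' a hli (Fintype.card_fin _)
  have he : ∀ j, e j = a j := fun j => by simp [e]
  have hrepr : ∀ x i, F.pairing (b i) x = e.repr x i := fun x i => by
    conv_lhs => rw [← e.sum_repr x]
    simp [map_sum, he, h]
  refine e.repr.injective (Finsupp.ext fun i => ?_)
  rw [← hrepr, ← hrepr, hx]

theorem IsFlatInZ.mono {τ : H} {S T : Set ℂ} {w : ℂ → H} (h : F.IsFlatInZ τ T w) (hST : S ⊆ T) :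
    F.IsFlatInZ τ S w := fun z hz => h z (hST hz)

omit [FiniteDimensional ℂ H] in
theorem ExpAsymptotics.mono {S T : Set ℂ} {u : Fin (Module.finrank ℂ H) → ℂ}
    {Ψ : Fin (Module.finrank ℂ H) → H} {w : Fin (Module.finrank ℂ H) → ℂ → H}
    (h : ExpAsymptotics T u Ψ w) (hST : S ⊆ T) : ExpAsymptotics S u Ψ w := fun i =>
  (h i).mono_left (nhdsWithin_mono _ hST)

/-- The pairing of flat sections in opposite sectors is constant. -/
theorem ConvergesOn.hasDerivAt_pairing_flat (hconv : F.ConvergesOn B) {τ : H} (hτ : τ ∈ B)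
    {φ δ : ℝ} {w w' : ℂ → H} (hw : F.IsFlatInZ τ (sector φ δ) w)
    (hw' : F.IsFlatInZ τ (sector (φ + Real.pi) δ) w') {z : ℂ} (hz : z ∈ sector φ δ) :
    HasDerivAt (fun z => F.pairing (w' (-z)) (w z)) 0 z := by
  obtain ⟨hd, he⟩ := hw z hz
  obtain ⟨hd', he'⟩ := hw' (-z) (neg_mem_sector_add_pi.2 hz)
  have h1 : HasDerivAt (fun z => w' (-z)) (-deriv w' (-z)) z := by
    have := hd'.hasDerivAt.scomp z (hasDerivAt_neg z)
    exact HasDerivAt.congr_deriv (f := fun z => w' (-z)) this (by simp)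
  have h2 := F.pairingCLM.hasFDerivAt_of_bilinear h1.hasFDerivAt hd.hasDerivAt.hasFDerivAt
  have h3 := h2.hasDerivAt
  refine HasDerivAt.congr_deriv (f := fun z => F.pairingCLM (w' (-z)) (w z)) h3 ?_
  -- The substitution `z ↦ -z` flips the sign of `z⁻¹ E ⋆` but not of `μ`, matching the
  -- self-adjointness of the former and the skewness of the latter.
  have hgoal : F.pairing (w' (-z)) (deriv w z) + F.pairing (-deriv w' (-z)) (w z) = 0 := by
    have hz0 := hz.1
    have e1 := congrArg (F.pairing (w' (-z))) he
    have e2 := congrArg (fun x => F.pairing x (w z)) he'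
    have e3 := hconv.pairing_star_right hτ (F.euler τ) (w' (-z)) (w z)
    have e4 := F.pairing_mu (w' (-z)) (w z)
    simp only [map_add, map_sub, map_smul, map_zero, LinearMap.add_apply, LinearMap.sub_apply,
      LinearMap.smul_apply, LinearMap.zero_apply, smul_eq_mul, inv_neg] at e1 e2
    simp only [map_neg, LinearMap.neg_apply]
    refine (mul_eq_zero.1 ?_).resolve_left hz0
    linear_combination e1 + e2 - z⁻¹ * e3 - e4
  simpa [pairingCLM_apply] using hgoal

/-- Solutions in opposite sectors with exponential asymptotics are dual to each other. -/
theorem ConvergesOn.pairing_flat (hconv : F.ConvergesOn B) {τ : H} (hτ : τ ∈ B)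
    {φ δ : ℝ} (hδ0 : 0 < δ) (hδ : δ < Real.pi / 2) {u : Fin (Module.finrank ℂ H) → ℂ}
    {Ψ : Fin (Module.finrank ℂ H) → H}
    (hΨ : ∀ i j, F.pairing (Ψ i) (Ψ j) = if i = j then 1 else 0)
    {w w' : Fin (Module.finrank ℂ H) → ℂ → H} (hw : ∀ i, F.IsFlatInZ τ (sector φ δ) (w i))
    (hwa : ExpAsymptotics (sector φ δ) u Ψ w)
    (hw' : ∀ i, F.IsFlatInZ τ (sector (φ + Real.pi) δ) (w' i))
    (hwa' : ExpAsymptotics (sector (φ + Real.pi) δ) u Ψ w') (i j : Fin (Module.finrank ℂ H))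
    {z : ℂ} (hz : z ∈ sector φ δ) :
    F.pairing (w' i (-z)) (w j z) = if i = j then 1 else 0 := by
  set p := F.pairing (w' i (-z)) (w j z) with hp
  have hder : ∀ z ∈ sector φ δ, HasDerivAt (fun z => F.pairing (w' i (-z)) (w j z)) 0 z :=
    fun z hz => hconv.hasDerivAt_pairing_flat hτ (hw j) (hw' i) hz
  have hconst : ∀ ζ ∈ sector φ δ, F.pairing (w' i (-ζ)) (w j ζ) = p := fun ζ hζ =>
    (isOpen_sector hδ).is_const_of_deriv_eq_zero (isPreconnected_sector hδ)
      (fun ζ hζ => (hder ζ hζ).differentiableAt.differentiableWithinAt)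
      (fun ζ hζ => (hder ζ hζ).deriv) hζ hz
  have hneg : Tendsto (fun z : ℂ => -z) (𝓝[sector φ δ] 0) (𝓝[sector (φ + Real.pi) δ] 0) := by
    refine tendsto_nhdsWithin_iff.2 ⟨?_, ?_⟩
    · simpa using (continuous_neg.tendsto (0 : ℂ)).mono_left nhdsWithin_le_nhds
    · filter_upwards [self_mem_nhdsWithin] with z hz using neg_mem_sector_add_pi.2 hz
  have hlim : Tendsto (fun z => exp ((u j - u i) / z) * p) (𝓝[sector φ δ] 0)
      (𝓝 (F.pairing (Ψ i) (Ψ j))) := by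
    have hc : Continuous fun p : H × H => F.pairingCLM p.1 p.2 := by fun_prop
    have h1 := (hc.tendsto (Ψ i, Ψ j)).comp (((hwa' i).comp hneg).prodMk_nhds (hwa j))
    refine h1.congr' ?_
    filter_upwards [self_mem_nhdsWithin] with ζ hζ
    simp only [Function.comp, pairingCLM_apply, map_smul, smul_apply, smul_eq_mul]
    rw [hconst ζ hζ, ← mul_assoc, ← exp_add]
    congr 2
    rw [div_neg, sub_div]
    ring
  rw [hΨ] at hlim
  -- If `u j = u i`, the exponential is `1` and the constant `p` equals its limit. Otherwise the
  -- limit is `0`, and along a ray where the exponential has modulus at least one this forces `p =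
  -- 0`.
  obtain ⟨d, hd, hre⟩ := exists_direction_mem_sector φ hδ0 (u j - u i)
  have hpath : Tendsto (fun s : ℝ => (s : ℂ) * d) (𝓝[>] 0) (𝓝[sector φ δ] 0) := by
    refine tendsto_nhdsWithin_iff.2 ⟨?_, ?_⟩
    · have : Continuous fun s : ℝ => (s : ℂ) * d := by fun_prop
      simpa using (this.tendsto 0).mono_left nhdsWithin_le_nhds
    · filter_upwards [self_mem_nhdsWithin] with s hs using hd s hs
  have hlim' := hlim.comp hpath
  by_cases huij : u j = u i
  · have : (fun s : ℝ => exp ((u j - u i) / (s * d)) * p) = fun _ => p := by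
      funext s
      rw [huij, sub_self, zero_div, exp_zero, one_mul]
    rw [Function.comp_def, this] at hlim'
    exact tendsto_nhds_unique tendsto_const_nhds hlim'
  · have hij : i ≠ j := fun h => huij (by rw [h])
    rw [if_neg hij] at hlim' ⊢
    have h0 : ‖p‖ ≤ 0 := by
      refine ge_of_tendsto (by simpa using hlim'.norm) ?_
      filter_upwards [self_mem_nhdsWithin] with s hs
      have hs' : (0 : ℝ) < s := hs
      simp only [norm_exp]
      refine le_mul_of_one_le_left (norm_nonneg _) (Real.one_le_exp ?_)
      rw [mul_comm, ← div_div, div_ofReal_re]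
      positivity
    exact norm_le_zero_iff.1 h0

/-- Both families pair to `δ` with the same solutions `w'` in the opposite sector, and these
pairings determine a vector. -/
theorem ConvergesOn.eq_of_flat (hconv : F.ConvergesOn B) {τ : H} (hτ : τ ∈ B)
    {φ δ : ℝ} (hδ0 : 0 < δ) (hδ : δ < Real.pi / 2) {u : Fin (Module.finrank ℂ H) → ℂ}
    {Ψ : Fin (Module.finrank ℂ H) → H}
    (hΨ : ∀ i j, F.pairing (Ψ i) (Ψ j) = if i = j then 1 else 0)
    {y w w' : Fin (Module.finrank ℂ H) → ℂ → H} (hy : ∀ i, F.IsFlatInZ τ (sector φ δ) (y i))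
    (hya : ExpAsymptotics (sector φ δ) u Ψ y) (hw : ∀ i, F.IsFlatInZ τ (sector φ δ) (w i))
    (hwa : ExpAsymptotics (sector φ δ) u Ψ w)
    (hw' : ∀ i, F.IsFlatInZ τ (sector (φ + Real.pi) δ) (w' i))
    (hwa' : ExpAsymptotics (sector (φ + Real.pi) δ) u Ψ w') (i : Fin (Module.finrank ℂ H))
    {z : ℂ} (hz : z ∈ sector φ δ) : w i z = y i z := by
  have h1 := fun j k => hconv.pairing_flat hτ hδ0 hδ hΨ hy hya hw' hwa' j k hz
  refine eq_of_pairing_dual (a := fun j => y j z) (b := fun j => w' j (-z)) h1 fun j => ?_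
  rw [h1, hconv.pairing_flat hτ hδ0 hδ hΨ hw hwa hw' hwa' j i hz]

end

end GromovWittenTheory

/-! ### A common domain for all the solutions, and the conclusion. -/

theorem AdmissiblePhase.add_pi {ι : Type*} {φ : ℝ} {u : ι → ℂ} (h : AdmissiblePhase φ u) :
    AdmissiblePhase (φ + Real.pi) u := by
  rintro i j ⟨r, hr, he⟩
  refine h j i ⟨r, hr, ?_⟩
  rw [← he, exp_neg_I_mul_add_pi]
  ring

theorem Real.exists_pos_forall_le {ι : Type*} [Finite ι] {R : ι → ℝ} (hR : ∀ i, 0 < R i) :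
    ∃ r, 0 < r ∧ ∀ i, r ≤ R i := by
  have h : ∀ᶠ r in 𝓝[>] (0 : ℝ), ∀ i, r ≤ R i := eventually_all.2 fun i => by
    filter_upwards [Ioo_mem_nhdsGT (hR i)] with r hr using hr.2.le
  obtain ⟨r, h1, h2⟩ := (h.and self_mem_nhdsWithin).exists
  exact ⟨r, h2, h1⟩

namespace SemisimpleFrame

variable {ι H : Type*} [Fintype ι] [DecidableEq ι] [NormedAddCommGroup H] [NormedSpace ℂ H]
  [FiniteDimensional ℂ H] {S : Set H} (Φ : SemisimpleFrame ι H S)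

/-- The flat sections attached to an admissible direction, on a common domain. -/
theorem exists_flatSections {τ₀ : H} (hτ₀ : τ₀ ∈ S) {φ : ℝ}
    (hφ : AdmissiblePhase φ fun i => Φ.u i τ₀) :
    ∃ R ε : ℝ, 0 < R ∧ 0 < ε ∧ ε < Real.pi / 2 ∧ Metric.ball τ₀ R ⊆ S ∧ ∃ Y : ι → H → ℂ → H, ∀ i,
      AnalyticOnNhd ℂ (fun p : H × ℂ => Y i p.1 p.2) (Metric.ball τ₀ R ×ˢ sector φ ε) ∧
      (∀ τ ∈ Metric.ball τ₀ R, ∀ z ∈ sector φ ε, ∀ a,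
        fderiv ℂ (fun σ => Y i σ z) τ a + z⁻¹ • Φ.C τ a (Y i τ z) = 0) ∧
      (∀ τ ∈ Metric.ball τ₀ R, ∀ z ∈ sector φ ε, DifferentiableAt ℂ (Y i τ) z ∧
        z • deriv (Y i τ) z - z⁻¹ • Φ.V τ (Y i τ z) + Φ.mu (Y i τ z) = 0) ∧
      ∀ τ ∈ Metric.ball τ₀ R, ∀ n : ℕ,
        (fun z => exp (Φ.u i τ / z) • Y i τ z - ∑ k ∈ Finset.range n, z ^ k • Φ.coeff i k τ)
          =O[𝓝[sector φ ε] 0] fun z => z ^ n := by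
  choose R hR hRS m hm y hy using fun i => Φ.exists_isBorelTransform i hτ₀ fun j => hφ j i
  choose ε hε hε' Y hY using fun i => (hy i).exists_flatSection Metric.isOpen_ball (hRS i) (hm i)
  -- With no index there is no aperture to bound `ε` from above, so an arbitrary one is chosen.
  rcases isEmpty_or_nonempty ι with hι | ⟨⟨i₀⟩⟩
  · obtain ⟨r, hr, hrS⟩ := Metric.isOpen_iff.1 Φ.isOpen τ₀ hτ₀
    exact ⟨r, Real.pi / 4, hr, by positivity, by linarith [Real.pi_pos], hrS, Y,
      fun i => (hι.false i).elim⟩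
  obtain ⟨r, hr, hrR⟩ := Real.exists_pos_forall_le hR
  obtain ⟨e, he, heε⟩ := Real.exists_pos_forall_le hε
  have hb := fun i => Metric.ball_subset_ball (x := τ₀) (hrR i)
  have hs := fun i => sector_mono (φ := φ) (heε i)
  refine ⟨r, e, hr, he, (heε i₀).trans_lt (hε' i₀), (hb i₀).trans (hRS i₀), Y, fun i => ?_⟩
  obtain ⟨h1, h2, h3, h4⟩ := hY i
  exact ⟨h1.mono (Set.prod_mono (hb i) (hs i)), fun τ hτ z hz => h2 τ (hb i hτ) z (hs i hz),
    fun τ hτ z hz => h3 τ (hb i hτ) z (hs i hz),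
    fun τ hτ n => (h4 τ (hb i hτ) n).mono (nhdsWithin_mono _ (hs i))⟩

end SemisimpleFrame

theorem tendsto_of_isBigO_expansion {H : Type*} [NormedAddCommGroup H] [NormedSpace ℂ H]
    {S : Set ℂ} {f : ℂ → H} {r : ℕ → H}
    (h : ∀ n : ℕ, (fun z => f z - ∑ k ∈ Finset.range n, z ^ k • r k) =O[𝓝[S] 0] fun z => z ^ n) :
    Tendsto f (𝓝[S] 0) (𝓝 (r 0)) := by
  have h1 := h 1
  simp only [Finset.sum_range_one, pow_zero, one_smul, pow_one] at h1
  have h2 := h1.trans_tendsto (tendsto_id.mono_left nhdsWithin_le_nhds)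
  exact tendsto_sub_nhds_zero_iff.1 h2

theorem proposition2p3 {H D : Type*} [NormedCommRing H] [NormedAlgebra ℂ H]
    [FiniteDimensional ℂ H] [AddCommMonoid D] [Finset.HasAntidiagonal D]
    (F : GromovWittenTheory H D)
    (B : Set H) (hB : IsOpen B) (τ₀ : H) (hτ₀ : τ₀ ∈ B)
    (hconv : F.ConvergesOn B) (hss : ∀ τ ∈ B, F.IsSemisimpleAt τ)
    (Ψ₀ : Fin (Module.finrank ℂ H) → H) (hΨ₀ : F.IsNormalizedIdempotents τ₀ Ψ₀)
    (u₀ : Fin (Module.finrank ℂ H) → ℂ)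
    (hu₀ : ∀ i, F.star τ₀ (F.euler τ₀) (Ψ₀ i) = u₀ i • Ψ₀ i)
    (φ : ℝ) (hφ : AdmissiblePhase φ u₀) :
    ∃ (B' : Set H) (ε : ℝ) (Ψ : H → Fin (Module.finrank ℂ H) → H)
      (u : H → Fin (Module.finrank ℂ H) → ℂ),
      -- a smaller neighbourhood of `τ₀`, with the analytic normalized idempotents that extend
      -- the given ones at `τ₀`, and the eigenvalues of `E ⋆_τ`
      B' ⊆ B ∧ IsOpen B' ∧ τ₀ ∈ B' ∧ 0 < ε ∧ ε < Real.pi / 2 ∧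
      Ψ τ₀ = Ψ₀ ∧ u τ₀ = u₀ ∧ AnalyticOnNhd ℂ Ψ B' ∧ AnalyticOnNhd ℂ u B' ∧
      (∀ τ ∈ B', F.IsNormalizedIdempotents τ (Ψ τ) ∧
        ∀ i, F.star τ (F.euler τ) (Ψ τ i) = u τ i • Ψ τ i) ∧
      -- the fundamental solutions associated to `e^{iφ}` and `-e^{iφ}`, unique and dual
      ∃ y y' : Fin (Module.finrank ℂ H) → H → ℂ → H,
        F.IsAsymptoticallyExponential B' φ ε u Ψ y ∧
        F.IsAsymptoticallyExponential B' (φ + Real.pi) ε u Ψ y' ∧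
        F.IsUniqueAsymptoticallyExponential B' φ ε u Ψ y ∧
        F.IsUniqueAsymptoticallyExponential B' (φ + Real.pi) ε u Ψ y' ∧
        (∀ τ ∈ B', ∀ z ∈ sector φ ε, ∀ i j,
          F.pairing (y' i τ (-z)) (y j τ z) = if i = j then 1 else 0) ∧
        -- `τ₀` is not a turning point: the formal solution is analytic in `τ`, and is the
        -- asymptotic expansion of `Y_τ(z)`
        ∃ r : Fin (Module.finrank ℂ H) → ℕ → H → H,
          ∀ i, (∀ τ ∈ B', r i 0 τ = Ψ τ i) ∧ F.IsFormalSolution B' (fun τ => u τ i) (r i) ∧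
            ∀ τ ∈ B', ∀ m : ℕ,
              (fun z => exp (u τ i / z) • y i τ z - ∑ k ∈ Finset.range m, z ^ k • r i k τ)
                =O[𝓝[sector φ ε] 0] fun z => z ^ m := by
  have : CompleteSpace H := FiniteDimensional.complete ℂ H
  obtain ⟨R₀, hR₀, hR₀B, Φ, hC, hV, hmu, hQ, hΨτ₀, hid⟩ :=
    hconv.exists_semisimpleFrame hB hss hτ₀ hΨ₀
  have hmem : τ₀ ∈ Metric.ball τ₀ R₀ := Metric.mem_ball_self hR₀
  have hstar : ∀ τ ∈ Metric.ball τ₀ R₀, ∀ a b, Φ.C τ a b = F.star τ a b := fun τ hτ a b => by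
    rw [hC, hconv.starCLM_apply (hR₀B hτ)]
  have heuler : ∀ τ ∈ Metric.ball τ₀ R₀, ∀ a, Φ.V τ a = F.star τ (F.euler τ) a :=
    fun τ hτ a => by rw [← hstar τ hτ, hV, hC]; rfl
  have hgrad : ∀ a, Φ.mu a = F.mu a := fun a => by rw [hmu, F.muCLM_apply]
  have hpair : ∀ τ ∈ Metric.ball τ₀ R₀, ∀ i j,
      F.pairing (Φ.Ψ i τ) (Φ.Ψ j τ) = if i = j then 1 else 0 := fun τ hτ i j => by
    rw [← F.pairingCLM_apply, ← hQ, Φ.Q_Ψ τ hτ]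
  -- Pairing the two eigenvalue equations with `Ψ_i` identifies the given eigenvalues, so that
  -- admissibility applies to the frame.
  have hu : (fun i => Φ.u i τ₀) = u₀ := funext fun i => by
    have h1 : Φ.u i τ₀ • Φ.Ψ i τ₀ = u₀ i • Φ.Ψ i τ₀ := by
      rw [← Φ.V_Ψ τ₀ hmem, heuler τ₀ hmem, hΨτ₀, hu₀]
    have h2 := congrArg (F.pairing (Φ.Ψ i τ₀)) h1
    simpa [hpair τ₀ hmem] using h2
  rw [← hu] at hφ
  obtain ⟨R₁, ε₁, hR₁, hε₁, hε₁', hR₁S, y, hy⟩ := Φ.exists_flatSections hmem hφ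
  obtain ⟨R₂, ε₂, hR₂, hε₂, hε₂', hR₂S, y', hy'⟩ := Φ.exists_flatSections hmem hφ.add_pi
  set B' := Metric.ball τ₀ (min R₁ R₂)
  set ε := min ε₁ ε₂
  have hB₁ : B' ⊆ Metric.ball τ₀ R₁ := Metric.ball_subset_ball (min_le_left _ _)
  have hB₂ : B' ⊆ Metric.ball τ₀ R₂ := Metric.ball_subset_ball (min_le_right _ _)
  have hB₀ : B' ⊆ Metric.ball τ₀ R₀ := hB₁.trans hR₁S
  have hBB : B' ⊆ B := hB₀.trans hR₀B
  have hs₁ : ∀ φ, sector φ ε ⊆ sector φ ε₁ := fun φ => sector_mono (min_le_left _ _)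
  have hs₂ : ∀ φ, sector φ ε ⊆ sector φ ε₂ := fun φ => sector_mono (min_le_right _ _)
  have hε : 0 < ε := lt_min hε₁ hε₂
  have hε' : ε < Real.pi / 2 := (min_le_left _ _).trans_lt hε₁'
  have hflat : ∀ i, F.IsFlatSection B' (sector φ ε) (y i) := fun i =>
    ⟨(hy i).1.mono (Set.prod_mono hB₁ (hs₁ _)),
      fun τ hτ z hz a => by
        rw [← hstar τ (hB₀ hτ)]
        exact (hy i).2.1 τ (hB₁ hτ) z (hs₁ _ hz) a,
      fun τ hτ z hz => by
        rw [← heuler τ (hB₀ hτ), ← hgrad]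
        exact (hy i).2.2.1 τ (hB₁ hτ) z (hs₁ _ hz)⟩
  have hflat' : ∀ i, F.IsFlatSection B' (sector (φ + Real.pi) ε) (y' i) := fun i =>
    ⟨(hy' i).1.mono (Set.prod_mono hB₂ (hs₂ _)),
      fun τ hτ z hz a => by
        rw [← hstar τ (hB₀ hτ)]
        exact (hy' i).2.1 τ (hB₂ hτ) z (hs₂ _ hz) a,
      fun τ hτ z hz => by
        rw [← heuler τ (hB₀ hτ), ← hgrad]
        exact (hy' i).2.2.1 τ (hB₂ hτ) z (hs₂ _ hz)⟩
  have hexp : ∀ τ ∈ B', GromovWittenTheory.ExpAsymptotics (sector φ ε) (fun i => Φ.u i τ)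
      (fun i => Φ.Ψ i τ) fun i => y i τ := fun τ hτ i => by
    simp only [← Φ.coeff_zero]
    exact (tendsto_of_isBigO_expansion ((hy i).2.2.2 τ (hB₁ hτ))).mono_left
      (nhdsWithin_mono _ (hs₁ _))
  have hexp' : ∀ τ ∈ B', GromovWittenTheory.ExpAsymptotics (sector (φ + Real.pi) ε)
      (fun i => Φ.u i τ) (fun i => Φ.Ψ i τ) fun i => y' i τ := fun τ hτ i => by
    simp only [← Φ.coeff_zero]
    exact (tendsto_of_isBigO_expansion ((hy' i).2.2.2 τ (hB₂ hτ))).mono_left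
      (nhdsWithin_mono _ (hs₂ _))
  have hdual : ∀ τ ∈ B', ∀ z ∈ sector φ ε, ∀ i j,
      F.pairing (y' i τ (-z)) (y j τ z) = if i = j then 1 else 0 := fun τ hτ z hz i j =>
    hconv.pairing_flat (hBB hτ) hε hε' (hpair τ (hB₀ hτ)) (fun i => (hflat i).2.2 τ hτ) (hexp τ hτ)
      (fun i => (hflat' i).2.2 τ hτ) (hexp' τ hτ) i j hz
  have hdual' : ∀ τ ∈ B', ∀ z ∈ sector (φ + Real.pi) ε, ∀ i j,
      F.pairing (y i τ (-z)) (y' j τ z) = if i = j then 1 else 0 := fun τ hτ z hz i j => by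
    have hz' : -z ∈ sector φ ε := by rwa [← neg_mem_sector_add_pi, neg_neg]
    have h := hdual τ hτ (-z) hz' j i
    rw [neg_neg] at h
    rw [F.pairing_comm, h]
    simp only [eq_comm]
  refine ⟨B', ε, fun τ i => Φ.Ψ i τ, fun τ i => Φ.u i τ, hBB, Metric.isOpen_ball,
    Metric.mem_ball_self (lt_min hR₁ hR₂), hε, hε', funext hΨτ₀, hu,
    fun τ hτ => AnalyticAt.pi fun i => Φ.analytic_Ψ i τ (hB₀ hτ),
    fun τ hτ => AnalyticAt.pi fun i => Φ.analytic_u i τ (hB₀ hτ),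
    fun τ hτ => ⟨hid τ (hB₀ hτ), fun i => ?_⟩, y, y',
    ⟨⟨hflat, fun τ hτ z hz =>
      GromovWittenTheory.linearIndependent_of_pairing (hdual τ hτ z hz)⟩, hexp⟩,
    ⟨⟨hflat', fun τ hτ z hz =>
      GromovWittenTheory.linearIndependent_of_pairing (hdual' τ hτ z hz)⟩, hexp'⟩,
    fun τ hτ δ hδ hδε w hw hwa i z hz => ?_, fun τ hτ δ hδ hδε w hw hwa i z hz => ?_, hdual,
    Φ.coeff, fun i => ⟨fun τ hτ => congrFun (Φ.coeff_zero i) τ,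
      ⟨fun k => (Φ.analytic_coeff i k).mono hB₀, fun τ hτ => ⟨?_, fun k => ?_, fun a => ⟨?_,
        fun k => ?_⟩⟩⟩, fun τ hτ m => ?_⟩⟩
  · rw [← heuler τ (hB₀ hτ), Φ.V_Ψ τ (hB₀ hτ)]
  · exact hconv.eq_of_flat (hBB hτ) hδ (hδε.trans_lt hε') (hpair τ (hB₀ hτ))
      (fun i => ((hflat i).2.2 τ hτ).mono (sector_mono hδε)) ((hexp τ hτ).mono (sector_mono hδε))
      hw hwa (fun i => ((hflat' i).2.2 τ hτ).mono (sector_mono hδε))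
      ((hexp' τ hτ).mono (sector_mono hδε)) i hz
  -- The roles are exchanged: the direction opposite to `φ + π` is `φ + 2π`, whose sector is that of
  -- `φ`.
  · refine hconv.eq_of_flat (w' := fun i => y i τ) (hBB hτ) hδ (hδε.trans_lt hε')
      (hpair τ (hB₀ hτ)) (fun i => ((hflat' i).2.2 τ hτ).mono (sector_mono hδε))
      ((hexp' τ hτ).mono (sector_mono hδε)) hw hwa ?_ ?_ i hz
    · rw [sector_add_pi_add_pi]
      exact fun i => ((hflat i).2.2 τ hτ).mono (sector_mono hδε)
    · rw [sector_add_pi_add_pi]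
      exact (hexp τ hτ).mono (sector_mono hδε)
  · rw [Φ.coeff_zero, ← heuler τ (hB₀ hτ), Φ.V_Ψ τ (hB₀ hτ)]
  · rw [← heuler τ (hB₀ hτ), ← hgrad]
    linear_combination (norm := module) -Φ.V_coeff i k (hB₀ hτ)
  · rw [Φ.coeff_zero, ← hstar τ (hB₀ hτ), Φ.C_Ψ τ (hB₀ hτ)]
  · rw [← hstar τ (hB₀ hτ), Φ.fderiv_coeff i k (hB₀ hτ)]
    module
  · exact ((hy i).2.2.2 τ (hB₁ hτ) m).mono (nhdsWithin_mono _ (hs₁ _))
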